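/- Let $m>3$ be odd and let $R=\mathrm{GR}(4,m)=\mathbb Z_4[X]/(h)$ be the Galois ring, where $h\in\mathbb Z_4[X]$ is any monic polynomial of degree $m$ that is irreducible modulo $2$. Let $\mathcal T=\{z\in R: z^{2^m}=z\}$ be the Teichmüller set; every $z\in R$ is uniquely $z=x+2y$ with $x,y\in\mathcal T$, and the trace $\mathrm{Tr}:R\to\mathbb Z_4$ is $\mathrm{Tr}(z)=\sum_{j=0}^{m-1}(x^{2^j}+2y^{2^j})$. For $t\in\{0,1,2,3\}$ let $D_t=\{x\in\mathcal T:\mathrm{Tr}(x)=t\}=\{d_1,\dots,d_n\}$ (with $d_1,\dots,d_n$ distinct) and $$\mathcal C_{D_t}=\{(\mathrm{Tr}(ud_1),\dots,\mathrm{Tr}(ud_n)):u\in R\}\subseteq\mathbb Z_4^n .$$ The Lee weight of $c\in\mathbb Z_4^n$ is $\omega_L(c)=n-\mathrm{Re}\sum_{j=1}^n i^{c_j}$, the Lee distance of $x$ and $y$ is $\omega_L(x-y)$, and $d_L$ denotes the minimum Lee distance between distinct codewords. Put $\sigma=0$ if $3\nmid m$ and $\sigma=-3$ if $3\mid m$;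 put $\tau=i^{(m-1)/2}$ if $m\equiv1\pmod 4$ and $\tau=i^{(m+1)/2}$ if $m\equiv3\pmod 4$ (so $\tau=\pm1$). Then $\mathcal C_{D_t}$ has the following length $n$, number of codewords and minimum Lee distance. | $t$ | $n$ | number of codewords | $d_L$ | |---|---|---|---| | $0$ | $2^{m-2}+2^{\frac{m-3}2}\tau$ | $4^{m-1}$ | $2^{m-2}+2^{\frac{m-3}2}(\tau-2)$ | | $1$ | $2^{m-2}+2^{\frac{m-3}2}i^{m-1}\tau$ | $4^m$ | $2^{m-2}+2^{\frac{m-3}2}(i^{m-1}\tau-2)$ | | $2$ | $2^{m-2}-2^{\frac{m-3}2}\tau$ | $2^{2m-1}$ | $2^{m-2}-2^{\frac{m-3}2}(\tau+2)$ | | $3$ | $2^{m-2}-2^{\frac{m-3}2}i^{m-1}\tau$ | $4^m$ | $2^{m-2}-2^{\frac{m-3}2}(i^{m-1}\tau+2)$ | Moreover, the Lee weight distribution of $\mathcal C_{D_t}$ is given by the tables below. A row with $\pm$ stands for two rows, one for the upper and one for the lower signs. When several rows of a table have the same weight, their frequencies are added; weights not in the table do not occur. For $t=0$: | Lee weight |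 frequency | |---|---| | $0$ | $1$ | | $2^{m-2}$ | $2^{m-2}+2^{\frac{m-3}2}\tau-1$ | | $2^{m-2}+2^{\frac{m-1}2}\tau$ | $2^{m-2}-2^{\frac{m-3}2}\tau$ | | $2^{m-2}+2^{\frac{m-3}2}\tau$ | $2^{m-4}(3\cdot2^{m-1}-5+3\sigma)-2^{\frac{m-3}2}(2^{m-2}-1)\tau$ | | $2^{m-2}+2^{\frac{m-3}2}(\tau\pm1)$ | $2^{m-3}(2^{m-1}\mp2^{\frac{m+1}2}-1-\sigma\pm2\tau)$ | | $2^{m-2}+2^{\frac{m-3}2}(\tau\pm2)$ | $2^{m-5}(2^{m-1}+1+\sigma\mp4\tau)+2^{\frac{m-5}2}(2^{m-2}-1)(\tau\mp2)$ | For $t=2$: | Lee weight | frequency | |---|---| | $0$ | $1$ | | $2^{m-2}$ | $2^{m-1}-1$ | | $2^{m-1}-2^{\frac{m-1}2}\tau$ | $1$ | | $2^{m-2}-2^{\frac{m-1}2}\tau$ | $2^{m-1}-1$ | | $2^{m-2}-2^{\frac{m-3}2}\tau$ | $2^{m-3}(3\cdot2^{m-1}-1+3\sigma)+2^{\frac{m-1}2}(2^{m-2}-1)\tau$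 | | $2^{m-2}-2^{\frac{m-3}2}(\tau\pm1)$ | $2^{m-2}(2^{m-1}-1-\sigma)$ (each) | | $2^{m-2}-2^{\frac{m-3}2}(\tau\pm2)$ | $2^{m-4}(2^{m-1}-3+\sigma)-2^{\frac{m-7}2}(2^m-4)\tau$ (each) | For $t=1$ and $t=3$: | Lee weight | frequency | |---|---| | $0$ | $1$ | | $2^{m-1}-2^{\frac{m-1}2}i^{m+t}\tau$ | $1$ | | $2^{m-2}$ | $2^{m-1}-1$ | | $2^{m-2}-2^{\frac{m-1}2}i^{m+t}\tau$ | $2^{m-1}-1$ | | $2^{m-2}-2^{\frac{m-3}2}i^{m+t}\tau$ | $(2^m-2)\big(3\cdot2^{m-3}+2^{\frac{m-3}2}i^{m+t}\tau\big)+2^m$ | | $2^{m-2}+2^{\frac{m-3}2}i^{t-1}(i^{m-1}\tau\pm1)$ | $2^{m-2}(2^m-2)$ (each) | | $2^{m-2}+2^{\frac{m-3}2}i^{t-1}(i^{m-1}\tau\pm2)$ | $(2^m-2)\big(2^{m-4}-2^{\frac{m-5}2}i^{m+t}\tau\big)$ (each) | -/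

import Mathlib

open Polynomial

namespace GaloisZ4

/-- A basic irreducible polynomial over `ℤ/4`: monic, with irreducible reduction modulo `2`.
For such an `h` of degree `m`, the ring `(ℤ/4)[X]/(h) = AdjoinRoot h` is the Galois ring
`GR(4, m)`. -/
structure IsBasicIrreducible (h : (ZMod 4)[X]) : Prop where
  monic : h.Monic
  irreducible_map : Irreducible (h.map (ZMod.castHom (by norm_num : 2 ∣ 4) (ZMod 2)))

/-- The Teichmüller set `{z : z ^ (2 ^ m) = z}`. -/
def teichmuller (m : ℕ) (R : Type*) [CommRing R] : Set R := {z | z ^ (2 ^ m) = z}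

/-- `a ∈ ℤ/4` is the trace of `z`: writing `z = x + 2 y` with `x, y` in the Teichmüller set,
`a = ∑_{j < m} (x ^ (2 ^ j) + 2 y ^ (2 ^ j))`. -/
def IsTrace (m : ℕ) {R : Type*} [CommRing R] [Algebra (ZMod 4) R] (z : R) (a : ZMod 4) : Prop :=
  ∃ x ∈ teichmuller m R, ∃ y ∈ teichmuller m R, z = x + 2 * y ∧
    algebraMap (ZMod 4) R a = ∑ j ∈ Finset.range m, (x ^ (2 ^ j) + 2 * y ^ (2 ^ j))

open Classical in
/-- The trace function onto `ℤ/4`. On the Galois ring `GR(4, m)` the value is well defined, by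
`existsUnique_isTrace` below; the value `0` in the other branch is never used there. -/
noncomputable def trace (m : ℕ) {R : Type*} [CommRing R] [Algebra (ZMod 4) R] (z : R) : ZMod 4 :=
  if H : ∃ a, IsTrace m z a then H.choose else 0

section Trace

variable {R : Type*} [CommRing R]

lemma sq_eq_of_two {a b v : R} (h4 : (4 : R) = 0) (h : a = b + 2 * v) : a ^ 2 = b ^ 2 := by
  subst h
  linear_combination (b * v + v ^ 2) * h4

lemma pow_eq_of_two {m : ℕ} (hm : 0 < m) {a b v : R} (h4 : (4 : R) = 0)
    (h : a = b + 2 * v) : a ^ (2 ^ m) = b ^ (2 ^ m) := by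
  obtain ⟨k, rfl⟩ := Nat.exists_eq_succ_of_ne_zero hm.ne'
  rw [pow_succ', pow_mul, pow_mul, sq_eq_of_two h4 h]

lemma pow_mem {m : ℕ} (hm : 0 < m) (h4 : (4 : R) = 0)
    (hq : ∀ z : R, ∃ w, z ^ (2 ^ m) = z + 2 * w) (z : R) : z ^ (2 ^ m) ∈ teichmuller m R := by
  obtain ⟨w, hw⟩ := hq z
  exact pow_eq_of_two hm h4 hw

lemma two_mul_pow {m : ℕ} (h4 : (4 : R) = 0)
    (hq : ∀ z : R, ∃ w, z ^ (2 ^ m) = z + 2 * w) (z : R) : 2 * z ^ (2 ^ m) = 2 * z := by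
  obtain ⟨w, hw⟩ := hq z
  rw [hw]
  linear_combination w * h4

lemma exists_rep {m : ℕ} (hm : 0 < m) (h4 : (4 : R) = 0)
    (hq : ∀ z : R, ∃ w, z ^ (2 ^ m) = z + 2 * w) (z : R) :
    ∃ x ∈ teichmuller m R, ∃ y ∈ teichmuller m R, z = x + 2 * y := by
  obtain ⟨w, hw⟩ := hq z
  refine ⟨_, pow_mem hm h4 hq z, _, pow_mem hm h4 hq w, ?_⟩
  rw [two_mul_pow h4 hq, hw]
  linear_combination -w * h4

lemma rep_unique {m : ℕ} (hm : 0 < m) (h4 : (4 : R) = 0)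
    (h2 : ∀ z : R, 2 * z = 0 → ∃ w, z = 2 * w) {x y x' y' : R}
    (hx : x ∈ teichmuller m R) (hy : y ∈ teichmuller m R)
    (hx' : x' ∈ teichmuller m R) (hy' : y' ∈ teichmuller m R)
    (h : x + 2 * y = x' + 2 * y') : x = x' ∧ y = y' := by
  have h1 : x = x' := by
    rw [← hx, ← hx']
    exact pow_eq_of_two hm h4 (v := y' - y) (by linear_combination h)
  refine ⟨h1, ?_⟩
  obtain ⟨w, hw⟩ := h2 (y - y') (by linear_combination h - h1)
  rw [← hy, ← hy']
  exact pow_eq_of_two hm h4 (v := w) (by linear_combination hw)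

/-- `z'` is the Frobenius image `x² + 2 y²` of `z = x + 2 y`; only used to prove that the trace
is well defined. -/
def Frob (m : ℕ) (z z' : R) : Prop :=
  ∃ x ∈ teichmuller m R, ∃ y ∈ teichmuller m R, z = x + 2 * y ∧ z' = x ^ 2 + 2 * y ^ 2

lemma teich_pow {m : ℕ} {x : R} (hx : x ∈ teichmuller m R) (k : ℕ) :
    x ^ k ∈ teichmuller m R := by
  change (x ^ k) ^ (2 ^ m) = x ^ k
  rw [← pow_mul, mul_comm, pow_mul, hx]

lemma teich_zero {m : ℕ} : (0 : R) ∈ teichmuller m R :=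
  zero_pow (by positivity)

lemma frob_add {m : ℕ} (hm : 0 < m) (h4 : (4 : R) = 0)
    (hq : ∀ z : R, ∃ w, z ^ (2 ^ m) = z + 2 * w) {z z' w w' : R}
    (h : Frob m z z') (h' : Frob m w w') : Frob m (z + w) (z' + w') := by
  obtain ⟨x, hx, y, hy, rfl, rfl⟩ := h
  obtain ⟨u, hu, v, hv, rfl, rfl⟩ := h'
  have key : ∀ x : R, x ∈ teichmuller m R → ∃ p, p ^ 2 = x := by
    intro x hx
    obtain ⟨k, rfl⟩ := Nat.exists_eq_succ_of_ne_zero hm.ne'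
    exact ⟨x ^ (2 ^ k), by rw [← pow_mul, ← pow_succ]; exact hx⟩
  obtain ⟨p, rfl⟩ := key x hx
  obtain ⟨r, rfl⟩ := key u hu
  obtain ⟨c, hc⟩ := hq (p + r)
  obtain ⟨d, hd⟩ := hq (p * r + y + v)
  refine ⟨(p + r) ^ 2, ?_, (p * r + y + v) ^ (2 ^ m), pow_mem hm h4 hq _, ?_, ?_⟩
  · change ((p + r) ^ 2) ^ (2 ^ m) = _
    rw [← pow_mul, mul_comm, pow_mul]
    exact sq_eq_of_two h4 hc
  · rw [two_mul_pow h4 hq]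
    linear_combination (-p * r) * h4
  · rw [sq_eq_of_two h4 hd]
    linear_combination (-p ^ 3 * r - p * r ^ 3 - 2 * p ^ 2 * r ^ 2 -
      p * r * y - p * r * v - y * v) * h4

lemma exists_trace {m : ℕ} (hm : 0 < m) (h4 : (4 : R) = 0)
    (hq : ∀ z : R, ∃ w, z ^ (2 ^ m) = z + 2 * w)
    (h2 : ∀ z : R, 2 * z = 0 → ∃ w, z = 2 * w)
    (hidem : ∀ z : R, z ^ 2 = z → z = 0 ∨ z = 1)
    [Algebra (ZMod 4) R] {x y : R} (hx : x ∈ teichmuller m R) (hy : y ∈ teichmuller m R) :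
    ∃ a : ZMod 4, algebraMap (ZMod 4) R a =
      ∑ j ∈ Finset.range m, (x ^ (2 ^ j) + 2 * y ^ (2 ^ j)) := by
  have hF : ∀ n : ℕ, Frob m (∑ j ∈ Finset.range n, (x ^ (2 ^ j) + 2 * y ^ (2 ^ j)))
      (∑ j ∈ Finset.range n, (x ^ (2 ^ (j + 1)) + 2 * y ^ (2 ^ (j + 1)))) := by
    intro n
    induction n with
    | zero => exact ⟨0, teich_zero, 0, teich_zero, by simp, by simp⟩
    | succ n ih =>
      rw [Finset.sum_range_succ, Finset.sum_range_succ]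
      refine frob_add hm h4 hq ih ⟨_, teich_pow hx _, _, teich_pow hy _, rfl, ?_⟩
      rw [pow_succ, pow_mul, pow_mul]
  have hs : ∑ j ∈ Finset.range m, (x ^ (2 ^ (j + 1)) + 2 * y ^ (2 ^ (j + 1))) =
      ∑ j ∈ Finset.range m, (x ^ (2 ^ j) + 2 * y ^ (2 ^ j)) := by
    have e1 := Finset.sum_range_succ (fun j => x ^ (2 ^ j) + 2 * y ^ (2 ^ j)) m
    have e2 := Finset.sum_range_succ' (fun j => x ^ (2 ^ j) + 2 * y ^ (2 ^ j)) m
    have hx' : x ^ (2 ^ m) = x := hx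
    have hy' : y ^ (2 ^ m) = y := hy
    simp only [hx', hy', pow_zero, pow_one] at e1 e2
    exact add_right_cancel (e2.symm.trans e1)
  obtain ⟨a, ha, b, hb, e1, e2⟩ := hF m
  rw [hs, e1] at e2
  obtain ⟨ea, eb⟩ := rep_unique hm h4 h2 ha hb (teich_pow ha 2) (teich_pow hb 2) e2
  rw [e1]
  rcases hidem a ea.symm with rfl | rfl <;> rcases hidem b eb.symm with rfl | rfl
  · exact ⟨0, by simp⟩
  · exact ⟨2, by rw [map_ofNat, zero_add, mul_one]⟩
  · exact ⟨1, by simp⟩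
  · exact ⟨1 + 2, by simp only [map_add, map_one, map_ofNat, mul_one]⟩

lemma even_coeffs {p : (ZMod 4)[X]}
    (hp : p.map (ZMod.castHom (by norm_num : 2 ∣ 4) (ZMod 2)) = 0) : ∃ r, p = 2 * r := by
  have hc : ∀ n, ∃ d : ZMod 4, p.coeff n = 2 * d := by
    intro n
    have h := congrArg (fun q => q.coeff n) hp
    simp only [coeff_map, coeff_zero] at h
    revert h
    generalize p.coeff n = c
    revert c
    decide
  choose d hd using hc
  refine ⟨∑ i ∈ Finset.range (p.natDegree + 1), monomial i (d i), ?_⟩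
  conv_lhs => rw [p.as_sum_range]
  rw [Finset.mul_sum]
  refine Finset.sum_congr rfl fun i _ => ?_
  rw [hd i, show (2 : (ZMod 4)[X]) = C 2 from rfl, C_mul_monomial]

/-- The trace on `GR(4, m)` is well defined. -/
theorem existsUnique_isTrace {m : ℕ} {h : (ZMod 4)[X]} (hb : IsBasicIrreducible h)
    (hd : h.natDegree = m) (z : AdjoinRoot h) : ∃! a, IsTrace m z a := by
  set ρ := ZMod.castHom (by norm_num : 2 ∣ 4) (ZMod 2) with hρ
  have hdeg : (h.map ρ).natDegree = m := by rw [hb.monic.natDegree_map, hd]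
  have : Fact (Irreducible (h.map ρ)) := ⟨hb.irreducible_map⟩
  have hm : 0 < m := hdeg ▸ hb.irreducible_map.natDegree_pos
  have h4 : (4 : AdjoinRoot h) = 0 := by
    have : algebraMap (ZMod 4) (AdjoinRoot h) 4 = 0 := by
      rw [show (4 : ZMod 4) = 0 from rfl, map_zero]
    simpa only [map_ofNat] using this
  let π : AdjoinRoot h →+* AdjoinRoot (h.map ρ) := AdjoinRoot.map ρ h (h.map ρ) dvd_rfl
  have hπ : ∀ p, π (AdjoinRoot.mk h p) = AdjoinRoot.mk (h.map ρ) (p.map ρ) := by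
    intro p
    induction p using Polynomial.induction_on' with
    | add p q hp hq => simp only [map_add, Polynomial.map_add, hp, hq]
    | monomial n a =>
      rw [← C_mul_X_pow_eq_monomial]
      simp only [map_mul, map_pow, AdjoinRoot.mk_C, AdjoinRoot.mk_X, Polynomial.map_mul, map_C,
        Polynomial.map_pow, map_X, π, AdjoinRoot.map_of, AdjoinRoot.map_root]
  have hker : ∀ w, π w = 0 → ∃ v, w = 2 * v := by
    intro w hw
    obtain ⟨p, rfl⟩ := AdjoinRoot.mk_surjective w
    rw [hπ, AdjoinRoot.mk_eq_zero] at hw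
    obtain ⟨q, hq⟩ := hw
    obtain ⟨q', rfl⟩ := Polynomial.map_surjective ρ (ZMod.castHom_surjective _) q
    obtain ⟨r, hr⟩ := even_coeffs (p := p - h * q') (by
      rw [Polynomial.map_sub, Polynomial.map_mul, ← hρ, hq, sub_self])
    refine ⟨AdjoinRoot.mk h r, ?_⟩
    have := congrArg (AdjoinRoot.mk h) hr
    rwa [map_sub, map_mul, AdjoinRoot.mk_self, zero_mul, sub_zero, map_mul, map_ofNat] at this
  have : Nontrivial (ZMod 4) := ⟨0, 1, by decide⟩
  have h2 : ∀ w : AdjoinRoot h, 2 * w = 0 → ∃ v, w = 2 * v := by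
    intro w hw
    apply hker
    obtain ⟨p, rfl⟩ := AdjoinRoot.mk_surjective w
    rw [← AdjoinRoot.mk_leftInverse hb.monic (AdjoinRoot.mk h p), AdjoinRoot.modByMonicHom_mk,
      hπ]
    have h0 : 2 * (p %ₘ h) = 0 := by
      by_contra hne
      have hlt : (2 * (p %ₘ h)).degree < h.degree := by
        have : (2 * (p %ₘ h)).degree ≤ (p %ₘ h).degree := by
          rw [show (2 : (ZMod 4)[X]) = C 2 from rfl]
          rw [← smul_eq_C_mul]
          exact degree_smul_le 2 _
        exact this.trans_lt (degree_modByMonic_lt _ hb.monic)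
      refine AdjoinRoot.mk_ne_zero_of_degree_lt hb.monic hne hlt ?_
      rw [map_mul, map_ofNat, ← AdjoinRoot.modByMonicHom_mk hb.monic,
        AdjoinRoot.mk_leftInverse hb.monic, hw]
    have : (p %ₘ h).map ρ = 0 := by
      ext n
      have h := congrArg (fun q => q.coeff n) h0
      rw [show (2 : (ZMod 4)[X]) = C 2 from rfl] at h
      simp only [coeff_C_mul, coeff_zero] at h
      rw [coeff_map, coeff_zero]
      revert h
      generalize (p %ₘ h).coeff n = c
      revert c
      decide
    rw [this, map_zero]
  have hcard : Nat.card (AdjoinRoot (h.map ρ)) = 2 ^ m := by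
    have hmon := hb.monic.map ρ
    have := hmon.finite_adjoinRoot
    have := hmon.free_adjoinRoot
    rw [Module.natCard_eq_pow_finrank (K := ZMod 2),
      (AdjoinRoot.powerBasis' hmon).finrank, AdjoinRoot.powerBasis'_dim, hdeg, Nat.card_zmod]
  have : Finite (AdjoinRoot (h.map ρ)) := Nat.finite_of_card_ne_zero (by rw [hcard]; positivity)
  let := Fintype.ofFinite (AdjoinRoot (h.map ρ))
  have hq : ∀ w : AdjoinRoot h, ∃ v, w ^ (2 ^ m) = w + 2 * v := by
    intro w
    obtain ⟨v, hv⟩ := hker (w ^ (2 ^ m) - w) (by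
      rw [map_sub, map_pow, ← hcard, Nat.card_eq_fintype_card, FiniteField.pow_card, sub_self])
    exact ⟨v, by linear_combination hv⟩
  have hidem : ∀ w : AdjoinRoot h, w ^ 2 = w → w = 0 ∨ w = 1 := by
    intro w hw
    have e : π w * (π w - 1) = 0 := by
      have := congrArg π hw
      rw [map_pow] at this
      linear_combination this
    rcases mul_eq_zero.1 e with e | e
    · obtain ⟨v, hv⟩ := hker w e
      left
      rw [← hw, sq_eq_of_two (b := 0) (v := v) h4 (by rw [hv, zero_add])]
      simp
    · obtain ⟨v, hv⟩ := hker (w - 1) (by rw [map_sub, map_one, e])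
      right
      rw [← hw, sq_eq_of_two (b := 1) (v := v) h4 (by linear_combination hv)]
      simp
  have hinj : Function.Injective (algebraMap (ZMod 4) (AdjoinRoot h)) := by
    have := hb.monic.free_adjoinRoot
    have : Nontrivial (AdjoinRoot h) := π.domain_nontrivial
    exact FaithfulSMul.algebraMap_injective _ _
  obtain ⟨x, hx, y, hy, hz⟩ := exists_rep hm h4 hq z
  obtain ⟨a, ha⟩ := exists_trace hm h4 hq h2 hidem hx hy
  refine ⟨a, ⟨x, hx, y, hy, hz, ha⟩, ?_⟩
  rintro b ⟨x', hx', y', hy', hz', hb'⟩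
  obtain ⟨rfl, rfl⟩ := rep_unique hm h4 h2 hx hy hx' hy' (hz ▸ hz')
  exact hinj (hb'.trans ha.symm)

theorem trace_spec {m : ℕ} {h : (ZMod 4)[X]} (hb : IsBasicIrreducible h)
    (hd : h.natDegree = m) (z : AdjoinRoot h) : IsTrace m z (trace m z) := by
  have H := (existsUnique_isTrace hb hd z).exists
  rw [trace, dif_pos H]
  exact H.choose_spec

end Trace

/-- `D_t = {x ∈ T : Tr(x) = t}`, where `T` is the Teichmüller set. -/
def traceFiber (m : ℕ) (R : Type*) [CommRing R] [Algebra (ZMod 4) R] (t : ZMod 4) : Set R :=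
  {x | x ∈ teichmuller m R ∧ trace m x = t}

/-- `d` lists the elements of `D` without repetition: `D = {d_1, …, d_n}`. -/
def Enumerates {R : Type*} {n : ℕ} (d : Fin n → R) (D : Set R) : Prop :=
  Function.Injective d ∧ Set.range d = D

/-- The code `{(Tr(u d_1), …, Tr(u d_n)) : u ∈ R}`. -/
def code (m : ℕ) {R : Type*} [CommRing R] [Algebra (ZMod 4) R] {n : ℕ} (d : Fin n → R) :
    Set (Fin n → ZMod 4) :=
  Set.range fun (u : R) (j : Fin n) => trace m (u * d j)

/-- The Lee weight `n - Re (∑ i ^ c_j)` of a word over `ℤ/4`. -/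
noncomputable def leeWeight {n : ℕ} (c : Fin n → ZMod 4) : ℝ :=
  n - (∑ j, Complex.I ^ (c j).val).re

/-- The minimum Lee distance of `C` is `d`. The parameter `d` is complex because the formulas
for it are written with powers of the imaginary unit. -/
def HasMinLeeDist {n : ℕ} (C : Set (Fin n → ZMod 4)) (d : ℂ) : Prop :=
  ∃ δ : ℝ, (δ : ℂ) = d ∧
    IsLeast {r : ℝ | ∃ x ∈ C, ∃ y ∈ C, x ≠ y ∧ r = leeWeight (x - y)} δ

open Classical in
/-- The Lee weight distribution of `C` is given by a table of rows `(weight, frequency)`: for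
every `w`, the number of codewords of Lee weight `w` is the sum of the frequencies of the rows
with weight `w`. -/
def HasLeeDistribution {n : ℕ} (C : Set (Fin n → ZMod 4)) (rows : List (ℂ × ℂ)) : Prop :=
  ∀ w : ℂ, ((({c ∈ C | (leeWeight c : ℂ) = w} : Set (Fin n → ZMod 4)).ncard : ℕ) : ℂ) =
    (rows.map fun r => if r.1 = w then r.2 else 0).sum

/-- `τ = i ^ ((m - 1) / 2)` if `m ≡ 1 (mod 4)` and `τ = i ^ ((m + 1) / 2)` if
`m ≡ 3 (mod 4)`; only used for odd `m`. -/
noncomputable def tau (m : ℕ) : ℂ :=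
  if m % 4 = 1 then Complex.I ^ ((m - 1) / 2) else Complex.I ^ ((m + 1) / 2)

/-- `σ = 0` if `3 ∤ m` and `σ = -3` if `3 ∣ m`. -/
def sigma (m : ℕ) : ℂ := if 3 ∣ m then -3 else 0

end GaloisZ4

/-! Identify the Teichmüller set with the residue field `F` by a ↦ T(a). The trace becomes a
ℤ/4-valued quadratic form `Q` with Q(x+y) = Q(x) + Q(y) + 2Q(xy), and u = T(b²) + 2T(c) yields the
word a ↦ Q(b²a) + 2Q(ca). The Lee weight of its restriction to D_t is n - Re S(u), where S(u) sums
i^(word) over D_t, so everything reduces to the distribution of Re S(u) over u ∈ R.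

Detecting Q(a) = t by the characters of ℤ/4 writes 4S(u) through the complete sums of u, u+1, u+2,
u+3 (`four_mul_fiberSum`). If b ≠ 0, completing the square turns a complete sum into a power of i
times the Gauss sum ∑ i^Q(a) = (1+i)^m (`sum_iPow`). The square of the Gauss sum is elementary. Its
sign follows by induction on m: for a prime p ∣ m an automorphism of order p gives a congruence
modulo p with the Gauss sum of a subfield, and p is odd, so it separates the two signs.

Put m = 2j+3. For b ∉ {0, 1}, Re S(u) is 2^(j-1) times a sum of four signs, hence one of 0, ±2^j,
±2^(j+1). Five linear equations fix the five frequencies (`sum_generic`): the number of words, the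
first three moments of Re S, and the sum of the product of the four signs. The moments come from
orthogonality; the third uses that x² + xy + y² is anisotropic over `F` for odd m. For fixed b the
product of signs is, up to sign, an additive character of c (`prodSgn_add`), and its sum vanishes
unless b is a root of X³+X+1 or X³+X²+1. These have roots in `F` exactly when 3 ∣ m, whence σ. For b
∈ {0, 1}, S(u) is computed directly.

The fibres of u ↦ codeword are cosets of its kernel, which consists of the u with Re S(u) = n and
has order 4, 2, 1 for t = 0, t = 2, t odd. Dividing by that order gives the tables. -/

namespace GaloisZ4

/-! ### Trace forms on the residue field and the square of their Gauss sum. -/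

/-- The character `a ↦ i ^ a` of `ℤ/4` with values in the Gaussian integers. -/
def iPow (a : ZMod 4) : GaussianInt := ⟨0, 1⟩ ^ a.val

/-- The sign of the real part of `i ^ a * (1 + i)`. -/
def sgn (a : ZMod 4) : ℤ := (iPow a * ⟨1, 1⟩).re

lemma iPow_add : ∀ a b : ZMod 4, iPow (a + b) = iPow a * iPow b := by decide

lemma iPow_zero : iPow 0 = 1 := by decide

lemma iPow_natCast (n : ℕ) : iPow (n : ZMod 4) = ⟨0, 1⟩ ^ n := by
  induction n with
  | zero => simpa using iPow_zero
  | succ n ih => rw [Nat.cast_succ, iPow_add, ih, pow_succ]; rfl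

/-- An abstraction of the trace of `GR(4, m)` restricted to the Teichmüller set, which is viewed
as a function on the residue field. -/
structure IsTraceForm (m : ℕ) {F : Type*} [Field F] [Fintype F] (Q : F → ZMod 4) : Prop where
  card : Fintype.card F = 2 ^ m
  add : ∀ x y, Q (x + y) = Q x + Q y + 2 * Q (x * y)
  sq : ∀ x, Q (x ^ 2) = Q x
  one : Q 1 = m

namespace IsTraceForm

variable {m : ℕ} {F : Type*} [Field F] [Fintype F] {Q : F → ZMod 4}

lemma pos (hQ : IsTraceForm m Q) : 0 < m := by
  rcases Nat.eq_zero_or_pos m with rfl | h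
  · have := hQ.card
    have h1 : 1 < Fintype.card F := Fintype.one_lt_card
    omega
  · exact h

lemma charP (hQ : IsTraceForm m Q) : CharP F 2 := by
  obtain ⟨p, hp⟩ := CharP.exists F
  obtain ⟨n, hp1, hn⟩ := FiniteField.card F p
  have h2 : p ∣ 2 ^ m := by
    rw [← hQ.card, hn]
    exact dvd_pow_self _ n.ne_zero
  have := (Nat.prime_dvd_prime_iff_eq hp1 Nat.prime_two).1 (hp1.dvd_of_dvd_pow h2)
  exact this ▸ hp

lemma zero (hQ : IsTraceForm m Q) : Q 0 = 0 := by
  have := hQ.add 0 0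
  simp only [add_zero, mul_zero] at this
  revert this
  generalize Q 0 = a
  revert a
  decide

lemma double_add (hQ : IsTraceForm m Q) (x y : F) : 2 * Q (x + y) = 2 * Q x + 2 * Q y := by
  rw [hQ.add]
  generalize Q x = a, Q y = b, Q (x * y) = c
  revert a b c
  decide

lemma two_mul_one (hQ : IsTraceForm m Q) (hodd : Odd m) : 2 * Q 1 = 2 := by
  rw [hQ.one]
  obtain ⟨k, rfl⟩ := hodd
  push_cast
  generalize (k : ZMod 4) = a
  revert a
  decide

lemma pow_two_pow (hQ : IsTraceForm m Q) (x : F) (k : ℕ) : Q (x ^ 2 ^ k) = Q x := by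
  induction k with
  | zero => simp
  | succ k ih => rw [pow_succ, pow_mul, hQ.sq, ih]

lemma sum_linear (hQ : IsTraceForm m Q) (hodd : Odd m) [DecidableEq F] (x : F) :
    ∑ a, iPow (2 * Q (x * a)) = if x = 0 then 2 ^ m else 0 := by
  split_ifs with hx
  · subst hx
    simp [hQ.zero, iPow_zero, hQ.card]
  · have h : ∑ a, iPow (2 * Q (x * a)) = ∑ a, iPow (2 * Q (x * (a + x⁻¹))) :=
      (Equiv.sum_comp (Equiv.addRight x⁻¹) fun a => iPow (2 * Q (x * a))).symm
    have h2 : ∀ a, iPow (2 * Q (x * (a + x⁻¹))) = - iPow (2 * Q (x * a)) := by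
      intro a
      rw [mul_add, mul_inv_cancel₀ hx, hQ.double_add, hQ.two_mul_one hodd, iPow_add,
        show iPow 2 = -1 by decide, mul_neg_one]
    simp only [h2, Finset.sum_neg_distrib] at h
    have h3 : (2 : GaussianInt) * ∑ a, iPow (2 * Q (x * a)) = 0 := by linear_combination h
    exact (mul_eq_zero.1 h3).resolve_left (by decide)

/-- Completing the square in a twisted Gauss sum. -/
lemma sum_affine (hQ : IsTraceForm m Q) (z : F) :
    ∑ a, iPow (Q a + 2 * Q (z * a)) = iPow (-Q z) * ∑ a, iPow (Q a) := by
  rw [← Equiv.sum_comp (Equiv.addRight z) fun a => iPow (Q a), Finset.mul_sum]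
  refine Finset.sum_congr rfl fun a _ => ?_
  rw [← iPow_add, Equiv.coe_addRight, hQ.add a z, mul_comm z a]
  congr 1
  ring

/-- Substituting y = x + z makes the exponent Q(z) + 2Q((1+z)x), which is additive in x; summing
over x leaves only z = 1. -/
lemma sum_iPow_sq (hQ : IsTraceForm m Q) (hodd : Odd m) :
    (∑ a, iPow (Q a)) ^ 2 = 2 ^ m * iPow m := by
  classical
  have := hQ.charP
  calc (∑ a, iPow (Q a)) ^ 2 = ∑ x, ∑ y, iPow (Q x) * iPow (Q y) := by
        rw [pow_two, Finset.sum_mul_sum]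
    _ = ∑ x, ∑ z, iPow (Q x) * iPow (Q (x + z)) := by
        refine Finset.sum_congr rfl fun x _ => ?_
        exact (Equiv.sum_comp (Equiv.addLeft x) fun y => iPow (Q x) * iPow (Q y)).symm
    _ = ∑ z, iPow (Q z) * ∑ x, iPow (2 * Q ((1 + z) * x)) := by
        rw [Finset.sum_comm]
        refine Finset.sum_congr rfl fun z _ => ?_
        rw [Finset.mul_sum]
        refine Finset.sum_congr rfl fun x _ => ?_
        rw [← iPow_add, ← iPow_add, hQ.add, add_mul, one_mul, hQ.double_add, mul_comm z x]
        congr 1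
        ring
    _ = _ := by
        simp only [hQ.sum_linear hodd]
        rw [Finset.sum_eq_single 1]
        · rw [if_pos (CharTwo.add_self_eq_zero 1), hQ.one, mul_comm]
        · intro z _ hz
          rw [if_neg, mul_zero]
          intro h
          exact hz (CharTwo.add_eq_zero.1 h).symm
        · simp

end IsTraceForm

/-! ### The sign of the Gauss sum. -/

/-- The number of solutions of `x ^ d = 1` in a finite field, when `d` divides the order of the
multiplicative group. -/
lemma card_pow_eq_one {F : Type*} [Field F] [Fintype F] [DecidableEq F] {d : ℕ} (hd : d ≠ 0)
    (h : d ∣ Fintype.card F - 1) : (Finset.univ.filter fun x : F => x ^ d = 1).card = d := by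
  have hc := IsCyclic.card_powMonoidHom_ker (G := Fˣ) d
  rw [Nat.card_units, Nat.card_eq_fintype_card (α := F), Nat.gcd_eq_right h] at hc
  conv_rhs => rw [← hc]
  rw [← Fintype.card_subtype, ← Nat.card_eq_fintype_card]
  refine (Nat.card_eq_of_bijective
    (fun u : (powMonoidHom d : Fˣ →* Fˣ).ker => (⟨(u : Fˣ), ?_⟩ : {x : F // x ^ d = 1}))
    ⟨?_, ?_⟩).symm
  · have := u.2
    rw [MonoidHom.mem_ker, powMonoidHom_apply] at this
    rw [← Units.val_pow_eq_pow_val, this, Units.val_one]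
  · intro u v huv
    exact Subtype.ext (Units.ext (congrArg Subtype.val huv))
  · rintro ⟨x, hx⟩
    have hx0 : x ≠ 0 := by
      rintro rfl
      rw [zero_pow hd] at hx
      exact zero_ne_one hx
    exact ⟨⟨Units.mk0 x hx0, Units.ext (by simpa using hx)⟩, rfl⟩

lemma card_pow_eq_self {F : Type*} [Field F] [Fintype F] [DecidableEq F] {d : ℕ} (hd : d ≠ 0)
    (h : d ∣ Fintype.card F - 1) : (Finset.univ.filter fun x : F => x ^ (d + 1) = x).card = d + 1 := by
  have : (Finset.univ.filter fun x : F => x ^ (d + 1) = x) =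
      insert 0 (Finset.univ.filter fun x : F => x ^ d = 1) := by
    ext x
    simp only [Finset.mem_filter, Finset.mem_univ, true_and, Finset.mem_insert]
    by_cases hx : x = 0
    · simp [hx]
    · rw [pow_succ, mul_eq_right₀ hx]
      simp [hx]
  rw [this, Finset.card_insert_of_notMem (by simp [hd]), card_pow_eq_one hd h]

lemma sum_comp_eq_sum_card {α β M : Type*} [Fintype α] [Fintype β] [DecidableEq β] [Semiring M]
    (Q : α → β) (g : β → M) :
    ∑ x, g (Q x) = ∑ s, ((Finset.univ.filter fun x => Q x = s).card : M) * g s := by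
  rw [← Finset.sum_fiberwise Finset.univ Q]
  refine Finset.sum_congr rfl fun s _ => ?_
  rw [Finset.sum_congr rfl (g := fun _ => g s), Finset.sum_const, nsmul_eq_mul]
  intro x hx
  rw [(Finset.mem_filter.1 hx).2]

namespace IsTraceForm

universe u

lemma eq_zero_or_one_of_degree_one {F : Type*} [Field F] [Fintype F] {Q : F → ZMod 4}
    (hQ : IsTraceForm 1 Q) : ∑ a, iPow (Q a) = ⟨1, 1⟩ := by
  classical
  have h : ({0, 1} : Finset F) = Finset.univ := by
    rw [← Finset.card_eq_iff_eq_univ, Finset.card_pair zero_ne_one, hQ.card, pow_one]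
  rw [← h, Finset.sum_pair zero_ne_one, hQ.zero, hQ.one]
  decide

/-- Restriction of a trace form to the subfield of index `p`. -/
lemma exists_restrict {F : Type u} [Field F] [Fintype F] {Q : F → ZMod 4} {p n : ℕ}
    [hp : Fact p.Prime] (hp2 : p * p % 4 = 1) (hQ : IsTraceForm (p * n) Q) :
    ∃ (E : Type u) (_ : Field E) (_ : Fintype E) (Q' : E → ZMod 4), IsTraceForm n Q' ∧
      (p : GaussianInt) ∣ ∑ a, iPow (Q a) - ∑ e, iPow (p * Q' e) := by
  classical
  have := hQ.charP
  have hpp : (p : ZMod 4) * p = 1 := by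
    rw [← Nat.cast_mul, ← ZMod.natCast_mod, hp2, Nat.cast_one]
  let E : Subfield F := RingHom.eqLocusField (iterateFrobenius F 2 n) (RingHom.id F)
  have hE : ∀ x, x ∈ E ↔ x ^ 2 ^ n = x := fun x => Iff.rfl
  have hn : n ≠ 0 := by
    rintro rfl
    exact hQ.pos.ne' (mul_zero p)
  have hcard : Fintype.card E = 2 ^ n := by
    have h1 := card_pow_eq_self (F := F) (d := 2 ^ n - 1)
      (Nat.sub_ne_zero_of_lt (Nat.one_lt_two_pow hn)) (by
        rw [hQ.card, mul_comm, pow_mul]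
        simpa using Nat.sub_dvd_pow_sub_pow (2 ^ n) 1 p)
    rw [Nat.sub_add_cancel Nat.one_le_two_pow, ← Fintype.card_subtype] at h1
    exact (Fintype.card_congr (Equiv.subtypeEquivRight hE)).trans h1
  have hQ' : ∀ x : E, (p : ZMod 4) * (p * Q x) = Q x := fun x => by
    rw [← mul_assoc, hpp, one_mul]
  -- The factor p normalises the form on the subfield: its value at 1 is p·p·n = n, since p² ≡ 1
  -- modulo 4.
  refine ⟨E, inferInstance, inferInstance, fun x => p * Q x, ⟨hcard, ?_, ?_, ?_⟩, ?_⟩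
  · intro x y
    simp only [Subfield.coe_add, Subfield.coe_mul, hQ.add]
    ring
  · intro x
    simp only [SubmonoidClass.coe_pow, hQ.sq]
  · simp only [Subfield.coe_one, hQ.one, Nat.cast_mul]
    rw [← mul_assoc, hpp, one_mul]
  · simp only [hQ']
    rw [sum_comp_eq_sum_card Q, sum_comp_eq_sum_card (fun e : E => Q e),
      ← Finset.sum_sub_distrib]
    refine Finset.dvd_sum fun s _ => ?_
    rw [← sub_mul]
    refine Dvd.dvd.mul_right ?_ _
    -- This map preserves the fibre of `Q`, has p-th power the identity, and fixes exactly the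
    -- points of `E`. Hence the fibres over `F` and `E` have congruent cardinalities modulo p.
    let f : Function.End {x : F // Q x = s} :=
      fun x => ⟨x.1 ^ 2 ^ n, by rw [hQ.pow_two_pow, x.2]⟩
    have hf : ∀ (j : ℕ) (x : {x : F // Q x = s}), ((f ^ j) x).1 = x.1 ^ 2 ^ (n * j) := by
      intro j
      induction j with
      | zero =>
        intro x
        rw [mul_zero, pow_zero, pow_zero, pow_one]
        rfl
      | succ j ih =>
        intro x
        change ((f ^ j) (f x)).1 = _
        rw [ih, mul_add_one, add_comm, pow_add, pow_mul x.1]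
    have hfp : f ^ p ^ 1 = 1 := by
      funext x
      refine Subtype.ext ?_
      rw [pow_one, hf, mul_comm, ← hQ.card, FiniteField.pow_card]
      rfl
    have hmod := Equiv.Perm.card_fixedPoints_modEq hfp
    have hfix : Fintype.card (Function.fixedPoints f) =
        (Finset.univ.filter fun e : E => Q e = s).card := by
      rw [← Fintype.card_subtype]
      refine Fintype.card_congr ⟨fun x => ⟨⟨x.1.1, congrArg Subtype.val x.2⟩, x.1.2⟩,
        fun e => ⟨⟨e.1.1, e.2⟩, Subtype.ext e.1.2⟩, fun _ => rfl, fun _ => rfl⟩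
    rw [hfix, Fintype.card_subtype] at hmod
    obtain ⟨c, hc⟩ := Nat.modEq_iff_dvd.1 hmod.symm
    refine ⟨c, ?_⟩
    exact_mod_cast congrArg (Int.cast : ℤ → GaussianInt) hc

/-- Modulo 4, p is 1 or -1, so multiplying the exponent by p is the identity or complex conjugation.
-/
lemma sum_iPow_mul {E : Type*} [Fintype E] (Q : E → ZMod 4) (n p : ℕ)
    (hp2 : p * p % 4 = 1) (h : ∑ e, iPow (Q e) = ⟨1, 1⟩ ^ n) :
    ∑ e, iPow (p * Q e) = (1 + iPow p) ^ n := by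
  have hp : (p : ZMod 4) = 1 ∨ (p : ZMod 4) = -1 := by
    have : (p : ZMod 4) * p = 1 := by
      rw [← Nat.cast_mul, ← ZMod.natCast_mod, hp2, Nat.cast_one]
    revert this
    generalize (p : ZMod 4) = a
    revert a
    decide
  rcases hp with hp | hp
  · simp only [hp, one_mul, h]
    congr 1
  · have hs : ∀ a, iPow (-1 * a) = star (iPow a) := by decide
    simp only [hp, hs]
    rw [← star_sum, h, star_pow]
    congr 1

/-- The sign of the quadratic Gauss sum. -/
theorem sum_iPow (m : ℕ) : Odd m → ∀ {F : Type u} [Field F] [Fintype F] {Q : F → ZMod 4},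
    IsTraceForm m Q → ∑ a, iPow (Q a) = ⟨1, 1⟩ ^ m := by
  induction m using Nat.strong_induction_on with
  | _ m ih =>
  intro hodd F _ _ Q hQ
  by_cases hm : m = 1
  · subst hm
    rw [pow_one, hQ.eq_zero_or_one_of_degree_one]
  obtain ⟨p, hp, n, rfl⟩ := Nat.exists_prime_and_dvd hm
  have := Fact.mk hp
  obtain ⟨hpo, hno⟩ := Nat.odd_mul.1 hodd
  have hp2 : p * p % 4 = 1 := by
    obtain ⟨k, rfl⟩ := hpo
    ring_nf
    omega
  obtain ⟨E, _, _, Q', hQ', hdvd⟩ := hQ.exists_restrict hp2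
  have hlt : n < p * n := lt_mul_of_one_lt_left hQ'.pos hp.one_lt
  rw [sum_iPow_mul Q' n p hp2 (ih n hlt hno hQ')] at hdvd
  -- Frobenius modulo p: (1+i)^p ≡ 1 + i^p.
  have hdvd2 : (p : GaussianInt) ∣ ∑ a, iPow (Q a) - ⟨1, 1⟩ ^ (p * n) := by
    obtain ⟨r, hr⟩ := exists_add_pow_prime_eq hp (1 : GaussianInt) ⟨0, 1⟩
    have h1 : (p : GaussianInt) ∣ (1 + iPow p) - ⟨1, 1⟩ ^ p := by
      refine ⟨-(1 * ⟨0, 1⟩ * r), ?_⟩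
      rw [iPow_natCast, show (⟨1, 1⟩ : GaussianInt) = 1 + ⟨0, 1⟩ by decide, hr]
      ring
    have h2 := h1.trans (sub_dvd_pow_sub_pow (1 + iPow p) (⟨1, 1⟩ ^ p) n)
    rw [← pow_mul] at h2
    simpa using hdvd.add h2
  have hsq : (∑ a, iPow (Q a)) ^ 2 = (⟨1, 1⟩ ^ (p * n)) ^ 2 := by
    rw [hQ.sum_iPow_sq hodd, ← pow_mul, mul_comm (p * n) 2, pow_mul _ 2,
      show (⟨1, 1⟩ : GaussianInt) ^ 2 = 2 * ⟨0, 1⟩ by decide, mul_pow, iPow_natCast]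
  rcases sq_eq_sq_iff_eq_or_eq_neg.1 hsq with h | h
  · exact h
  · exfalso
    rw [h] at hdvd2
    -- The wrong sign would make p divide 2(1+i)^(pn); multiplying by (1-i)^(pn) turns this into a
    -- power of 2, impossible for odd p.
    have h3 : (p : GaussianInt) ∣ ((2 ^ (p * n + 1) : ℤ) : GaussianInt) := by
      have h4 := (hdvd2.mul_right (⟨1, -1⟩ ^ (p * n))).neg_right
      convert h4 using 1
      have h5 : (⟨1, 1⟩ : GaussianInt) ^ (p * n) * ⟨1, -1⟩ ^ (p * n) = 2 ^ (p * n) := by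
        rw [← mul_pow]
        rfl
      push_cast
      linear_combination (-2) * h5
    have h6 : (p : ℤ) ∣ 2 ^ (p * n + 1) := by
      have := (Zsqrtd.intCast_dvd_intCast (d := -1) (p : ℤ) (2 ^ (p * n + 1))).1
      exact this (by exact_mod_cast h3)
    have h7 : p ∣ 2 := hp.dvd_of_dvd_pow (by exact_mod_cast h6)
    rw [(Nat.prime_dvd_prime_iff_eq hp Nat.prime_two).1 h7] at hpo
    exact absurd hpo (by decide)

end IsTraceForm

end GaloisZ4

/-! ### Words, their complete character sums, and orthogonality relations. -/

namespace GaloisZ4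

/-- The value at `a` of the codeword with coordinates `u`. It is the trace of
`(x ^ 2 + 2 * y) * z` for Teichmüller elements `x`, `y`, `z` lifting `u.1`, `u.2`, `a`. -/
def word {F : Type*} [Field F] (Q : F → ZMod 4) (u : F × F) (a : F) : ZMod 4 :=
  Q (u.1 ^ 2 * a) + 2 * Q (u.2 * a)

/-- The sum of the values of the character `iPow` on a codeword of length `|Q ⁻¹ {t}|`. -/
def fiberSum {F : Type*} [Field F] [Fintype F] (Q : F → ZMod 4) (t : ZMod 4) (u : F × F) :
    GaussianInt :=
  ∑ a with Q a = t, iPow (word Q u a)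

/-- The coordinates of the sum of two elements of the Galois ring. -/
def wordAdd {F : Type*} [Field F] (u v : F × F) : F × F :=
  (u.1 + v.1, u.2 + v.2 + u.1 * v.1)

namespace IsTraceForm

section

variable {m : ℕ} {F : Type*} [Field F] [Fintype F] {Q : F → ZMod 4}

/-- The cross term 2Q((bb'a)²) equals 2Q(bb'a), which the product in the second coordinate of
`wordAdd` absorbs. This is why the first coordinate enters `word` squared. -/
lemma word_wordAdd (hQ : IsTraceForm m Q) (u v : F × F) (a : F) :
    word Q (wordAdd u v) a = word Q u a + word Q v a := by
  have := hQ.charP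
  obtain ⟨b, c⟩ := u
  obtain ⟨b', c'⟩ := v
  simp only [word, wordAdd, CharTwo.add_sq, add_mul, hQ.double_add]
  rw [hQ.add, show b ^ 2 * a * (b' ^ 2 * a) = (b * b' * a) ^ 2 by ring, hQ.sq]
  have h : ∀ x : ZMod 4, 2 * x + 2 * x = 0 := by decide
  linear_combination h (Q (b * b' * a))

lemma word_one_zero (hQ : IsTraceForm m Q) (a : F) : word Q (1, 0) a = Q a := by
  simp [word, hQ.zero]

lemma word_zero_one (hQ : IsTraceForm m Q) (a : F) : word Q (0, 1) a = 2 * Q a := by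
  simp [word, hQ.zero]

lemma word_zero_right (hQ : IsTraceForm m Q) (u : F × F) : word Q u 0 = 0 := by
  simp [word, hQ.zero]

/-- Rescaling a by b² brings the sum to the form treated by `sum_affine`. -/
lemma sum_word_of_ne_zero (hQ : IsTraceForm m Q) (hodd : Odd m) {b : F} (hb : b ≠ 0) (c : F) :
    ∑ a, iPow (word Q (b, c) a) = iPow (-Q (c / b ^ 2)) * ⟨1, 1⟩ ^ m := by
  rw [← hQ.sum_iPow m hodd, ← hQ.sum_affine]
  refine Eq.trans (Finset.sum_congr rfl fun a _ => ?_)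
    (Equiv.sum_comp (Equiv.mulLeft₀ (b ^ 2) (pow_ne_zero 2 hb)) _)
  change iPow (Q (b ^ 2 * a) + 2 * Q (c * a)) =
    iPow (Q (b ^ 2 * a) + 2 * Q (c / b ^ 2 * (b ^ 2 * a)))
  rw [← mul_assoc, div_mul_cancel₀ _ (pow_ne_zero 2 hb)]

lemma sum_word_of_eq_zero [DecidableEq F] (hQ : IsTraceForm m Q) (hodd : Odd m) (c : F) :
    ∑ a, iPow (word Q (0, c) a) = if c = 0 then 2 ^ m else 0 := by
  rw [← hQ.sum_linear hodd]
  simp [word, hQ.zero]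

/-- The condition Q(a) = t is detected by the sum of i^(s(Q(a) - t)) over s ∈ ℤ/4, and multiplying
by i^(sQ(a)) replaces u by u + s. The pairs on the right are the coordinates of u, u+1, u+2, u+3. -/
lemma four_mul_fiberSum (hQ : IsTraceForm m Q) (t : ZMod 4) (b c : F) :
    4 * fiberSum Q t (b, c) = ∑ a, iPow (word Q (b, c) a) +
      iPow (-t) * ∑ a, iPow (word Q (b + 1, c + b) a) +
      iPow (-2 * t) * ∑ a, iPow (word Q (b, c + 1) a) +
      iPow (-3 * t) * ∑ a, iPow (word Q (b + 1, c + b + 1) a) := by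
  rw [fiberSum, Finset.sum_filter]
  simp only [Finset.mul_sum, ← Finset.sum_add_distrib]
  refine Finset.sum_congr rfl fun a _ => ?_
  have e1 : word Q (b + 1, c + b) a = word Q (b, c) a + Q a := by
    rw [← hQ.word_one_zero, ← hQ.word_wordAdd]
    simp [wordAdd]
  have e2 : word Q (b, c + 1) a = word Q (b, c) a + 2 * Q a := by
    rw [← hQ.word_zero_one, ← hQ.word_wordAdd]
    simp [wordAdd]
  have e3 : word Q (b + 1, c + b + 1) a = word Q (b, c) a + Q a + 2 * Q a := by
    rw [← e1, ← hQ.word_zero_one, ← hQ.word_wordAdd]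
    simp [wordAdd]
  rw [e1, e2, e3]
  generalize word Q (b, c) a = w, Q a = s
  revert w s t
  decide

/-- Summing over c forces x + y + z = 0. Under that condition the exponent left over is additive in
b, governed by s, and summing over b forces s = 0. -/
lemma sum_sum_word (hQ : IsTraceForm m Q) (hodd : Odd m) [DecidableEq F] (ε : ZMod 4)
    (hε : 2 * ε = 2) (x y z s : F) (hs : x + y + z = 0 →
      ∀ b, Q (b ^ 2 * x) + Q (b ^ 2 * y) + ε * Q (b ^ 2 * z) = 2 * Q (b ^ 4 * s)) :
    ∑ u : F × F, iPow (word Q u x + word Q u y + ε * word Q u z) =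
      if x + y + z = 0 ∧ s = 0 then 4 ^ m else 0 := by
  have := hQ.charP
  have h1 : ∀ b c, iPow (word Q (b, c) x + word Q (b, c) y + ε * word Q (b, c) z) =
      iPow (Q (b ^ 2 * x) + Q (b ^ 2 * y) + ε * Q (b ^ 2 * z)) *
        iPow (2 * Q ((x + y + z) * c)) := by
    intro b c
    rw [← iPow_add]
    simp only [word, mul_comm _ c, mul_add, hQ.double_add]
    congr 1
    linear_combination Q (c * z) * hε
  rw [Fintype.sum_prod_type]
  simp only [h1, ← Finset.mul_sum, hQ.sum_linear hodd]
  by_cases h0 : x + y + z = 0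
  -- A fourth root w of s turns Q(b⁴s) into Q(wb), to which `sum_linear` applies.
  · obtain ⟨r, hr⟩ := FiniteField.isSquare_of_char_two (ringChar.eq F 2) s
    obtain ⟨w, hw⟩ := FiniteField.isSquare_of_char_two (ringChar.eq F 2) r
    have hw4 : s = w ^ 4 := by rw [hr, hw]; ring
    have h2 : ∀ b, Q (b ^ 4 * s) = Q (w * b) := by
      intro b
      rw [hw4, show b ^ 4 * w ^ 4 = ((w * b) ^ 2) ^ 2 by ring, hQ.sq, hQ.sq]
    simp only [h0, hs h0, h2, true_and, if_true, ← Finset.sum_mul, hQ.sum_linear hodd]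
    have h3 : s = 0 ↔ w = 0 := by rw [hw4]; exact pow_eq_zero_iff (by norm_num)
    simp only [h3]
    split_ifs
    · rw [← mul_pow]
      norm_num
    · rw [zero_mul]
  · simp [h0]

/-- Otherwise x/y would be a primitive cube root of unity, but 2^m ≡ 2 modulo 3 for odd m, so its
2^m-th power would not be itself. -/
lemma eq_zero_of_sq_add_mul_add_sq (hQ : IsTraceForm m Q) (hodd : Odd m) {x y : F}
    (h : x ^ 2 + x * y + y ^ 2 = 0) : x = 0 ∧ y = 0 := by
  have hy : y = 0 := by
    by_contra hy
    have h1 : (x / y) ^ 2 + x / y + 1 = 0 := by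
      field_simp
      linear_combination h
    generalize x / y = w at h1
    have h3 : w ^ 3 = 1 := by linear_combination (w - 1) * h1
    have h4 : w ^ 2 ^ m = w := by rw [← hQ.card, FiniteField.pow_card]
    obtain ⟨k, rfl⟩ := hodd
    have h5 : ∃ c, 2 ^ (2 * k + 1) = 3 * c + 2 := by
      induction k with
      | zero => exact ⟨0, rfl⟩
      | succ k ih =>
        clear ih
        have : 2 ^ (2 * (k + 1) + 1) % 3 = 2 := by
          rw [pow_succ, pow_mul, Nat.mul_mod, Nat.pow_mod]
          norm_num
        exact ⟨2 ^ (2 * (k + 1) + 1) / 3, by omega⟩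
    obtain ⟨c, hc⟩ := h5
    rw [hc, pow_add, pow_mul, h3, one_pow, one_mul] at h4
    have h6 : w = 1 := by
      have : w ^ 3 = w * w := by rw [pow_succ, h4]
      rw [← h4, pow_two, ← this, h3]
    have := hQ.charP
    rw [h6] at h1
    have h7 := CharTwo.add_self_eq_zero (1 : F)
    have : (1 : F) = 0 := by linear_combination h1 - h7
    exact one_ne_zero this
  subst hy
  refine ⟨?_, rfl⟩
  simpa using h

/-- On z = x + y the three quadratic terms add up to 2Q(b⁴(x² + xy + y²)), and this form is
anisotropic. -/
lemma sum_word_add_add (hQ : IsTraceForm m Q) (hodd : Odd m) [DecidableEq F] (x y z : F) :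
    ∑ u : F × F, iPow (word Q u x + word Q u y + word Q u z) =
      if x = 0 ∧ y = 0 ∧ z = 0 then 4 ^ m else 0 := by
  have := hQ.charP
  have h := hQ.sum_sum_word hodd 1 rfl x y z (x ^ 2 + x * y + y ^ 2) (by
    intro h b
    obtain rfl : z = x + y := (CharTwo.add_eq_zero.1 h).symm
    have e : ∀ w, Q (b ^ 4 * w ^ 2) = Q (b ^ 2 * w) := fun w => by
      rw [show b ^ 4 * w ^ 2 = (b ^ 2 * w) ^ 2 by ring, hQ.sq]
    rw [mul_add (b ^ 2), hQ.add (b ^ 2 * x), mul_add (b ^ 4), hQ.double_add, mul_add (b ^ 4),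
      hQ.double_add, e, e, show b ^ 2 * x * (b ^ 2 * y) = b ^ 4 * (x * y) by ring]
    ring)
  simp only [one_mul] at h
  rw [h]
  congr 1
  refine propext ⟨fun ⟨h1, h2⟩ => ?_, ?_⟩
  · obtain ⟨rfl, rfl⟩ := hQ.eq_zero_of_sq_add_mul_add_sq hodd h2
    exact ⟨rfl, rfl, by simpa using h1⟩
  · rintro ⟨rfl, rfl, rfl⟩
    simp

/-- With the minus sign only the cross term 2Q(b⁴xy) survives on z = x + y. -/
lemma sum_word_add_sub (hQ : IsTraceForm m Q) (hodd : Odd m) [DecidableEq F] (x y z : F) :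
    ∑ u : F × F, iPow (word Q u x + word Q u y - word Q u z) =
      if x + y = z ∧ x * y = 0 then 4 ^ m else 0 := by
  have := hQ.charP
  have h := hQ.sum_sum_word hodd (-1) rfl x y z (x * y) (by
    intro h b
    obtain rfl : z = x + y := (CharTwo.add_eq_zero.1 h).symm
    have e : ∀ w : ZMod 4, -(2 * w) = 2 * w := by decide
    rw [mul_add, hQ.add (b ^ 2 * x),
      show b ^ 2 * x * (b ^ 2 * y) = b ^ 4 * (x * y) by ring]
    linear_combination e (Q (b ^ 4 * (x * y))))
  simp only [neg_one_mul, ← sub_eq_add_neg] at h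
  rw [h]
  simp only [CharTwo.add_eq_zero]

end

end IsTraceForm

end GaloisZ4

/-! ### The first three moments of the real parts of the sums over a trace fibre. -/

namespace GaloisZ4

lemma re_sum {ι : Type*} (s : Finset ι) (f : ι → GaussianInt) :
    (∑ i ∈ s, f i).re = ∑ i ∈ s, (f i).re :=
  map_sum (⟨⟨Zsqrtd.re, rfl⟩, fun _ _ => rfl⟩ : GaussianInt →+ ℤ) f s

lemma re_intCast_mul (n : ℤ) (z : GaussianInt) : ((n : GaussianInt) * z).re = n * z.re := by
  simp

/-- The product-to-sum formula for cosines; it reduces the third moment to the orthogonality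
relations. -/
lemma iPow_re_mul_mul : ∀ a b c : ZMod 4, 4 * ((iPow a).re * (iPow b).re * (iPow c).re) =
    (iPow (a + b + c)).re + (iPow (a + b - c)).re + (iPow (a + c - b)).re +
      (iPow (b + c - a)).re := by decide

lemma iPow_re_mul : ∀ a b : ZMod 4, 2 * ((iPow a).re * (iPow b).re) =
    (iPow (a + b)).re + (iPow (a - b)).re := by decide

/-- Odd m ≥ 3 is written 2j+3, so that 2^j is the factor 2^((m-3)/2) of the tables. -/
lemma one_add_i_pow (j : ℕ) :
    (⟨1, 1⟩ : GaussianInt) ^ (2 * j + 3) = ((2 ^ (j + 1) : ℤ) : GaussianInt) *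
      (iPow ((j + 1 : ℕ) : ZMod 4) * ⟨1, 1⟩) := by
  rw [show 2 * j + 3 = 2 * (j + 1) + 1 by ring, pow_succ, pow_mul,
    show (⟨1, 1⟩ : GaussianInt) ^ 2 = 2 * ⟨0, 1⟩ by decide, mul_pow, iPow_natCast]
  push_cast
  ring

namespace IsTraceForm

section Moments

variable {m : ℕ} {F : Type*} [Field F] [Fintype F] {Q : F → ZMod 4}

lemma sum_word_add_add_re (hQ : IsTraceForm m Q) (hodd : Odd m) [DecidableEq F] (x y z : F) :
    ∑ u : F × F, (iPow (word Q u x + word Q u y + word Q u z)).re =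
      if x = 0 ∧ y = 0 ∧ z = 0 then 4 ^ m else 0 := by
  rw [← re_sum, hQ.sum_word_add_add hodd]
  split_ifs
  · rw [show (4 : GaussianInt) ^ m = ((4 ^ m : ℤ) : GaussianInt) by push_cast; rfl,
      Zsqrtd.re_intCast]
  · rfl

lemma sum_word_add_sub_re (hQ : IsTraceForm m Q) (hodd : Odd m) [DecidableEq F] (x y z : F) :
    ∑ u : F × F, (iPow (word Q u x + word Q u y - word Q u z)).re =
      if x + y = z ∧ x * y = 0 then 4 ^ m else 0 := by
  rw [← re_sum, hQ.sum_word_add_sub hodd]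
  split_ifs
  · rw [show (4 : GaussianInt) ^ m = ((4 ^ m : ℤ) : GaussianInt) by push_cast; rfl,
      Zsqrtd.re_intCast]
  · rfl

lemma sum_fiber_ite (hQ : IsTraceForm m Q) [DecidableEq F] (t : ZMod 4) (w : ℤ) :
    ∑ x with Q x = t, (if x = 0 then w else 0) = if t = 0 then w else 0 := by
  rw [Finset.sum_ite_eq']
  simp [hQ.zero, eq_comm]

lemma sum_fiberSum_re (hQ : IsTraceForm m Q) (hodd : Odd m) (t : ZMod 4) :
    ∑ u, (fiberSum Q t u).re = if t = 0 then 4 ^ m else 0 := by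
  classical
  simp only [fiberSum, re_sum]
  rw [Finset.sum_comm, ← hQ.sum_fiber_ite]
  refine Finset.sum_congr rfl fun x _ => ?_
  have := hQ.sum_word_add_add_re hodd x 0 0
  simpa [hQ.word_zero_right] using this

/-- After product-to-sum, the difference terms contribute the diagonal x = y and the sum terms only
x = y = 0, which lies in the fibre exactly when t = 0. -/
lemma two_mul_sum_fiberSum_re_sq (hQ : IsTraceForm m Q) (hodd : Odd m) (t : ZMod 4) :
    2 * ∑ u, (fiberSum Q t u).re ^ 2 =
      4 ^ m * (((Finset.univ.filter fun a => Q a = t).card : ℤ) + if t = 0 then 1 else 0) := by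
  classical
  set D := Finset.univ.filter fun a => Q a = t with hD
  have h1 : 2 * ∑ u, (fiberSum Q t u).re ^ 2 = ∑ x ∈ D, ∑ y ∈ D, ∑ u,
      ((iPow (word Q u x + word Q u y)).re + (iPow (word Q u x - word Q u y)).re) := by
    have hu : ∀ u, 2 * (fiberSum Q t u).re ^ 2 = ∑ x ∈ D, ∑ y ∈ D,
        ((iPow (word Q u x + word Q u y)).re + (iPow (word Q u x - word Q u y)).re) := by
      intro u
      rw [fiberSum, re_sum, ← hD, pow_two, Finset.sum_mul_sum, Finset.mul_sum]
      refine Finset.sum_congr rfl fun x _ => ?_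
      rw [Finset.mul_sum]
      exact Finset.sum_congr rfl fun y _ => iPow_re_mul _ _
    rw [Finset.mul_sum, Finset.sum_congr rfl fun u _ => hu u, Finset.sum_comm]
    exact Finset.sum_congr rfl fun x _ => Finset.sum_comm
  have h2 : ∀ x y, ∑ u,
      ((iPow (word Q u x + word Q u y)).re + (iPow (word Q u x - word Q u y)).re) =
      (if x = 0 then if y = 0 then 4 ^ m else 0 else 0) + if x = y then 4 ^ m else 0 := by
    intro x y
    have e1 := hQ.sum_word_add_add_re hodd x y 0
    have e2 := hQ.sum_word_add_sub_re hodd x 0 y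
    simp only [hQ.word_zero_right, add_zero, mul_zero, and_true] at e1 e2
    rw [Finset.sum_add_distrib, e1, e2, ite_and]
  rw [h1]
  have h4 : ∀ x ∈ D, (if x ∈ D then (4 ^ m : ℤ) else 0) = 4 ^ m := fun x hx => if_pos hx
  simp only [h2, Finset.sum_add_distrib, Finset.sum_ite_eq]
  rw [Finset.sum_congr rfl h4, Finset.sum_const, nsmul_eq_mul, mul_add]
  have h3 : ∀ x : F, ∑ y ∈ D, (if x = 0 then if y = 0 then (4 ^ m : ℤ) else 0 else 0) =
      if x = 0 then if t = 0 then 4 ^ m else 0 else 0 := by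
    intro x
    split_ifs with hx ht
    · rw [hD, hQ.sum_fiber_ite, if_pos ht]
    · rw [hD, hQ.sum_fiber_ite, if_neg ht]
    · simp
  simp only [h3]
  rw [hQ.sum_fiber_ite]
  split_ifs <;> ring

/-- For t = 0 the sum term contributes the zero triple and each of the three mixed terms 2|D| - 1
triples, so that 1 + 3(2|D| - 1) = 6|D| - 2. For t ≠ 0 nothing contributes, since 0 is not in the
fibre. -/
lemma four_mul_sum_fiberSum_re_cube (hQ : IsTraceForm m Q) (hodd : Odd m) (t : ZMod 4) :
    4 * ∑ u, (fiberSum Q t u).re ^ 3 = if t = 0 then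
      4 ^ m * (6 * ((Finset.univ.filter fun a => Q a = t).card : ℤ) - 2) else 0 := by
  classical
  set D := Finset.univ.filter fun a => Q a = t with hD
  have hmem : ∀ x, x ∈ D ↔ Q x = t := by simp [hD]
  have h1 : 4 * ∑ u, (fiberSum Q t u).re ^ 3 = ∑ x ∈ D, ∑ y ∈ D, ∑ z ∈ D, ∑ u,
      ((iPow (word Q u x + word Q u y + word Q u z)).re +
        (iPow (word Q u x + word Q u y - word Q u z)).re +
        (iPow (word Q u x + word Q u z - word Q u y)).re +
        (iPow (word Q u y + word Q u z - word Q u x)).re) := by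
    have hu : ∀ u, 4 * (fiberSum Q t u).re ^ 3 = ∑ x ∈ D, ∑ y ∈ D, ∑ z ∈ D,
        ((iPow (word Q u x + word Q u y + word Q u z)).re +
          (iPow (word Q u x + word Q u y - word Q u z)).re +
          (iPow (word Q u x + word Q u z - word Q u y)).re +
          (iPow (word Q u y + word Q u z - word Q u x)).re) := by
      intro u
      rw [fiberSum, re_sum, ← hD, pow_succ, pow_two, Finset.sum_mul_sum, Finset.sum_mul,
        Finset.mul_sum]
      refine Finset.sum_congr rfl fun x _ => ?_
      rw [Finset.sum_mul, Finset.mul_sum]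
      refine Finset.sum_congr rfl fun y _ => ?_
      rw [Finset.mul_sum, Finset.mul_sum]
      exact Finset.sum_congr rfl fun z _ => iPow_re_mul_mul _ _ _
    rw [Finset.mul_sum, Finset.sum_congr rfl fun u _ => hu u, Finset.sum_comm]
    refine Finset.sum_congr rfl fun x _ => ?_
    rw [Finset.sum_comm]
    exact Finset.sum_congr rfl fun y _ => Finset.sum_comm
  let B : F → F → F → ℤ := fun x y z => if x + y = z ∧ x * y = 0 then 4 ^ m else 0
  have h2 : ∀ x y z, ∑ u,
      ((iPow (word Q u x + word Q u y + word Q u z)).re +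
        (iPow (word Q u x + word Q u y - word Q u z)).re +
        (iPow (word Q u x + word Q u z - word Q u y)).re +
        (iPow (word Q u y + word Q u z - word Q u x)).re) =
      (if x = 0 then if y = 0 then if z = 0 then 4 ^ m else 0 else 0 else 0) + B x y z +
        B x z y + B y z x := by
    intro x y z
    simp only [Finset.sum_add_distrib, hQ.sum_word_add_add_re hodd, hQ.sum_word_add_sub_re hodd,
      ite_and, B]
  have hB1 : ∑ x ∈ D, ∑ y ∈ D, ∑ z ∈ D, B x z y = ∑ x ∈ D, ∑ y ∈ D, ∑ z ∈ D, B x y z :=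
    Finset.sum_congr rfl fun x _ => Finset.sum_comm
  have hB2 : ∑ x ∈ D, ∑ y ∈ D, ∑ z ∈ D, B y z x = ∑ x ∈ D, ∑ y ∈ D, ∑ z ∈ D, B x y z := by
    rw [Finset.sum_comm]
    exact Finset.sum_congr rfl fun x _ => Finset.sum_comm
  -- The solutions of z = x + y and xy = 0 are (x, 0, x) and (0, y, y), with the zero triple common
  -- to both families.
  have hB : ∑ x ∈ D, ∑ y ∈ D, ∑ z ∈ D, B x y z = if t = 0 then 4 ^ m * (2 * (D.card : ℤ) - 1)
      else 0 := by
    have e1 : ∀ x ∈ D, ∀ y ∈ D, ∑ z ∈ D, B x y z = if x * y = 0 then 4 ^ m else 0 := by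
      intro x hx y hy
      simp only [B, ite_and, Finset.sum_ite_eq]
      split_ifs with h h' h'
      · rfl
      · rfl
      · exfalso
        apply h
        rcases mul_eq_zero.1 h' with rfl | rfl
        · rwa [zero_add]
        · rwa [add_zero]
      · rfl
    rw [Finset.sum_congr rfl fun x hx => Finset.sum_congr rfl fun y hy => e1 x hx y hy]
    have e2 : ∀ x y : F, (if x * y = 0 then (4 ^ m : ℤ) else 0) = (if x = 0 then 4 ^ m else 0) +
        (if y = 0 then 4 ^ m else 0) -
        (if x = 0 then if y = 0 then 4 ^ m else 0 else 0) := by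
      intro x y
      by_cases hx : x = 0 <;> by_cases hy : y = 0 <;> simp [hx, hy]
    have e3 : ∀ x : F, ∑ y ∈ D, (if x = 0 then if y = 0 then (4 ^ m : ℤ) else 0 else 0) =
        if x = 0 then if t = 0 then 4 ^ m else 0 else 0 := by
      intro x
      split_ifs with hx ht
      · rw [hD, hQ.sum_fiber_ite, if_pos ht]
      · rw [hD, hQ.sum_fiber_ite, if_neg ht]
      · simp
    simp only [e2, Finset.sum_sub_distrib, Finset.sum_add_distrib, e3]
    simp only [hD, hQ.sum_fiber_ite, Finset.sum_const]
    rw [← Finset.smul_sum, hQ.sum_fiber_ite]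
    split_ifs
    · simp only [nsmul_eq_mul]
      ring
    · simp
  have hA : ∑ x ∈ D, ∑ y ∈ D, ∑ z ∈ D,
      (if x = 0 then if y = 0 then if z = 0 then (4 ^ m : ℤ) else 0 else 0 else 0) =
      if t = 0 then 4 ^ m else 0 := by
    by_cases ht : t = 0
    · have h0 : (0 : F) ∈ D := (hmem 0).2 (by rw [hQ.zero, ht])
      rw [Finset.sum_eq_single 0, Finset.sum_eq_single 0, Finset.sum_eq_single 0]
      · simp [ht]
      · intro z _ hz; simp [hz]
      · exact fun h => absurd h0 h
      · intro y _ hy; simp [hy]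
      · exact fun h => absurd h0 h
      · intro x _ hx; simp [hx]
      · exact fun h => absurd h0 h
    · rw [if_neg ht]
      refine Finset.sum_eq_zero fun x hx => Finset.sum_eq_zero fun y _ =>
        Finset.sum_eq_zero fun z _ => if_neg ?_
      rintro rfl
      exact ht (by rw [← (hmem 0).1 hx, hQ.zero])
  rw [h1]
  simp only [h2, Finset.sum_add_distrib, hB1, hB2, hB, hA]
  split_ifs <;> ring

end Moments

/-! ### Explicit values of the sums over a trace fibre. -/

section Values

variable {j : ℕ} {F : Type*} [Field F] [Fintype F] {Q : F → ZMod 4}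

lemma odd_two_mul_add_three (j : ℕ) : Odd (2 * j + 3) := ⟨j + 1, by ring⟩

lemma re_iPow_mul_gauss (j : ℕ) (s a : ZMod 4) :
    (iPow s * (iPow (-a) * (⟨1, 1⟩ : GaussianInt) ^ (2 * j + 3))).re =
      2 ^ (j + 1) * sgn (((j + 1 : ℕ) : ZMod 4) - a + s) := by
  rw [one_add_i_pow, show ((j + 1 : ℕ) : ZMod 4) - a + s = s + (-a + ((j + 1 : ℕ) : ZMod 4)) by
    ring, sgn, iPow_add, iPow_add, ← re_intCast_mul]
  congr 1
  ring

/-- Both b and b + 1 are nonzero, so each of the four complete sums is a power of i times the Gauss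
sum, with real part ±2^(j+1). -/
lemma two_mul_fiberSum_re (hQ : IsTraceForm (2 * j + 3) Q) (t : ZMod 4) {b : F} (hb0 : b ≠ 0)
    (hb1 : b ≠ 1) (c : F) :
    2 * (fiberSum Q t (b, c)).re = 2 ^ j *
      (sgn (((j + 1 : ℕ) : ZMod 4) - Q (c / b ^ 2)) +
        sgn (((j + 1 : ℕ) : ZMod 4) - Q ((c + b) / (b + 1) ^ 2) - t) +
        sgn (((j + 1 : ℕ) : ZMod 4) - Q ((c + 1) / b ^ 2) - 2 * t) +
        sgn (((j + 1 : ℕ) : ZMod 4) - Q ((c + b + 1) / (b + 1) ^ 2) - 3 * t)) := by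
  have := hQ.charP
  have hb2 : b + 1 ≠ 0 := fun h => hb1 (CharTwo.add_eq_zero.1 h)
  have h := congrArg Zsqrtd.re (hQ.four_mul_fiberSum t b c)
  rw [hQ.sum_word_of_ne_zero (odd_two_mul_add_three j) hb0,
    hQ.sum_word_of_ne_zero (odd_two_mul_add_three j) hb0,
    hQ.sum_word_of_ne_zero (odd_two_mul_add_three j) hb2,
    hQ.sum_word_of_ne_zero (odd_two_mul_add_three j) hb2] at h
  have e1 : ∀ z : GaussianInt, z = iPow 0 * z := fun z => by rw [iPow_zero, one_mul]
  rw [e1 (iPow (-Q (c / b ^ 2)) * _)] at h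
  simp only [Zsqrtd.re_add, re_iPow_mul_gauss] at h
  rw [show (4 : GaussianInt) = ((4 : ℤ) : GaussianInt) by rfl, re_intCast_mul] at h
  simp only [neg_mul, ← sub_eq_add_neg, add_zero] at h
  rw [pow_succ] at h
  linarith

/-- The complete sums of u and u+2 vanish, and the two Gauss sums of u+1 and u+3 add up to a real
number. -/
lemma fiberSum_zero_left (hQ : IsTraceForm (2 * j + 3) Q) (t : ZMod 4) {c : F} (hc0 : c ≠ 0)
    (hc1 : c ≠ 1) :
    fiberSum Q t (0, c) = ((2 ^ j * sgn (((j + 1 : ℕ) : ZMod 4) - Q c - t) : ℤ) : GaussianInt) := by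
  classical
  have := hQ.charP
  have hc2 : c + 1 ≠ 0 := fun h => hc1 (CharTwo.add_eq_zero.1 h)
  have h := hQ.four_mul_fiberSum t 0 c
  rw [hQ.sum_word_of_eq_zero (odd_two_mul_add_three j), if_neg hc0,
    hQ.sum_word_of_eq_zero (odd_two_mul_add_three j), if_neg hc2, zero_add (1 : F),
    hQ.sum_word_of_ne_zero (odd_two_mul_add_three j) one_ne_zero,
    hQ.sum_word_of_ne_zero (odd_two_mul_add_three j) one_ne_zero, add_zero, one_pow, div_one,
    div_one, hQ.add, hQ.one, mul_one, one_add_i_pow] at h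
  -- With κ = j+1, the value Q(1) = m is 2κ+1 modulo 4, so only finitely many cases remain.
  have h2 : ∀ t κ s : ZMod 4, iPow (-t) * (iPow (-s) * (iPow κ * ⟨1, 1⟩)) +
      iPow (-3 * t) * (iPow (-(s + (2 * κ + 1) + 2 * s)) * (iPow κ * ⟨1, 1⟩)) =
      ((2 * sgn (κ - s - t) : ℤ) : GaussianInt) := by
    decide
  have h3 := h2 t ((j + 1 : ℕ) : ZMod 4) (Q c)
  rw [show (2 * ((j + 1 : ℕ) : ZMod 4) + 1) = ((2 * j + 3 : ℕ) : ZMod 4) by push_cast; ring] at h3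
  have h4 : (4 : GaussianInt) ≠ 0 := by decide
  refine mul_left_cancel₀ h4 ?_
  rw [h]
  push_cast at h3 ⊢
  linear_combination 2 ^ (j + 1) * h3

lemma fiberSum_zero (Q : F → ZMod 4) (hQ : IsTraceForm (2 * j + 3) Q) (t : ZMod 4) :
    fiberSum Q t (0, 0) = ((Finset.univ.filter fun a => Q a = t).card : GaussianInt) := by
  simp [fiberSum, word, hQ.zero, iPow_zero]

/-- The fibre sum of the zero word counts the fibre: the complete sum 2^m gives the main term and
two Gauss sums give the correction. -/
lemma card_fiber (hQ : IsTraceForm (2 * j + 3) Q) (t : ZMod 4) :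
    ((Finset.univ.filter fun a => Q a = t).card : ℤ) =
      2 * 2 ^ j * 2 ^ j + 2 ^ j * sgn (((j + 1 : ℕ) : ZMod 4) - t) := by
  classical
  have := hQ.charP
  have h := hQ.four_mul_fiberSum t 0 0
  rw [hQ.fiberSum_zero, hQ.sum_word_of_eq_zero (odd_two_mul_add_three j), if_pos rfl,
    zero_add (1 : F), add_zero (0 : F),
    hQ.sum_word_of_eq_zero (odd_two_mul_add_three j), if_neg one_ne_zero,
    hQ.sum_word_of_ne_zero (odd_two_mul_add_three j) one_ne_zero,
    hQ.sum_word_of_ne_zero (odd_two_mul_add_three j) one_ne_zero, one_pow, div_one,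
    div_one, zero_add (1 : F), hQ.zero, hQ.one, one_add_i_pow] at h
  have h2 : ∀ t κ : ZMod 4, iPow (-t) * (iPow (-0) * (iPow κ * ⟨1, 1⟩)) +
      iPow (-3 * t) * (iPow (-(2 * κ + 1)) * (iPow κ * ⟨1, 1⟩)) =
      ((2 * sgn (κ - t) : ℤ) : GaussianInt) := by
    decide
  have h3 := h2 t ((j + 1 : ℕ) : ZMod 4)
  rw [show (2 * ((j + 1 : ℕ) : ZMod 4) + 1) = ((2 * j + 3 : ℕ) : ZMod 4) by push_cast; ring] at h3
  have h4 : (4 : GaussianInt) ≠ 0 := by decide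
  suffices (((Finset.univ.filter fun a => Q a = t).card : ℤ) : GaussianInt) =
      ((2 * 2 ^ j * 2 ^ j + 2 ^ j * sgn (((j + 1 : ℕ) : ZMod 4) - t) : ℤ) : GaussianInt) by
    exact_mod_cast this
  refine mul_left_cancel₀ h4 ?_
  push_cast at h h3 ⊢
  rw [h, pow_add, mul_comm 2 j, pow_mul]
  linear_combination 2 ^ (j + 1) * h3

lemma fiberSum_zero_one (hQ : IsTraceForm (2 * j + 3) Q) (t : ZMod 4) :
    fiberSum Q t (0, 1) = iPow (2 * t) * (Finset.univ.filter fun a => Q a = t).card := by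
  rw [fiberSum, Finset.sum_congr rfl (g := fun _ => iPow (2 * t)), Finset.sum_const, nsmul_eq_mul,
    mul_comm]
  intro a ha
  rw [hQ.word_zero_one, (Finset.mem_filter.1 ha).2]

lemma fiberSum_one_left (hQ : IsTraceForm (2 * j + 3) Q) (t : ZMod 4) (c : F) :
    fiberSum Q t (1, c) = iPow t * fiberSum Q t (0, c) := by
  rw [fiberSum, fiberSum, Finset.mul_sum]
  refine Finset.sum_congr rfl fun a ha => ?_
  rw [← iPow_add, ← (Finset.mem_filter.1 ha).2, ← hQ.word_one_zero, ← hQ.word_wordAdd]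
  simp [wordAdd]

end Values

end IsTraceForm

end GaloisZ4

/-! ### The product of the four signs as an additive character. -/

namespace GaloisZ4

/-- The product of the signs that belong to `u` and `u + 2`. -/
def pairSgn {F : Type*} [Field F] (Q : F → ZMod 4) (κ t : ZMod 4) (b c : F) : ℤ :=
  sgn (κ - Q (c / b ^ 2)) * sgn (κ - Q ((c + 1) / b ^ 2) - 2 * t)

/-- The product of the signs that belong to `u`, `u + 1`, `u + 2` and `u + 3`. -/
def prodSgn {F : Type*} [Field F] (Q : F → ZMod 4) (κ t : ZMod 4) (b c : F) : ℤ :=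
  pairSgn Q κ t b c * pairSgn Q (κ - t) t (b + 1) (c + b)

/-- The element `v` for which `pairSgn` is the character `c ↦ (-1) ^ tr (c * v)`, up to sign. -/
def pairSlope {F : Type*} [Field F] (Q : F → ZMod 4) (b : F) : F :=
  (1 / b ^ 2) ^ 2 + if 2 * Q (1 / b ^ 2) = 0 then 0 else 1 / b ^ 2

/-- The sign depends quadratically on its argument, so the product of two signs changes under a
shift by a factor independent of a. -/
lemma sgn_mul_sgn_sub : ∀ a d w z : ZMod 4,
    sgn (a - w) * sgn (a - w - (d + 2 * z)) = sgn a * sgn (a - d) * (iPow (2 * (z + w * d))).re := by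
  decide

lemma two_mul_eq_zero_or : ∀ a : ZMod 4, 2 * a = 0 ∨ 2 * a = 2 := by decide

lemma four_eq_zero : (4 : ZMod 4) = 0 := rfl

namespace IsTraceForm

variable {m : ℕ} {F : Type*} [Field F] [Fintype F] {Q : F → ZMod 4}

/-- With β = 1/b², the gap between the two arguments has the parity of Q(β), whatever c is. The
exponent in `sgn_mul_sgn_sub` therefore becomes additive in e: it is the trace of eβ², plus that of
eβ when Q(β) is odd. -/
lemma pairSgn_add (hQ : IsTraceForm m Q) (κ t : ZMod 4) (b c e : F) :
    pairSgn Q κ t b (c + e) = pairSgn Q κ t b c * (iPow (2 * Q (e * pairSlope Q b))).re := by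
  have h1 : 2 * Q (e * pairSlope Q b) =
      2 * Q (e * (1 / b ^ 2) ^ 2) + 2 * Q (e * (1 / b ^ 2)) * Q (1 / b ^ 2) := by
    rw [pairSlope, mul_add, hQ.double_add]
    split_ifs with h
    · rw [mul_zero, hQ.zero]
      linear_combination -Q (e * (1 / b ^ 2)) * h
    · linear_combination -Q (e * (1 / b ^ 2)) * (two_mul_eq_zero_or (Q (1 / b ^ 2))).resolve_left h
  rw [h1, pairSgn, pairSgn]
  set β := 1 / b ^ 2
  have e1 : ∀ x, x / b ^ 2 = x * β := fun x => by simp only [β]; ring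
  have e2 : Q ((c + e) * β) = Q (c * β) + (Q (e * β) + 2 * Q (c * β * (e * β))) := by
    rw [add_mul, hQ.add]
    ring
  have e3 : Q ((c + 1) * β) = Q (c * β) + (Q β + 2 * Q (c * β * β)) := by
    rw [add_mul, one_mul, hQ.add]
    ring
  have e4 : Q ((c + e + 1) * β) = Q (c * β) + (Q (e * β) + 2 * Q (c * β * (e * β))) +
      (Q β + 2 * Q (c * β * β) + 2 * Q (e * β ^ 2)) := by
    rw [add_mul, one_mul, hQ.add, e2, add_mul, add_mul, hQ.double_add,
      show e * β * β = e * β ^ 2 by ring]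
    ring
  rw [e1, e1, e1, e1, e2, e3, e4]
  have h := sgn_mul_sgn_sub (κ - Q (c * β)) (Q β + 2 * Q (c * β * β) + 2 * t)
    (Q (e * β) + 2 * Q (c * β * (e * β))) (Q (e * β ^ 2))
  rw [show 2 * (Q (e * β ^ 2) + (Q (e * β) + 2 * Q (c * β * (e * β))) *
      (Q β + 2 * Q (c * β * β) + 2 * t)) = 2 * Q (e * β ^ 2) + 2 * Q (e * β) * Q β by
    linear_combination (Q (c * β * (e * β)) * (Q β + 2 * Q (c * β * β) + 2 * t) +
      Q (e * β) * Q (c * β * β) + Q (e * β) * t) * four_eq_zero] at h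
  have e5 : κ - (Q (c * β) + (Q β + 2 * Q (c * β * β))) - 2 * t =
      κ - Q (c * β) - (Q β + 2 * Q (c * β * β) + 2 * t) := by ring
  rw [e5, ← h]
  congr 2
  · ring
  · ring

lemma prodSgn_add (hQ : IsTraceForm m Q) (κ t : ZMod 4) (b c e : F) :
    prodSgn Q κ t b (c + e) = prodSgn Q κ t b c *
      (iPow (2 * Q (e * (pairSlope Q b + pairSlope Q (b + 1))))).re := by
  rw [prodSgn, prodSgn, hQ.pairSgn_add, add_right_comm, hQ.pairSgn_add, mul_add, hQ.double_add]
  have h : ∀ x y : ZMod 4, (iPow (2 * x + 2 * y)).re = (iPow (2 * x)).re * (iPow (2 * y)).re := by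
    decide
  rw [h]
  ring

lemma sum_prodSgn_eq_zero (hQ : IsTraceForm m Q) (hodd : Odd m) (κ t : ZMod 4) {b : F}
    (hb : pairSlope Q b + pairSlope Q (b + 1) ≠ 0) : ∑ c, prodSgn Q κ t b c = 0 := by
  have h := Equiv.sum_comp (Equiv.addRight (pairSlope Q b + pairSlope Q (b + 1))⁻¹)
    fun c => prodSgn Q κ t b c
  simp only [Equiv.coe_addRight, hQ.prodSgn_add, inv_mul_cancel₀ hb, hQ.two_mul_one hodd] at h
  rw [← Finset.sum_mul, show (iPow 2).re = -1 by decide] at h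
  linarith

lemma sum_prodSgn_of_eq (hQ : IsTraceForm m Q) (κ t : ZMod 4) {b : F}
    (hb : pairSlope Q b + pairSlope Q (b + 1) = 0) :
    ∑ c, prodSgn Q κ t b c = 2 ^ m * prodSgn Q κ t b 0 := by
  have h : ∀ c, prodSgn Q κ t b c = prodSgn Q κ t b 0 := by
    intro c
    have := hQ.prodSgn_add κ t b 0 c
    rw [hb, mul_zero, hQ.zero, zero_add, mul_zero, iPow_zero] at this
    simpa using this
  rw [Finset.sum_congr rfl fun c _ => h c, Finset.sum_const, Finset.card_univ, hQ.card,
    nsmul_eq_mul]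
  push_cast
  rfl

section Cubic

variable {b : F}

/-- A root satisfies b² + b = b⁴ and b³ = b + 1; invariance of `Q` under squaring then determines
Q(b). -/
lemma cubic_apply (hQ : IsTraceForm m Q) (hodd : Odd m) (hb : b ^ 3 + b + 1 = 0) :
    Q b = 2 := by
  have := hQ.charP
  have h2 := CharTwo.two_eq_zero (R := F)
  have h4 : b ^ 2 + b = (b ^ 2) ^ 2 := by linear_combination -b * hb + (b ^ 2 + b) * h2
  have h3 : b ^ 3 = b + 1 := by linear_combination hb - (b + 1) * h2
  have h := hQ.add (b ^ 2) b
  rw [h4, hQ.sq, hQ.sq, show b ^ 2 * b = b ^ 3 by ring, h3, hQ.double_add, hQ.two_mul_one hodd] at h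
  linear_combination h + Q b * four_eq_zero

lemma cubic_inv (hQ : IsTraceForm m Q) (hb : b ^ 3 + b + 1 = 0) :
    b ≠ 0 ∧ b + 1 ≠ 0 ∧ 1 / b ^ 2 = (b ^ 2 + 1) ^ 2 ∧ 1 / (b + 1) ^ 2 = b := by
  have := hQ.charP
  have h2 := CharTwo.two_eq_zero (R := F)
  have h0 : b ≠ 0 := by
    rintro rfl
    simp at hb
  have h1 : b * (b + 1) ^ 2 = 1 := by linear_combination hb + (b ^ 2 - 1) * h2
  have h1' : b + 1 ≠ 0 := by
    intro h
    rw [h] at h1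
    simp at h1
  refine ⟨h0, h1', ?_, ?_⟩
  · rw [div_eq_iff (pow_ne_zero 2 h0)]
    have : b * (b ^ 2 + 1) = 1 := by linear_combination h1 - b ^ 2 * h2
    rw [← mul_pow, mul_comm, this, one_pow]
  · rw [div_eq_iff (pow_ne_zero 2 h1'), h1]

lemma cubic_apply_inv (hQ : IsTraceForm m Q) (hodd : Odd m) (hb : b ^ 3 + b + 1 = 0) :
    Q (1 / b ^ 2) = m + 2 := by
  rw [(hQ.cubic_inv hb).2.2.1, hQ.sq, hQ.add, mul_one, hQ.sq, hQ.one, hQ.cubic_apply hodd hb]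
  linear_combination four_eq_zero

lemma two_mul_cast_add_two (hodd : Odd m) : 2 * ((m : ZMod 4) + 2) ≠ 0 := by
  obtain ⟨k, rfl⟩ := hodd
  push_cast
  generalize (k : ZMod 4) = a
  revert a
  decide

lemma pairSlope_cubic (hQ : IsTraceForm m Q) (hodd : Odd m) (hb : b ^ 3 + b + 1 = 0) :
    pairSlope Q b + pairSlope Q (b + 1) = 0 := by
  have := hQ.charP
  have h2 := CharTwo.two_eq_zero (R := F)
  obtain ⟨_, _, e1, e2⟩ := hQ.cubic_inv hb
  have h1 := hQ.cubic_apply_inv hodd hb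
  rw [pairSlope, pairSlope, h1, if_neg (two_mul_cast_add_two hodd), e2, hQ.cubic_apply hodd hb,
    if_pos (by decide), e1]
  linear_combination (b ^ 5 + 3 * b ^ 3 - b ^ 2 + 4 * b - 4) * hb + (3 + b ^ 3 + 2 * b ^ 2) * h2

/-- The parities of Q(1/b²) and Q(1/(b+1)²) give four equations. After clearing denominators they
are 1 = 0, the squares of the two cubics, and the square of b² + b + 1, which has no root for odd m.
-/
lemma eq_zero_of_pairSlope (hQ : IsTraceForm m Q) (hodd : Odd m) (h0 : b ≠ 0) (h1 : b ≠ 1)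
    (hb : pairSlope Q b + pairSlope Q (b + 1) = 0) : b ^ 3 + b + 1 = 0 ∨ b ^ 3 + b ^ 2 + 1 = 0 := by
  have := hQ.charP
  have h2 := CharTwo.two_eq_zero (R := F)
  have h1' : b + 1 ≠ 0 := fun h => h1 (CharTwo.add_eq_zero.1 h)
  rw [pairSlope, pairSlope] at hb
  split_ifs at hb
  · exfalso
    field_simp at hb
    exact one_ne_zero (by linear_combination hb - (b ^ 4 + 2 * b ^ 3 + 3 * b ^ 2 + 2 * b) * h2)
  · right
    field_simp at hb
    refine pow_eq_zero_iff two_ne_zero |>.1 ?_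
    linear_combination hb - (2 * b + 2 * b ^ 2 + b ^ 3 + b ^ 4) * h2
  · left
    field_simp at hb
    refine pow_eq_zero_iff two_ne_zero |>.1 ?_
    linear_combination hb - (b + 3 * b ^ 2 + 3 * b ^ 3 + 3 * b ^ 4 + 2 * b ^ 5) * h2
  · exfalso
    field_simp at hb
    have h3 : b ^ 2 + b * 1 + 1 ^ 2 = 0 := by
      refine pow_eq_zero_iff two_ne_zero |>.1 ?_
      linear_combination hb - (b + 2 * b ^ 2 + 3 * b ^ 3 + 4 * b ^ 4 + 3 * b ^ 5 + b ^ 6) * h2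
    exact one_ne_zero (hQ.eq_zero_of_sq_add_mul_add_sq hodd h3).2

end Cubic

end IsTraceForm

end GaloisZ4

/-! ### Roots of the two cubics, and the source of σ. -/

namespace GaloisZ4

/-- The integer `σ` of the weight distribution. -/
def sigmaInt (m : ℕ) : ℤ := if 3 ∣ m then -3 else 0

namespace IsTraceForm

section Count

variable {m : ℕ} {F : Type*} [Field F] [Fintype F] {Q : F → ZMod 4}

lemma card_cubic_eq [DecidableEq F] (hQ : IsTraceForm m Q) :
    (Finset.univ.filter fun b : F => b ^ 3 + b ^ 2 + 1 = 0).card =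
      (Finset.univ.filter fun b : F => b ^ 3 + b + 1 = 0).card := by
  have := hQ.charP
  have h2 := CharTwo.two_eq_zero (R := F)
  refine Finset.card_bij' (fun b _ => b + 1) (fun b _ => b + 1) ?_ ?_ ?_ ?_
  · intro b hb
    simp only [Finset.mem_filter, Finset.mem_univ, true_and] at hb ⊢
    linear_combination hb + (b ^ 2 + 2 * b + 1) * h2
  · intro b hb
    simp only [Finset.mem_filter, Finset.mem_univ, true_and] at hb ⊢
    linear_combination hb + (2 * b ^ 2 + 2 * b + 1) * h2
  · intro b _
    linear_combination h2
  · intro b _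
    linear_combination h2

/-- A root has order 7, while 2^m is 2 or 4 modulo 7 when 3 ∤ m; together with b^(2^m) = b this
forces b = 1. -/
lemma not_cubic (hQ : IsTraceForm m Q) (hm : ¬3 ∣ m) (b : F) : b ^ 3 + b + 1 ≠ 0 := by
  intro hb
  have := hQ.charP
  have h2 := CharTwo.two_eq_zero (R := F)
  have h7 : b ^ 7 = 1 := by
    linear_combination (b ^ 4 - b ^ 2 - b + 1) * hb + (b ^ 2 - 1) * h2
  have h1 : b ≠ 1 := by
    rintro rfl
    exact one_ne_zero (by linear_combination hb - h2)
  have hm' : b ^ 2 ^ m = b := by rw [← hQ.card, FiniteField.pow_card]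
  have h0 : b ≠ 0 := by
    rintro rfl
    simp at h7
  have h8 : ∀ k, 2 ^ m % 7 = k → b ^ k = b := by
    intro k hk
    rw [← Nat.div_add_mod (2 ^ m) 7, pow_add, pow_mul, h7, one_pow, one_mul, hk] at hm'
    exact hm'
  have hmod : 2 ^ m % 7 = 2 ∨ 2 ^ m % 7 = 4 := by
    rw [← Nat.div_add_mod m 3, pow_add, pow_mul, Nat.mul_mod, Nat.pow_mod]
    have : m % 3 = 1 ∨ m % 3 = 2 := by omega
    rcases this with h | h <;> simp [h]
  rcases hmod with h | h
  · have h9 := h8 _ h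
    exact h1 (mul_left_cancel₀ h0 (by linear_combination h9))
  · have h9 := h8 _ h
    have h10 : b ^ 3 = 1 := mul_left_cancel₀ h0 (by linear_combination h9)
    exact h1 (by linear_combination h7 - (b ^ 4 + b) * h10)

/-- If 3 ∣ m then 7 ∣ 2^m - 1, so X⁷ - 1 = (X-1)(X³+X+1)(X³+X²+1) has seven roots. The cubics have
equally many roots, by b ↦ b + 1, hence three each. -/
lemma card_cubic [DecidableEq F] (hQ : IsTraceForm m Q) :
    ((Finset.univ.filter fun b : F => b ^ 3 + b + 1 = 0).card : ℤ) = -sigmaInt m := by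
  have := hQ.charP
  have h2 := CharTwo.two_eq_zero (R := F)
  rw [sigmaInt]
  split_ifs with hm
  · have h7 : (Finset.univ.filter fun x : F => x ^ 7 = 1).card = 7 := by
      refine card_pow_eq_one (by norm_num) ?_
      obtain ⟨k, rfl⟩ := hm
      rw [hQ.card, pow_mul]
      have h8 := Nat.sub_dvd_pow_sub_pow (2 ^ 3) 1 k
      rwa [one_pow] at h8
    have hunion : (Finset.univ.filter fun x : F => x ^ 7 = 1) =
        insert 1 ((Finset.univ.filter fun b : F => b ^ 3 + b + 1 = 0) ∪
          (Finset.univ.filter fun b : F => b ^ 3 + b ^ 2 + 1 = 0)) := by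
      ext b
      simp only [Finset.mem_filter, Finset.mem_univ, true_and, Finset.mem_insert, Finset.mem_union]
      have hf : b ^ 7 - 1 = (b - 1) * ((b ^ 3 + b + 1) * (b ^ 3 + b ^ 2 + 1)) := by
        linear_combination (b ^ 3 - b ^ 4) * h2
      rw [← sub_eq_zero, hf, mul_eq_zero, mul_eq_zero, sub_eq_zero]
    have hdisj : Disjoint (Finset.univ.filter fun b : F => b ^ 3 + b + 1 = 0)
        (Finset.univ.filter fun b : F => b ^ 3 + b ^ 2 + 1 = 0) := by
      rw [Finset.disjoint_filter]
      intro b _ h h'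
      have hb : b * (b - 1) = 0 := by linear_combination h' - h
      rcases mul_eq_zero.1 hb with rfl | hb
      · simp at h
      · rw [sub_eq_zero.1 hb] at h
        exact one_ne_zero (by linear_combination h - h2)
    rw [hunion, Finset.card_insert_of_notMem, Finset.card_union_of_disjoint hdisj,
      hQ.card_cubic_eq] at h7
    · omega
    · simp only [Finset.mem_union, Finset.mem_filter, Finset.mem_univ, true_and, one_pow]
      rintro (h | h) <;> exact one_ne_zero (by linear_combination h - h2)
  · rw [Finset.filter_false_of_mem fun b _ => hQ.not_cubic hm b]
    rfl

end Count

section Parity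

variable {j : ℕ} {F : Type*} [Field F] [Fintype F] {Q : F → ZMod 4}

/-- At such b the product does not depend on c, so c = 0 suffices; all values of `Q` involved are
known at a root, which leaves a finite check. -/
lemma prodSgn_cubic (hQ : IsTraceForm (2 * j + 3) Q) (t : ZMod 4) {b : F}
    (hb : b ^ 3 + b + 1 = 0) : prodSgn Q ((j + 1 : ℕ) : ZMod 4) t b 0 = -1 := by
  have := hQ.charP
  have h2 := CharTwo.two_eq_zero (R := F)
  have hodd := odd_two_mul_add_three j
  obtain ⟨h0, h1, e1, e2⟩ := hQ.cubic_inv hb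
  have hQb := hQ.cubic_apply hodd hb
  have e3 : Q (b / (b + 1) ^ 2) = 2 := by
    rw [← mul_one_div, e2, ← pow_two, hQ.sq, hQb]
  have e4 : Q ((b + 1) / (b + 1) ^ 2) = 2 := by
    rw [← hQ.sq, show ((b + 1) / (b + 1) ^ 2) ^ 2 = 1 / (b + 1) ^ 2 by field_simp, e2, hQb]
  rw [prodSgn, pairSgn, pairSgn, zero_div, hQ.zero, zero_add, zero_add,
    hQ.cubic_apply_inv hodd hb, e3, e4, show (((2 * j + 3 : ℕ) : ZMod 4)) =
      2 * ((j + 1 : ℕ) : ZMod 4) + 1 by push_cast; ring]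
  generalize ((j + 1 : ℕ) : ZMod 4) = κ
  revert κ t
  decide

lemma prodSgn_cubic' (hQ : IsTraceForm (2 * j + 3) Q) (t : ZMod 4) {b : F}
    (hb : b ^ 3 + b ^ 2 + 1 = 0) :
    prodSgn Q ((j + 1 : ℕ) : ZMod 4) t b 0 = if 2 * t = 0 then -1 else 1 := by
  have := hQ.charP
  have h2 := CharTwo.two_eq_zero (R := F)
  have hodd := odd_two_mul_add_three j
  obtain ⟨a, rfl⟩ : ∃ a, b = a + 1 := ⟨b - 1, by ring⟩
  have ha : a ^ 3 + a + 1 = 0 := by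
    linear_combination hb - (2 * a ^ 2 + 2 * a + 1) * h2
  have e : a + 1 + 1 = a := by linear_combination h2
  obtain ⟨h0, h1, e1, e2⟩ := hQ.cubic_inv ha
  have hQa := hQ.cubic_apply hodd ha
  have hQi := hQ.cubic_apply_inv hodd ha
  have e3 : Q ((a + 1) / a ^ 2) = 2 := by
    rw [show (a + 1) / a ^ 2 = a by
      rw [div_eq_iff (pow_ne_zero 2 h0)]
      linear_combination -ha + (a + 1) * h2, hQa]
  have e4 : Q (a / a ^ 2) = ((2 * j + 3 : ℕ) : ZMod 4) + 2 := by
    rw [← hQ.sq, show (a / a ^ 2) ^ 2 = 1 / a ^ 2 by field_simp, hQi]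
  rw [prodSgn, pairSgn, pairSgn, zero_div, hQ.zero, zero_add, zero_add, e, e2, hQa, e3, e4,
    show (((2 * j + 3 : ℕ) : ZMod 4)) = 2 * ((j + 1 : ℕ) : ZMod 4) + 1 by push_cast; ring]
  generalize ((j + 1 : ℕ) : ZMod 4) = κ
  revert κ t
  decide

/-- Only roots of the cubics contribute. For even t every root gives -2^m; for odd t the two cubics
give opposite signs and cancel. -/
lemma sum_sum_prodSgn [DecidableEq F] (hQ : IsTraceForm (2 * j + 3) Q) (t : ZMod 4) :
    ∑ b ∈ ({0, 1} : Finset F)ᶜ, ∑ c, prodSgn Q ((j + 1 : ℕ) : ZMod 4) t b c =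
      if 2 * t = 0 then 2 ^ (2 * j + 3) * (2 * sigmaInt (2 * j + 3)) else 0 := by
  have := hQ.charP
  have h2 := CharTwo.two_eq_zero (R := F)
  have hodd := odd_two_mul_add_three j
  have h : ∀ b ∈ ({0, 1} : Finset F)ᶜ, ∑ c, prodSgn Q ((j + 1 : ℕ) : ZMod 4) t b c =
      2 ^ (2 * j + 3) * (-(if b ^ 3 + b + 1 = 0 then 1 else 0) +
        (if 2 * t = 0 then -1 else 1) * if b ^ 3 + b ^ 2 + 1 = 0 then 1 else 0) := by
    intro b hb
    simp only [Finset.mem_compl, Finset.mem_insert, Finset.mem_singleton, not_or] at hb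
    have hexcl : b ^ 3 + b + 1 = 0 → b ^ 3 + b ^ 2 + 1 ≠ 0 := by
      intro h h'
      have hb' : b * (b - 1) = 0 := by linear_combination h' - h
      rcases mul_eq_zero.1 hb' with hb' | hb'
      · exact hb.1 hb'
      · exact hb.2 (sub_eq_zero.1 hb')
    by_cases hs : pairSlope Q b + pairSlope Q (b + 1) = 0
    · rw [hQ.sum_prodSgn_of_eq _ _ hs]
      rcases hQ.eq_zero_of_pairSlope hodd hb.1 hb.2 hs with h | h
      · rw [hQ.prodSgn_cubic t h, if_pos h, if_neg (hexcl h)]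
        simp
      · rw [hQ.prodSgn_cubic' t h, if_pos h, if_neg fun h' => hexcl h' h]
        simp
    · have n1 : b ^ 3 + b + 1 ≠ 0 := fun h => hs (hQ.pairSlope_cubic hodd h)
      have n2 : b ^ 3 + b ^ 2 + 1 ≠ 0 := by
        intro h
        have h' : (b + 1) ^ 3 + (b + 1) + 1 = 0 := by
          linear_combination h + (b ^ 2 + 2 * b + 1) * h2
        have := hQ.pairSlope_cubic hodd h'
        rw [show b + 1 + 1 = b by linear_combination h2, add_comm] at this
        exact hs this
      rw [hQ.sum_prodSgn_eq_zero hodd _ _ hs, if_neg n1, if_neg n2]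
      simp
  have hsum : ∀ p : F → Prop, [DecidablePred p] → (¬p 0) → (¬p 1) →
      ∑ b ∈ ({0, 1} : Finset F)ᶜ, (if p b then (1 : ℤ) else 0) =
        (Finset.univ.filter p).card := by
    intro p _ h0 h1
    rw [Finset.natCast_card_filter]
    refine Finset.sum_subset (Finset.subset_univ _) ?_
    intro b _ hb
    simp only [Finset.mem_compl, not_not, Finset.mem_insert, Finset.mem_singleton] at hb
    rcases hb with rfl | rfl
    · exact if_neg h0
    · exact if_neg h1
  rw [Finset.sum_congr rfl h, ← Finset.mul_sum, Finset.sum_add_distrib, Finset.sum_neg_distrib,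
    ← Finset.mul_sum, hsum, hsum, hQ.card_cubic_eq, hQ.card_cubic]
  · split_ifs <;> ring
  · simp
  · intro h
    exact one_ne_zero (α := F) (by linear_combination h - h2)
  · simp
  · intro h
    exact one_ne_zero (α := F) (by linear_combination h - h2)

end Parity

end IsTraceForm

end GaloisZ4

/-! ### Interpolation from moments, and the words with b equal to 0 or 1. -/

namespace GaloisZ4

lemma sgn_eq_or : ∀ a : ZMod 4, sgn a = 1 ∨ sgn a = -1 := by decide

lemma sum_sgn_sub : ∀ κ : ZMod 4, ∑ s, sgn (κ - s) = 0 := by decide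

lemma sum_sgn_sub_mul : ∀ κ t : ZMod 4,
    ∑ s, sgn (κ - s) * sgn (κ - s - t) = 4 * (iPow t).re := by decide

lemma half_sum_of_signs {a b c d x q : ℤ} (ha : a = 1 ∨ a = -1) (hb : b = 1 ∨ b = -1)
    (hc : c = 1 ∨ c = -1) (hd : d = 1 ∨ d = -1) (h : 2 * x = q * (a + b + c + d)) :
    (x = 0 ∧ a * c * (b * d) = 1) ∨ (x = q ∧ a * c * (b * d) = -1) ∨
      (x = -q ∧ a * c * (b * d) = -1) ∨ (x = 2 * q ∧ a * c * (b * d) = 1) ∨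
      (x = -(2 * q) ∧ a * c * (b * d) = 1) := by
  rcases ha with rfl | rfl <;> rcases hb with rfl | rfl <;> rcases hc with rfl | rfl <;>
    rcases hd with rfl | rfl <;> norm_num <;> omega

namespace IsTraceForm

variable {j : ℕ} {F : Type*} [Field F] [Fintype F] {Q : F → ZMod 4}

lemma fiberSum_re_cases (hQ : IsTraceForm (2 * j + 3) Q) (t : ZMod 4) {b : F} (hb0 : b ≠ 0)
    (hb1 : b ≠ 1) (c : F) :
    ((fiberSum Q t (b, c)).re = 0 ∧ prodSgn Q ((j + 1 : ℕ) : ZMod 4) t b c = 1) ∨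
    ((fiberSum Q t (b, c)).re = 2 ^ j ∧ prodSgn Q ((j + 1 : ℕ) : ZMod 4) t b c = -1) ∨
    ((fiberSum Q t (b, c)).re = -2 ^ j ∧ prodSgn Q ((j + 1 : ℕ) : ZMod 4) t b c = -1) ∨
    ((fiberSum Q t (b, c)).re = 2 * 2 ^ j ∧ prodSgn Q ((j + 1 : ℕ) : ZMod 4) t b c = 1) ∨
    ((fiberSum Q t (b, c)).re = -(2 * 2 ^ j) ∧ prodSgn Q ((j + 1 : ℕ) : ZMod 4) t b c = 1) := by
  have h := half_sum_of_signs (sgn_eq_or _) (sgn_eq_or _) (sgn_eq_or _) (sgn_eq_or _)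
    (hQ.two_mul_fiberSum_re t hb0 hb1 c)
  have e : prodSgn Q ((j + 1 : ℕ) : ZMod 4) t b c =
      sgn (((j + 1 : ℕ) : ZMod 4) - Q (c / b ^ 2)) *
        sgn (((j + 1 : ℕ) : ZMod 4) - Q ((c + 1) / b ^ 2) - 2 * t) *
        (sgn (((j + 1 : ℕ) : ZMod 4) - Q ((c + b) / (b + 1) ^ 2) - t) *
        sgn (((j + 1 : ℕ) : ZMod 4) - Q ((c + b + 1) / (b + 1) ^ 2) - 3 * t)) := by
    simp only [prodSgn, pairSgn]
    congr 3
    · ring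
    · ring
  rw [e]
  exact h

/-- A function of the real parts on the words outside `ℤ/4 + 2 R` is determined by the first
moments of the real parts and by the sum of `prodSgn`. -/
lemma sum_generic [DecidableEq F] (hQ : IsTraceForm (2 * j + 3) Q) (t : ZMod 4) (f : ℤ → ℂ)
    {q s0 s1 s2 s3 sp : ℂ} (hq : q = 2 ^ j)
    (h0 : ∑ _b ∈ ({0, 1} : Finset F)ᶜ, ∑ _c : F, (1 : ℂ) = s0)
    (h1 : ∑ b ∈ ({0, 1} : Finset F)ᶜ, ∑ c, ((fiberSum Q t (b, c)).re : ℂ) = s1)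
    (h2 : ∑ b ∈ ({0, 1} : Finset F)ᶜ, ∑ c, ((fiberSum Q t (b, c)).re : ℂ) ^ 2 = s2)
    (h3 : ∑ b ∈ ({0, 1} : Finset F)ᶜ, ∑ c, ((fiberSum Q t (b, c)).re : ℂ) ^ 3 = s3)
    (hp : ∑ b ∈ ({0, 1} : Finset F)ᶜ, ∑ c, (prodSgn Q ((j + 1 : ℕ) : ZMod 4) t b c : ℂ) = sp) :
    ∑ b ∈ ({0, 1} : Finset F)ᶜ, ∑ c, f (fiberSum Q t (b, c)).re =
      (5 / 8 * f 0 + (f (2 ^ j) + f (-2 ^ j)) / 4 -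
        (f (2 * 2 ^ j) + f (-(2 * 2 ^ j))) / 16) * s0 +
      (3 / 8 * f 0 - (f (2 ^ j) + f (-2 ^ j)) / 4 +
        (f (2 * 2 ^ j) + f (-(2 * 2 ^ j))) / 16) * sp +
      ((f (2 ^ j) - f (-2 ^ j)) * 2 / 3 - (f (2 * 2 ^ j) - f (-(2 * 2 ^ j))) / 12) / q * s1 +
      (-f 0 / 4 + (f (2 * 2 ^ j) + f (-(2 * 2 ^ j))) / 8) / q ^ 2 * s2 +
      (-(f (2 ^ j) - f (-2 ^ j)) / 6 + (f (2 * 2 ^ j) - f (-(2 * 2 ^ j))) / 12) / q ^ 3 * s3 := by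
  have hq0 : q ≠ 0 := hq ▸ pow_ne_zero j two_ne_zero
  rw [← h0, ← h1, ← h2, ← h3, ← hp]
  simp only [Finset.mul_sum, ← Finset.sum_add_distrib]
  -- The identity holds word by word: on the values 0, ±q, ±2q the functions 1, x, x², x³ and the
  -- product of signs form a basis, and the coefficients invert that 5×5 system.
  refine Finset.sum_congr rfl fun b hb => Finset.sum_congr rfl fun c _ => ?_
  simp only [Finset.mem_compl, Finset.mem_insert, Finset.mem_singleton, not_or] at hb
  have hqc : ((2 ^ j : ℤ) : ℂ) = q := by rw [hq]; push_cast; rfl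
  rcases hQ.fiberSum_re_cases t hb.1 hb.2 c with h | h | h | h | h <;> rw [h.1, h.2] <;>
    simp only [Int.cast_neg, Int.cast_mul, Int.cast_ofNat, hqc, Int.cast_zero, Int.cast_one] <;>
    field_simp <;> ring

/-- The formula for generic c is summed over all c by means of `card_fiber`; the last two terms
remove its values at c = 0 and c = 1, and the first two insert the true ones. -/
lemma sum_left_zero (hQ : IsTraceForm (2 * j + 3) Q) (t : ZMod 4) (f : ℤ → ℂ)
    {n e : ℤ} {q : ℂ} (hq : q = 2 ^ j) (he : e = sgn (((j + 1 : ℕ) : ZMod 4) - t))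
    (hn : n = (Finset.univ.filter fun a => Q a = t).card) :
    ∑ c, f (fiberSum Q t (0, c)).re = f n + f ((iPow (2 * t)).re * n) +
      (4 * q ^ 2 * (f (2 ^ j) + f (-2 ^ j)) +
        2 * q * (iPow t).re * (f (2 ^ j) - f (-2 ^ j))) -
      f (2 ^ j * e) - f ((iPow (2 * t)).re * (2 ^ j * e)) := by
  classical
  set κ := ((j + 1 : ℕ) : ZMod 4) with hκ
  have hall : ∑ c, f (2 ^ j * sgn (κ - Q c - t)) =
      4 * q ^ 2 * (f (2 ^ j) + f (-2 ^ j)) +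
        2 * q * (iPow t).re * (f (2 ^ j) - f (-2 ^ j)) := by
    rw [sum_comp_eq_sum_card Q fun s => f (2 ^ j * sgn (κ - s - t))]
    have hf : ∀ x, f (2 ^ j * sgn x) =
        (f (2 ^ j) + f (-2 ^ j)) / 2 + sgn x * ((f (2 ^ j) - f (-2 ^ j)) / 2) := by
      intro x
      rcases sgn_eq_or x with h | h <;> rw [h]
      · rw [mul_one]; push_cast; ring
      · rw [mul_neg_one]; push_cast; ring
    have hc : ∀ s, ((Finset.univ.filter fun x => Q x = s).card : ℂ) =
        2 * q ^ 2 + q * sgn (κ - s) := by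
      intro s
      have := congrArg (Int.cast : ℤ → ℂ) (hQ.card_fiber s)
      rw [Int.cast_natCast] at this
      rw [this, hq, ← hκ]
      push_cast
      ring
    have e1 : ∑ s, (sgn (κ - s) : ℂ) = 0 := by exact_mod_cast sum_sgn_sub κ
    have e2 : ∑ s, (sgn (κ - s - t) : ℂ) = 0 := by
      simp only [sub_right_comm κ _ t]
      exact_mod_cast sum_sgn_sub (κ - t)
    have e3 : ∑ s, (sgn (κ - s) : ℂ) * sgn (κ - s - t) = 4 * (iPow t).re := by
      exact_mod_cast sum_sgn_sub_mul κ t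
    simp only [hf, hc]
    have h : ∀ s, (2 * q ^ 2 + q * (sgn (κ - s) : ℂ)) *
        ((f (2 ^ j) + f (-2 ^ j)) / 2 + sgn (κ - s - t) * ((f (2 ^ j) - f (-2 ^ j)) / 2)) =
        q ^ 2 * (f (2 ^ j) + f (-2 ^ j)) +
        q * ((f (2 ^ j) + f (-2 ^ j)) / 2) * (sgn (κ - s) : ℂ) +
        q ^ 2 * (f (2 ^ j) - f (-2 ^ j)) * sgn (κ - s - t) +
        q * ((f (2 ^ j) - f (-2 ^ j)) / 2) * (sgn (κ - s) * sgn (κ - s - t)) := fun s => by ring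
    simp only [h, Finset.sum_add_distrib, ← Finset.mul_sum, e1, e2, e3, Finset.sum_const,
      Finset.card_univ, ZMod.card]
    rw [nsmul_eq_mul]
    push_cast
    ring
  have hsplit : ∀ g : F → ℂ, ∑ c, g c = g 0 + g 1 + ∑ c ∈ ({0, 1} : Finset F)ᶜ, g c := by
    intro g
    rw [← Finset.sum_add_sum_compl {0, 1} g, Finset.sum_pair zero_ne_one]
  rw [hsplit] at hall
  have hgen : ∀ c ∈ ({0, 1} : Finset F)ᶜ,
      f (fiberSum Q t (0, c)).re = f (2 ^ j * sgn (κ - Q c - t)) := by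
    intro c hc
    simp only [Finset.mem_compl, Finset.mem_insert, Finset.mem_singleton, not_or] at hc
    rw [hQ.fiberSum_zero_left t hc.1 hc.2, Zsqrtd.re_intCast]
  rw [hsplit, Finset.sum_congr rfl hgen, ← sub_eq_iff_eq_add'.2 hall.symm]
  have hs : ∀ κ t : ZMod 4, sgn (κ - (2 * κ + 1) - t) = (iPow (2 * t)).re * sgn (κ - t) := by
    decide
  have h0 : (fiberSum Q t (0, 0)).re = n := by
    rw [hQ.fiberSum_zero, hn]
    simp
  have h1 : (fiberSum Q t (0, 1)).re = (iPow (2 * t)).re * n := by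
    rw [hQ.fiberSum_zero_one, hn, mul_comm,
      ← Int.cast_natCast (Finset.univ.filter fun a => Q a = t).card, re_intCast_mul, mul_comm]
  rw [h0, h1, hQ.zero, hQ.one, sub_zero, ← he,
    show (((2 * j + 3 : ℕ) : ZMod 4)) = 2 * κ + 1 by rw [hκ]; push_cast; ring, hs, ← he,
    mul_left_comm]
  ring

/-- All fibre sums with b = 0 are real, so the factor i^t acts on real parts through Re i^t. -/
lemma sum_left_one (hQ : IsTraceForm (2 * j + 3) Q) (t : ZMod 4) (f : ℤ → ℂ) :
    ∑ c, f (fiberSum Q t (1, c)).re = ∑ c, f ((iPow t).re * (fiberSum Q t (0, c)).re) := by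
  refine Finset.sum_congr rfl fun c _ => ?_
  rw [hQ.fiberSum_one_left]
  by_cases h0 : c = 0
  · subst h0
    rw [hQ.fiberSum_zero, mul_comm, ← Int.cast_natCast (Finset.univ.filter _).card,
      re_intCast_mul, Zsqrtd.re_intCast, mul_comm]
  by_cases h1 : c = 1
  · subst h1
    have h : ∀ t, (iPow t * iPow (2 * t)).re = (iPow t).re * (iPow (2 * t)).re := by decide
    rw [hQ.fiberSum_zero_one, ← mul_assoc, mul_comm,
      ← Int.cast_natCast (Finset.univ.filter _).card, re_intCast_mul, mul_comm (iPow (2 * t)),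
      re_intCast_mul, h]
    congr 1
    ring
  · rw [hQ.fiberSum_zero_left t h0 h1, mul_comm, re_intCast_mul, Zsqrtd.re_intCast, mul_comm]

lemma sum_eq_add [DecidableEq F] (g : F × F → ℂ) :
    ∑ u, g u = ∑ c, g (0, c) + ∑ c, g (1, c) + ∑ b ∈ ({0, 1} : Finset F)ᶜ, ∑ c, g (b, c) := by
  rw [Fintype.sum_prod_type, ← Finset.sum_add_sum_compl {0, 1}, Finset.sum_pair zero_ne_one]

end IsTraceForm

end GaloisZ4

/-! ### The complete distribution of the real parts for each t. -/

namespace GaloisZ4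

/-- The sum of the values of `f` at the real parts of the character sums of the words in `2 R`,
in terms of the length `n` and the sign `e`. -/
noncomputable def leftSum (j : ℕ) (t : ZMod 4) (n e : ℤ) (f : ℤ → ℂ) : ℂ :=
  f n + f ((iPow (2 * t)).re * n) + (4 * (2 ^ j) ^ 2 * (f (2 ^ j) + f (-2 ^ j)) +
    2 * 2 ^ j * (iPow t).re * (f (2 ^ j) - f (-2 ^ j))) -
    f (2 ^ j * e) - f ((iPow (2 * t)).re * (2 ^ j * e))

namespace IsTraceForm

variable {j : ℕ} {F : Type*} [Field F] [Fintype F] {Q : F → ZMod 4}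

/-- The moments over the words with b ∉ {0, 1}, needed by `sum_generic`, are the moments over all
words minus the explicit contributions of b = 0 and b = 1. -/
lemma sum_apply_fiberSum (hQ : IsTraceForm (2 * j + 3) Q) (t : ZMod 4) (f : ℤ → ℂ)
    {n e : ℤ} {q s0 s1 s2 s3 sp : ℂ} (hq : q = 2 ^ j)
    (he : e = sgn (((j + 1 : ℕ) : ZMod 4) - t))
    (hn : n = (Finset.univ.filter fun a => Q a = t).card)
    (h0 : s0 = (8 * q ^ 2 - 2) * (8 * q ^ 2))
    (h1 : s1 = (if t = 0 then 64 * q ^ 4 else 0) - leftSum j t n e (fun x => x) -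
      leftSum j t n e (fun x => ((iPow t).re * x : ℤ)))
    (h2 : s2 = 32 * q ^ 4 * (n + if t = 0 then 1 else 0) - leftSum j t n e (fun x => x ^ 2) -
      leftSum j t n e (fun x => ((iPow t).re * x : ℤ) ^ 2))
    (h3 : s3 = (if t = 0 then 32 * q ^ 4 * (3 * n - 1) else 0) -
      leftSum j t n e (fun x => x ^ 3) - leftSum j t n e (fun x => ((iPow t).re * x : ℤ) ^ 3))
    (hp : sp = if 2 * t = 0 then 16 * q ^ 2 * sigmaInt (2 * j + 3) else 0) :
    ∑ u, f (fiberSum Q t u).re =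
      leftSum j t n e f + leftSum j t n e (fun x => f ((iPow t).re * x)) +
      ((5 / 8 * f 0 + (f (2 ^ j) + f (-2 ^ j)) / 4 -
        (f (2 * 2 ^ j) + f (-(2 * 2 ^ j))) / 16) * s0 +
      (3 / 8 * f 0 - (f (2 ^ j) + f (-2 ^ j)) / 4 +
        (f (2 * 2 ^ j) + f (-(2 * 2 ^ j))) / 16) * sp +
      ((f (2 ^ j) - f (-2 ^ j)) * 2 / 3 - (f (2 * 2 ^ j) - f (-(2 * 2 ^ j))) / 12) / q * s1 +
      (-f 0 / 4 + (f (2 * 2 ^ j) + f (-(2 * 2 ^ j))) / 8) / q ^ 2 * s2 +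
      (-(f (2 ^ j) - f (-2 ^ j)) / 6 + (f (2 * 2 ^ j) - f (-(2 * 2 ^ j))) / 12) / q ^ 3 * s3) := by
  classical
  have hodd := odd_two_mul_add_three j
  have h4 : (4 : ℂ) ^ (2 * j + 3) = 64 * q ^ 4 := by
    rw [hq, ← pow_mul, show (64 : ℂ) = 2 ^ 6 by norm_num, ← pow_add,
      show (4 : ℂ) = 2 ^ 2 by norm_num, ← pow_mul]
    congr 1
    ring
  have hcard : (Fintype.card F : ℂ) = 8 * q ^ 2 := by
    rw [hQ.card, hq]
    push_cast
    ring
  have hL : ∀ g : ℤ → ℂ, ∑ c, g (fiberSum Q t (0, c)).re = leftSum j t n e g := fun g =>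
    hQ.sum_left_zero t g rfl he hn
  have hR : ∀ g : ℤ → ℂ, ∑ c, g (fiberSum Q t (1, c)).re =
      leftSum j t n e (fun x => g ((iPow t).re * x)) := fun g => by
    rw [hQ.sum_left_one]
    exact hL fun x => g ((iPow t).re * x)
  rw [sum_eq_add, hL f, hR f]
  congr 1
  have hgen : ∀ g : ℤ → ℂ, ∑ b ∈ ({0, 1} : Finset F)ᶜ, ∑ c, g (fiberSum Q t (b, c)).re =
      ∑ u, g (fiberSum Q t u).re - leftSum j t n e g -
        leftSum j t n e (fun x => g ((iPow t).re * x)) := by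
    intro g
    rw [sum_eq_add (fun u => g (fiberSum Q t u).re), hL g, hR g]
    ring
  refine hQ.sum_generic t f hq ?_ ?_ ?_ ?_ ?_
  · rw [h0, Finset.sum_const, Finset.sum_const, Finset.card_compl, Finset.card_univ,
      Finset.card_pair zero_ne_one, nsmul_eq_mul, nsmul_eq_mul, Nat.cast_sub, hcard]
    · push_cast
      ring
    · exact Fintype.one_lt_card
  · rw [hgen (fun x => x), h1]
    congr 2
    have := congrArg (Int.cast : ℤ → ℂ) (hQ.sum_fiberSum_re hodd t)
    push_cast at this
    rw [this, h4]
  · rw [hgen (fun x => x ^ 2), h2]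
    congr 2
    have := congrArg (Int.cast : ℤ → ℂ) (hQ.two_mul_sum_fiberSum_re_sq hodd t)
    rw [← hn] at this
    push_cast at this
    rw [h4] at this
    linear_combination this / 2
  · rw [hgen (fun x => x ^ 3), h3]
    congr 2
    have := congrArg (Int.cast : ℤ → ℂ) (hQ.four_mul_sum_fiberSum_re_cube hodd t)
    rw [← hn] at this
    push_cast at this
    rw [h4] at this
    split_ifs at this ⊢ <;> linear_combination this / 4
  · have := congrArg (Int.cast : ℤ → ℂ) (hQ.sum_sum_prodSgn t)
    rw [hp]
    push_cast at this ⊢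
    rw [this]
    split_ifs
    · rw [hq]
      ring
    · rfl

/-- The factor 4 reflects that u = 0, 1, 2, 3 all give the zero word on D_0. -/
lemma sum_apply_fiberSum_zero (hQ : IsTraceForm (2 * j + 3) Q) (f : ℤ → ℂ)
    {n τ : ℤ} {q σ : ℂ} (hq : q = 2 ^ j)
    (hτ : τ = sgn ((j + 1 : ℕ) : ZMod 4)) (hσ : σ = sigmaInt (2 * j + 3))
    (hn : n = (Finset.univ.filter fun a => Q a = 0).card) :
    ∑ u, f (fiberSum Q 0 u).re = 4 * (f n + (2 * q ^ 2 + q * τ - 1) * f (2 ^ j * τ) +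
      (2 * q ^ 2 - q * τ) * f (-(2 ^ j * τ)) +
      (q ^ 2 / 2 * (12 * q ^ 2 - 5 + 3 * σ) - q * (2 * q ^ 2 - 1) * τ) * f 0 +
      q ^ 2 * (4 * q ^ 2 - 4 * q - 1 - σ + 2 * τ) * f (-2 ^ j) +
      q ^ 2 * (4 * q ^ 2 + 4 * q - 1 - σ - 2 * τ) * f (2 ^ j) +
      (q ^ 2 / 4 * (4 * q ^ 2 + 1 + σ - 4 * τ) + q / 2 * (2 * q ^ 2 - 1) * (τ - 2)) *
        f (-(2 * 2 ^ j)) +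
      (q ^ 2 / 4 * (4 * q ^ 2 + 1 + σ + 4 * τ) + q / 2 * (2 * q ^ 2 - 1) * (τ + 2)) *
        f (2 * 2 ^ j)) := by
  have hq0 : q ≠ 0 := hq ▸ pow_ne_zero j two_ne_zero
  have hqc : ((2 ^ j : ℤ) : ℂ) = q := by rw [hq]; push_cast; rfl
  have hnc : (n : ℂ) = 2 * q ^ 2 + q * τ := by
    rw [hn, hQ.card_fiber 0, sub_zero, ← hτ]
    push_cast
    rw [hq]
    ring
  rw [hQ.sum_apply_fiberSum 0 f (e := τ) hq (by rw [sub_zero]; exact hτ) hn rfl rfl rfl rfl rfl]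
  -- Splitting into τ = ±1 both reduces τ² to 1 and matches f(2^j τ) with f(±2^j).
  simp only [leftSum, mul_zero, show (iPow 0).re = 1 by decide, one_mul, if_true,
    Int.cast_mul, Int.cast_neg, hqc, ← hq, hnc, ← hσ, Int.cast_one]
  rcases (hτ ▸ sgn_eq_or _ : τ = 1 ∨ τ = -1) with h | h <;> subst h <;>
    simp only [mul_one, mul_neg_one, Int.cast_one, Int.cast_neg, neg_neg] <;> field_simp <;> ring

lemma sum_apply_fiberSum_two (hQ : IsTraceForm (2 * j + 3) Q) (f : ℤ → ℂ)
    {n τ : ℤ} {q σ : ℂ} (hq : q = 2 ^ j)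
    (hτ : τ = sgn ((j + 1 : ℕ) : ZMod 4)) (hσ : σ = sigmaInt (2 * j + 3))
    (hn : n = (Finset.univ.filter fun a => Q a = 2).card) :
    ∑ u, f (fiberSum Q 2 u).re = 2 * (f n + (4 * q ^ 2 - 1) * f (-(2 ^ j * τ)) + f (-n) +
      (4 * q ^ 2 - 1) * f (2 ^ j * τ) +
      (q ^ 2 * (12 * q ^ 2 - 1 + 3 * σ) + 2 * q * (2 * q ^ 2 - 1) * τ) * f 0 +
      2 * q ^ 2 * (4 * q ^ 2 - 1 - σ) * (f (2 ^ j) + f (-2 ^ j)) +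
      (q ^ 2 / 2 * (4 * q ^ 2 - 3 + σ) - q / 4 * (8 * q ^ 2 - 4) * τ) *
        (f (2 * 2 ^ j) + f (-(2 * 2 ^ j)))) := by
  have hq0 : q ≠ 0 := hq ▸ pow_ne_zero j two_ne_zero
  have hqc : ((2 ^ j : ℤ) : ℂ) = q := by rw [hq]; push_cast; rfl
  have he : ∀ κ : ZMod 4, sgn (κ - 2) = -sgn κ := by decide
  have hnc : (n : ℂ) = 2 * q ^ 2 - q * τ := by
    rw [hn, hQ.card_fiber 2, he, ← hτ]
    push_cast
    rw [hq]
    ring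
  rw [hQ.sum_apply_fiberSum 2 f (e := -τ) hq (by rw [he, hτ]) hn rfl rfl rfl rfl rfl]
  simp only [leftSum, show (iPow 2).re = -1 by decide, show (2 : ZMod 4) * 2 = 0 by decide,
    show (iPow 0).re = 1 by decide, one_mul, if_true, neg_one_mul,
    if_neg (show (2 : ZMod 4) ≠ 0 by decide),
    Int.cast_mul, Int.cast_neg, hqc, ← hq, hnc, ← hσ, Int.cast_one]
  rcases (hτ ▸ sgn_eq_or _ : τ = 1 ∨ τ = -1) with h | h <;> subst h <;>
    simp only [mul_one, mul_neg_one, Int.cast_one, Int.cast_neg, neg_neg] <;> field_simp <;> ring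

lemma sum_apply_fiberSum_odd (hQ : IsTraceForm (2 * j + 3) Q) {t : ZMod 4} (ht : 2 * t = 2)
    (f : ℤ → ℂ) {n e : ℤ} {q : ℂ} (hq : q = 2 ^ j)
    (he : e = sgn (((j + 1 : ℕ) : ZMod 4) - t))
    (hn : n = (Finset.univ.filter fun a => Q a = t).card) :
    ∑ u, f (fiberSum Q t u).re = f n + f (-n) + (4 * q ^ 2 - 1) * f (2 ^ j * e) +
      (4 * q ^ 2 - 1) * f (-(2 ^ j * e)) +
      ((8 * q ^ 2 - 2) * (3 * q ^ 2 - q * e) + 8 * q ^ 2) * f 0 +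
      2 * q ^ 2 * (8 * q ^ 2 - 2) * (f (2 ^ j) + f (-2 ^ j)) +
      (8 * q ^ 2 - 2) * (q ^ 2 / 2 + q / 2 * e) * (f (2 * 2 ^ j) + f (-(2 * 2 ^ j))) := by
  have hq0 : q ≠ 0 := hq ▸ pow_ne_zero j two_ne_zero
  have hqc : ((2 ^ j : ℤ) : ℂ) = q := by rw [hq]; push_cast; rfl
  have hnc : (n : ℂ) = 2 * q ^ 2 + q * e := by
    rw [hn, hQ.card_fiber t, ← he]
    push_cast
    rw [hq]
    ring
  -- For odd t the number i^t is purely imaginary, so the words with b = 1 all have real part 0;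
  -- they account for the summand 8q² in the coefficient of f(0).
  have hr : (iPow t).re = 0 := by
    revert ht
    clear * -
    revert t
    decide
  have ht0 : t ≠ 0 := by
    rintro rfl
    exact absurd ht (by decide)
  rw [hQ.sum_apply_fiberSum t f hq he hn rfl rfl rfl rfl rfl]
  simp only [leftSum, ht, show (iPow 2).re = -1 by decide, hr, zero_mul, neg_one_mul,
    if_neg (show (2 : ZMod 4) ≠ 0 by decide), if_neg ht0,
    Int.cast_mul, Int.cast_neg, hqc, ← hq, hnc, Int.cast_zero]
  rcases (he ▸ sgn_eq_or _ : e = 1 ∨ e = -1) with h | h <;> subst h <;>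
    simp only [mul_one, mul_neg_one, Int.cast_one, Int.cast_neg, neg_neg] <;> field_simp <;> ring

end IsTraceForm

end GaloisZ4

/-! ### From the Galois ring to a trace form on its residue field. -/

namespace GaloisZ4

/-- Frobenius permutes the summands. The shift provides the exponents 2^(j+1) required by
`teichLift_add_pow`. -/
lemma sum_teich_shift {m : ℕ} {R : Type*} [CommRing R] {x : R}
    (hx : x ∈ teichmuller m R) :
    ∑ j ∈ Finset.range m, x ^ 2 ^ (j + 1) = ∑ j ∈ Finset.range m, x ^ 2 ^ j := by
  have e1 := Finset.sum_range_succ (fun j => x ^ 2 ^ j) m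
  have e2 := Finset.sum_range_succ' (fun j => x ^ 2 ^ j) m
  have hx' : x ^ 2 ^ m = x := hx
  simp only [hx', pow_zero, pow_one] at e1 e2
  exact add_right_cancel (e2.symm.trans e1)

section Residue

variable {m : ℕ} {R : Type*} [CommRing R] [Algebra (ZMod 4) R] {F : Type*} [Field F] [Fintype F]

/-- The properties of the Galois ring, with its residue map `π`, that determine the trace
codes. -/
structure IsResidueMap (m : ℕ) (π : R →+* F) : Prop where
  pos : 0 < m
  card : Fintype.card F = 2 ^ m
  four : (4 : R) = 0
  surjective : Function.Surjective π
  exists_of_apply_eq_zero : ∀ w, π w = 0 → ∃ v, w = 2 * v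
  exists_of_two_mul : ∀ w : R, 2 * w = 0 → ∃ v, w = 2 * v
  injective : Function.Injective (algebraMap (ZMod 4) R)
  isTrace : ∀ z : R, IsTrace m z (trace m z)

/-- The Teichmüller lift. -/
noncomputable def teichLift (m : ℕ) (π : R →+* F) (a : F) : R := Function.invFun π a ^ 2 ^ m

namespace IsResidueMap

variable {π : R →+* F}

lemma exists_of_apply_eq (hπ : IsResidueMap m π) {x y : R} (h : π x = π y) :
    ∃ v, x = y + 2 * v := by
  obtain ⟨v, hv⟩ := hπ.exists_of_apply_eq_zero (x - y) (by rw [map_sub, h, sub_self])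
  exact ⟨v, by linear_combination hv⟩

lemma exists_pow_eq (hπ : IsResidueMap m π) (z : R) : ∃ w, z ^ 2 ^ m = z + 2 * w :=
  hπ.exists_of_apply_eq (by rw [map_pow, ← hπ.card, FiniteField.pow_card])

lemma charP (hπ : IsResidueMap m π) : CharP F 2 := by
  have h := congrArg π hπ.four
  rw [map_ofNat, map_zero] at h
  have h2 : (2 : F) = 0 := pow_eq_zero_iff two_ne_zero |>.1 (by rw [← h]; norm_num)
  exact CharTwo.of_one_ne_zero_of_two_eq_zero one_ne_zero h2

lemma apply_teichLift (hπ : IsResidueMap m π) (a : F) : π (teichLift m π a) = a := by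
  rw [teichLift, map_pow, Function.invFun_eq (hπ.surjective a), ← hπ.card, FiniteField.pow_card]

lemma teichLift_mem (hπ : IsResidueMap m π) (a : F) : teichLift m π a ∈ teichmuller m R :=
  pow_mem hπ.pos hπ.four hπ.exists_pow_eq _

lemma eq_of_apply_eq (hπ : IsResidueMap m π) {x y : R} (hx : x ∈ teichmuller m R)
    (hy : y ∈ teichmuller m R) (h : π x = π y) : x = y := by
  obtain ⟨v, hv⟩ := hπ.exists_of_apply_eq h
  rw [← hx, ← hy]
  exact pow_eq_of_two hπ.pos hπ.four hv

lemma teichLift_apply (hπ : IsResidueMap m π) {x : R} (hx : x ∈ teichmuller m R) :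
    teichLift m π (π x) = x :=
  hπ.eq_of_apply_eq (hπ.teichLift_mem _) hx (hπ.apply_teichLift _)

lemma teichLift_mul (hπ : IsResidueMap m π) (a b : F) :
    teichLift m π (a * b) = teichLift m π a * teichLift m π b := by
  refine hπ.eq_of_apply_eq (hπ.teichLift_mem _) ?_ ?_
  · change (_ * _) ^ 2 ^ m = _
    rw [mul_pow, hπ.teichLift_mem a, hπ.teichLift_mem b]
  · rw [map_mul, hπ.apply_teichLift, hπ.apply_teichLift, hπ.apply_teichLift]

lemma teichLift_one (hπ : IsResidueMap m π) : teichLift m π (1 : F) = 1 :=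
  hπ.eq_of_apply_eq (hπ.teichLift_mem _) (one_pow _) (by rw [hπ.apply_teichLift, map_one])

lemma algebraMap_trace (hπ : IsResidueMap m π) {x y : R} (hx : x ∈ teichmuller m R)
    (hy : y ∈ teichmuller m R) : algebraMap (ZMod 4) R (trace m (x + 2 * y)) =
      ∑ j ∈ Finset.range m, (x ^ 2 ^ j + 2 * y ^ 2 ^ j) := by
  obtain ⟨x', hx', y', hy', h, ht⟩ := hπ.isTrace (x + 2 * y)
  obtain ⟨rfl, rfl⟩ := rep_unique hπ.pos hπ.four hπ.exists_of_two_mul hx hy hx' hy' h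
  exact ht

lemma algebraMap_trace_teich (hπ : IsResidueMap m π) {x : R} (hx : x ∈ teichmuller m R) :
    algebraMap (ZMod 4) R (trace m x) = ∑ j ∈ Finset.range m, x ^ 2 ^ j := by
  have h := hπ.algebraMap_trace hx teich_zero
  simpa using h

/-- Modulo 2 the lift of a + b is the sum of the lifts, and squaring upgrades a congruence modulo 2
to an equality modulo 4. The cross term of the square is what makes the trace form quadratic. -/
lemma teichLift_add_pow (hπ : IsResidueMap m π) (a b : F) (j : ℕ) :
    teichLift m π (a + b) ^ 2 ^ (j + 1) = teichLift m π a ^ 2 ^ (j + 1) +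
      teichLift m π b ^ 2 ^ (j + 1) + 2 * teichLift m π (a * b) ^ 2 ^ j := by
  have := hπ.charP
  obtain ⟨v, hv⟩ := hπ.exists_of_apply_eq (x := teichLift m π (a + b) ^ 2 ^ j)
    (y := teichLift m π a ^ 2 ^ j + teichLift m π b ^ 2 ^ j) (by
      simp only [map_add, map_pow, hπ.apply_teichLift]
      exact add_pow_char_pow a b 2 j)
  rw [pow_succ, pow_mul, sq_eq_of_two hπ.four hv, hπ.teichLift_mul]
  ring

lemma isTraceForm (hπ : IsResidueMap m π) :
    IsTraceForm m fun a => trace m (teichLift m π a) where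
  card := hπ.card
  add a b := by
    apply hπ.injective
    rw [map_add, map_add, map_mul, map_ofNat, hπ.algebraMap_trace_teich (hπ.teichLift_mem _),
      hπ.algebraMap_trace_teich (hπ.teichLift_mem _),
      hπ.algebraMap_trace_teich (hπ.teichLift_mem _),
      hπ.algebraMap_trace_teich (hπ.teichLift_mem _), ← sum_teich_shift (hπ.teichLift_mem _),
      ← sum_teich_shift (hπ.teichLift_mem a), ← sum_teich_shift (hπ.teichLift_mem b)]
    simp only [hπ.teichLift_add_pow, Finset.sum_add_distrib, Finset.mul_sum]
  sq a := by
    apply hπ.injective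
    rw [hπ.algebraMap_trace_teich (hπ.teichLift_mem _),
      hπ.algebraMap_trace_teich (hπ.teichLift_mem _), ← sum_teich_shift (hπ.teichLift_mem a),
      pow_two, hπ.teichLift_mul]
    refine Finset.sum_congr rfl fun j _ => ?_
    rw [pow_succ', pow_mul, pow_two]
  one := by
    apply hπ.injective
    rw [hπ.algebraMap_trace_teich (hπ.teichLift_mem _), hπ.teichLift_one]
    simp

lemma trace_mul_teichLift (hπ : IsResidueMap m π) (u : F × F) (a : F) :
    trace m ((teichLift m π (u.1 ^ 2) + 2 * teichLift m π u.2) * teichLift m π a) =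
      word (fun a => trace m (teichLift m π a)) u a := by
  apply hπ.injective
  rw [show (teichLift m π (u.1 ^ 2) + 2 * teichLift m π u.2) * teichLift m π a =
      teichLift m π (u.1 ^ 2 * a) + 2 * teichLift m π (u.2 * a) by
    rw [hπ.teichLift_mul, hπ.teichLift_mul]; ring,
    hπ.algebraMap_trace (hπ.teichLift_mem _) (hπ.teichLift_mem _), word, map_add, map_mul,
    map_ofNat, hπ.algebraMap_trace_teich (hπ.teichLift_mem _),
    hπ.algebraMap_trace_teich (hπ.teichLift_mem _), Finset.sum_add_distrib, Finset.mul_sum]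

lemma exists_eq_teichLift (hπ : IsResidueMap m π) (z : R) :
    ∃ u : F × F, z = teichLift m π (u.1 ^ 2) + 2 * teichLift m π u.2 := by
  have := hπ.charP
  obtain ⟨x, hx, y, hy, rfl⟩ := exists_rep hπ.pos hπ.four hπ.exists_pow_eq z
  obtain ⟨b, hb⟩ := FiniteField.isSquare_of_char_two (ringChar.eq F 2) (π x)
  refine ⟨(b, π y), ?_⟩
  rw [pow_two, ← hb, hπ.teichLift_apply hx, hπ.teichLift_apply hy]

/-- The trace code of `D_t` is the code of the words of a trace form. -/
lemma exists_code_eq (hπ : IsResidueMap m π) {t : ZMod 4} {n : ℕ} {d : Fin n → R}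
    (hd : Enumerates d (traceFiber m R t)) :
    ∃ d' : Fin n → F, Function.Injective d' ∧
      (∀ a, a ∈ Set.range d' ↔ trace m (teichLift m π a) = t) ∧
      code m d = Set.range fun (u : F × F) (i : Fin n) =>
        word (fun a => trace m (teichLift m π a)) u (d' i) := by
  have hmem : ∀ i, d i ∈ teichmuller m R ∧ trace m (d i) = t := by
    intro i
    have : d i ∈ traceFiber m R t := hd.2 ▸ Set.mem_range_self i
    exact this
  refine ⟨fun i => π (d i), ?_, ?_, ?_⟩
  · intro i k hik
    exact hd.1 (hπ.eq_of_apply_eq (hmem i).1 (hmem k).1 hik)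
  · intro a
    constructor
    · rintro ⟨i, rfl⟩
      beta_reduce
      rw [hπ.teichLift_apply (hmem i).1, (hmem i).2]
    · intro ha
      have : teichLift m π a ∈ Set.range d := by
        rw [hd.2]
        exact ⟨hπ.teichLift_mem a, ha⟩
      obtain ⟨i, hi⟩ := this
      exact ⟨i, by beta_reduce; rw [hi, hπ.apply_teichLift]⟩
  · have hw : ∀ (u : F × F), (fun i : Fin n => trace m
        ((teichLift m π (u.1 ^ 2) + 2 * teichLift m π u.2) * d i)) =
        fun i => word (fun a => trace m (teichLift m π a)) u (π (d i)) := by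
      intro u
      funext i
      rw [← hπ.trace_mul_teichLift, hπ.teichLift_apply (hmem i).1]
    ext c
    constructor
    · rintro ⟨z, rfl⟩
      obtain ⟨u, rfl⟩ := hπ.exists_eq_teichLift z
      exact ⟨u, (hw u).symm⟩
    · rintro ⟨u, rfl⟩
      exact ⟨_, hw u⟩

end IsResidueMap

end Residue

/-- The Galois ring `GR(4, m)` has a residue field with `2 ^ m` elements. -/
theorem IsBasicIrreducible.exists_isResidueMap {m : ℕ} {h : (ZMod 4)[X]}
    (hb : IsBasicIrreducible h) (hd : h.natDegree = m) :
    ∃ (F : Type) (_ : Field F) (_ : Fintype F) (π : AdjoinRoot h →+* F), IsResidueMap m π := by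
  set ρ := ZMod.castHom (by norm_num : 2 ∣ 4) (ZMod 2) with hρ
  have hdeg : (h.map ρ).natDegree = m := by rw [hb.monic.natDegree_map, hd]
  have : Fact (Irreducible (h.map ρ)) := ⟨hb.irreducible_map⟩
  have hm : 0 < m := hdeg ▸ hb.irreducible_map.natDegree_pos
  have h4 : (4 : AdjoinRoot h) = 0 := by
    have : algebraMap (ZMod 4) (AdjoinRoot h) 4 = 0 := by
      rw [show (4 : ZMod 4) = 0 from rfl, map_zero]
    simpa only [map_ofNat] using this
  let π : AdjoinRoot h →+* AdjoinRoot (h.map ρ) := AdjoinRoot.map ρ h (h.map ρ) dvd_rfl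
  have hπ : ∀ p, π (AdjoinRoot.mk h p) = AdjoinRoot.mk (h.map ρ) (p.map ρ) := by
    intro p
    induction p using Polynomial.induction_on' with
    | add p q hp hq => simp only [map_add, Polynomial.map_add, hp, hq]
    | monomial n a =>
      rw [← C_mul_X_pow_eq_monomial]
      simp only [map_mul, map_pow, AdjoinRoot.mk_C, AdjoinRoot.mk_X, Polynomial.map_mul, map_C,
        Polynomial.map_pow, map_X, π, AdjoinRoot.map_of, AdjoinRoot.map_root]
  have hker : ∀ w, π w = 0 → ∃ v, w = 2 * v := by
    intro w hw
    obtain ⟨p, rfl⟩ := AdjoinRoot.mk_surjective w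
    rw [hπ, AdjoinRoot.mk_eq_zero] at hw
    obtain ⟨q, hq⟩ := hw
    obtain ⟨q', rfl⟩ := Polynomial.map_surjective ρ (ZMod.castHom_surjective _) q
    obtain ⟨r, hr⟩ := even_coeffs (p := p - h * q') (by
      rw [Polynomial.map_sub, Polynomial.map_mul, ← hρ, hq, sub_self])
    refine ⟨AdjoinRoot.mk h r, ?_⟩
    have := congrArg (AdjoinRoot.mk h) hr
    rwa [map_sub, map_mul, AdjoinRoot.mk_self, zero_mul, sub_zero, map_mul, map_ofNat] at this
  have : Nontrivial (ZMod 4) := ⟨0, 1, by decide⟩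
  have h2 : ∀ w : AdjoinRoot h, 2 * w = 0 → ∃ v, w = 2 * v := by
    intro w hw
    apply hker
    obtain ⟨p, rfl⟩ := AdjoinRoot.mk_surjective w
    rw [← AdjoinRoot.mk_leftInverse hb.monic (AdjoinRoot.mk h p), AdjoinRoot.modByMonicHom_mk,
      hπ]
    have h0 : 2 * (p %ₘ h) = 0 := by
      by_contra hne
      have hlt : (2 * (p %ₘ h)).degree < h.degree := by
        have : (2 * (p %ₘ h)).degree ≤ (p %ₘ h).degree := by
          rw [show (2 : (ZMod 4)[X]) = C 2 from rfl, ← smul_eq_C_mul]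
          exact degree_smul_le 2 _
        exact this.trans_lt (degree_modByMonic_lt _ hb.monic)
      refine AdjoinRoot.mk_ne_zero_of_degree_lt hb.monic hne hlt ?_
      rw [map_mul, map_ofNat, ← AdjoinRoot.modByMonicHom_mk hb.monic,
        AdjoinRoot.mk_leftInverse hb.monic, hw]
    have : (p %ₘ h).map ρ = 0 := by
      ext n
      have h := congrArg (fun q => q.coeff n) h0
      rw [show (2 : (ZMod 4)[X]) = C 2 from rfl] at h
      simp only [coeff_C_mul, coeff_zero] at h
      rw [coeff_map, coeff_zero]
      revert h
      generalize (p %ₘ h).coeff n = c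
      revert c
      decide
    rw [this, map_zero]
  have hcard : Nat.card (AdjoinRoot (h.map ρ)) = 2 ^ m := by
    have hmon := hb.monic.map ρ
    have := hmon.finite_adjoinRoot
    have := hmon.free_adjoinRoot
    rw [Module.natCard_eq_pow_finrank (K := ZMod 2),
      (AdjoinRoot.powerBasis' hmon).finrank, AdjoinRoot.powerBasis'_dim, hdeg, Nat.card_zmod]
  have : Finite (AdjoinRoot (h.map ρ)) := Nat.finite_of_card_ne_zero (by rw [hcard]; positivity)
  let := Fintype.ofFinite (AdjoinRoot (h.map ρ))
  have hsurj : Function.Surjective π := by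
    intro y
    obtain ⟨q, rfl⟩ := AdjoinRoot.mk_surjective y
    obtain ⟨p, rfl⟩ := Polynomial.map_surjective ρ (ZMod.castHom_surjective _) q
    exact ⟨AdjoinRoot.mk h p, hπ p⟩
  have hinj : Function.Injective (algebraMap (ZMod 4) (AdjoinRoot h)) := by
    have := hb.monic.free_adjoinRoot
    have : Nontrivial (AdjoinRoot h) := π.domain_nontrivial
    exact FaithfulSMul.algebraMap_injective _ _
  exact ⟨AdjoinRoot (h.map ρ), inferInstance, inferInstance, π, hm,
    by rw [← Nat.card_eq_fintype_card, hcard], h4, hsurj, hker, h2, hinj, trace_spec hb hd⟩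

end GaloisZ4

/-! ### From the distribution of real parts to the parameters of the code. -/

namespace GaloisZ4

lemma iPow_re_eq (a : ZMod 4) : ((iPow a).re : ℝ) = (Complex.I ^ a.val).re := by
  rw [GaussianInt.intCast_re, iPow, map_pow, GaussianInt.toComplex_def']
  simp

lemma iPow_re_le : ∀ a : ZMod 4, (iPow a).re ≤ 1 := by decide

lemma eq_zero_of_iPow_re : ∀ a : ZMod 4, (iPow a).re = 1 → a = 0 := by decide

/-- The codeword with coordinates `u`. -/
def codeword {F : Type*} [Field F] (Q : F → ZMod 4) {n : ℕ} (d : Fin n → F) (u : F × F) :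
    Fin n → ZMod 4 :=
  fun i => word Q u (d i)

lemma sum_fiber_eq {F M : Type*} [Fintype F] {Q : F → ZMod 4} {t : ZMod 4} {n : ℕ}
    {d : Fin n → F} [AddCommMonoid M]
    (hinj : Function.Injective d)
    (hrange : ∀ a, a ∈ Set.range d ↔ Q a = t) (g : F → M) :
    ∑ a with Q a = t, g a = ∑ i, g (d i) := by
  classical
  have : (Finset.univ.filter fun a => Q a = t) = Finset.univ.map ⟨d, hinj⟩ := by
    ext a
    rw [Finset.mem_filter, ← hrange]
    simp
  rw [this, Finset.sum_map]
  rfl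

lemma card_fiber_eq {F : Type*} [Fintype F] {Q : F → ZMod 4} {t : ZMod 4} {n : ℕ} {d : Fin n → F}
    (hinj : Function.Injective d) (hrange : ∀ a, a ∈ Set.range d ↔ Q a = t) :
    (Finset.univ.filter fun a => Q a = t).card = n := by
  rw [Finset.card_eq_sum_ones, sum_fiber_eq hinj hrange]
  simp

namespace IsTraceForm

variable {m : ℕ} {F : Type*} [Field F] [Fintype F] {Q : F → ZMod 4} {t : ZMod 4} {n : ℕ}
  {d : Fin n → F}

lemma codeword_wordAdd (hQ : IsTraceForm m Q) (u v : F × F) :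
    codeword Q d (wordAdd u v) = codeword Q d u + codeword Q d v :=
  funext fun _ => hQ.word_wordAdd u v _

lemma exists_codeword_sub (hQ : IsTraceForm m Q) (u v : F × F) :
    ∃ w, wordAdd v w = u ∧ codeword Q d w = codeword Q d u - codeword Q d v := by
  have h : wordAdd v (u.1 - v.1, u.2 - v.2 - v.1 * (u.1 - v.1)) = u := by
    refine Prod.ext ?_ ?_
    · simp [wordAdd]
    · simp only [wordAdd]
      ring
  exact ⟨_, h, by conv_rhs => rw [← h, hQ.codeword_wordAdd, add_sub_cancel_left]⟩

/-- `wordAdd` is the addition of the ring in coordinates, so fibres of the codeword map are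
translates of its kernel. -/
lemma card_fiber_codeword [DecidableEq F] (hQ : IsTraceForm m Q) (u₀ : F × F) :
    (Finset.univ.filter fun u => codeword Q d u = codeword Q d u₀).card =
      (Finset.univ.filter fun u => codeword Q d u = 0).card := by
  symm
  refine Finset.card_bij (fun u _ => wordAdd u₀ u) ?_ ?_ ?_
  · intro u hu
    simp only [Finset.mem_filter, Finset.mem_univ, true_and] at hu ⊢
    rw [hQ.codeword_wordAdd, hu, add_zero]
  · intro u _ v _ h
    have h1 := congrArg Prod.fst h
    have h2 := congrArg Prod.snd h
    simp only [wordAdd, add_right_inj] at h1 h2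
    rw [h1, add_left_inj, add_right_inj] at h2
    exact Prod.ext h1 h2
  · intro u hu
    obtain ⟨w, hw, hc⟩ := hQ.exists_codeword_sub (d := d) u u₀
    refine ⟨w, ?_, hw⟩
    simp only [Finset.mem_filter, Finset.mem_univ, true_and] at hu ⊢
    rw [hc, hu, sub_self]

lemma card_mul_ncard [DecidableEq F] (hQ : IsTraceForm m Q) (p : (Fin n → ZMod 4) → Prop)
    [DecidablePred p] :
    (Finset.univ.filter fun u => codeword Q d u = 0).card *
      {c ∈ Set.range (codeword Q d) | p c}.ncard =
      (Finset.univ.filter fun u => p (codeword Q d u)).card := by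
  classical
  have himg : {c ∈ Set.range (codeword Q d) | p c} =
      (Finset.image (codeword Q d) (Finset.univ.filter fun u => p (codeword Q d u)) :
        Set (Fin n → ZMod 4)) := by
    ext c
    simp only [Set.mem_ofPred_eq, Set.mem_range, Finset.coe_image, Set.mem_image,
      Finset.mem_coe, Finset.mem_filter, Finset.mem_univ, true_and]
    constructor
    · rintro ⟨⟨u, rfl⟩, h⟩
      exact ⟨u, h, rfl⟩
    · rintro ⟨u, h, rfl⟩
      exact ⟨⟨u, rfl⟩, h⟩
  rw [himg, Set.ncard_coe_finset, mul_comm,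
    Finset.card_eq_sum_card_image (codeword Q d) (Finset.univ.filter fun u => p (codeword Q d u))]
  refine (Finset.sum_const_nat fun c hc => ?_).symm
  obtain ⟨u₀, hu₀, rfl⟩ := Finset.mem_image.1 hc
  rw [← hQ.card_fiber_codeword u₀, Finset.filter_filter]
  congr 1
  ext u
  simp only [Finset.mem_filter, Finset.mem_univ, true_and, and_iff_right_iff_imp]
  intro h
  rw [h]
  exact (Finset.mem_filter.1 hu₀).2

lemma leeWeight_codeword (hinj : Function.Injective d)
    (hrange : ∀ a, a ∈ Set.range d ↔ Q a = t) (u : F × F) :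
    leeWeight (codeword Q d u) = n - ((fiberSum Q t u).re : ℝ) := by
  rw [leeWeight, fiberSum, sum_fiber_eq hinj hrange, re_sum, Complex.re_sum]
  push_cast
  simp only [iPow_re_eq]
  rfl

/-- The real part is a sum of n terms at most 1, each equal to 1 only at a zero coordinate. -/
lemma codeword_eq_zero_iff (hinj : Function.Injective d)
    (hrange : ∀ a, a ∈ Set.range d ↔ Q a = t) (u : F × F) :
    codeword Q d u = 0 ↔ (fiberSum Q t u).re = n := by
  rw [fiberSum, sum_fiber_eq hinj hrange, re_sum]
  constructor
  · intro h
    have h1 : ∀ i, word Q u (d i) = 0 := fun i => congrFun h i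
    simp [h1, iPow_zero]
  · intro h
    have h1 : ∑ i, (iPow (word Q u (d i))).re = ∑ _i : Fin n, 1 := by simp [h]
    rw [Finset.sum_eq_sum_iff_of_le fun i _ => iPow_re_le _] at h1
    exact funext fun i => eq_zero_of_iPow_re _ (h1 i (Finset.mem_univ i))

section Table

variable {κ q : ℕ} {L : List (ℤ × ℂ)}

lemma sum_map_eq_zero {ι : Type*} (L : List ι) (f : ι → ℂ) (h : ∀ x ∈ L, f x = 0) :
    (L.map f).sum = 0 := by
  refine List.sum_eq_zero fun x hx => ?_
  obtain ⟨r, hr, rfl⟩ := List.mem_map.1 hx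
  exact h r hr

/-- Testing `hL` on the indicator of n isolates the kernel, because every row of `L` lies at or
below 2q < n. -/
lemma card_codeword_eq_zero [DecidableEq F] (hinj : Function.Injective d)
    (hrange : ∀ a, a ∈ Set.range d ↔ Q a = t)
    (hL : ∀ f : ℤ → ℂ, ∑ u, f (fiberSum Q t u).re =
      κ * (f n + (L.map fun r => r.2 * f r.1).sum))
    (hle : ∀ r ∈ L, r.1 ≤ 2 * q) (hq : 2 * q < n) :
    (Finset.univ.filter fun u => codeword Q d u = 0).card = κ := by
  have h := hL fun x => if x = n then 1 else 0
  rw [sum_map_eq_zero, if_pos rfl, add_zero, mul_one, ← Finset.natCast_card_filter] at h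
  · simp only [codeword_eq_zero_iff hinj hrange]
    exact_mod_cast h
  · intro r hr
    have := hle r hr
    rw [if_neg (by omega), mul_zero]

lemma ncard_code [DecidableEq F] (hQ : IsTraceForm m Q) (hinj : Function.Injective d)
    (hrange : ∀ a, a ∈ Set.range d ↔ Q a = t)
    (hL : ∀ f : ℤ → ℂ, ∑ u, f (fiberSum Q t u).re =
      κ * (f n + (L.map fun r => r.2 * f r.1).sum))
    (hle : ∀ r ∈ L, r.1 ≤ 2 * q) (hq : 2 * q < n) :
    κ * (Set.range (codeword Q d)).ncard = 4 ^ m := by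
  have h := hQ.card_mul_ncard (d := d) fun _ => True
  rw [card_codeword_eq_zero hinj hrange hL hle hq] at h
  simp only [and_true, Set.ofPred_mem_eq, Finset.filter_true, Finset.card_univ, Fintype.card_prod,
    hQ.card, ← mul_pow] at h
  exact h

lemma hasLeeDistribution [DecidableEq F] (hQ : IsTraceForm m Q) (hinj : Function.Injective d)
    (hrange : ∀ a, a ∈ Set.range d ↔ Q a = t) (hκ : κ ≠ 0)
    (hL : ∀ f : ℤ → ℂ, ∑ u, f (fiberSum Q t u).re =
      κ * (f n + (L.map fun r => r.2 * f r.1).sum))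
    (hle : ∀ r ∈ L, r.1 ≤ 2 * q) (hq : 2 * q < n) :
    HasLeeDistribution (Set.range (codeword Q d))
      ((0, 1) :: L.map fun r => ((n : ℂ) - r.1, r.2)) := by
  classical
  intro w
  have h := hQ.card_mul_ncard (d := d) fun c => (leeWeight c : ℂ) = w
  rw [card_codeword_eq_zero hinj hrange hL hle hq] at h
  have h2 := hL fun x => if (n : ℂ) - x = w then 1 else 0
  have hlee : ∀ u, (leeWeight (codeword Q d u) : ℂ) = n - ((fiberSum Q t u).re : ℂ) := by
    intro u
    rw [leeWeight_codeword hinj hrange]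
    push_cast
    rfl
  simp only [hlee] at h
  rw [← Finset.natCast_card_filter, ← h, Nat.cast_mul] at h2
  have h3 := mul_left_cancel₀ (Nat.cast_ne_zero.2 hκ) h2
  convert h3 using 1
  rw [List.map_cons, List.sum_cons, List.map_map]
  simp [Function.comp_def]

lemma hasMinLeeDist [DecidableEq F] (hQ : IsTraceForm m Q) (hinj : Function.Injective d)
    (hrange : ∀ a, a ∈ Set.range d ↔ Q a = t) (hκ : κ ≠ 0)
    (hL : ∀ f : ℤ → ℂ, ∑ u, f (fiberSum Q t u).re =
      κ * (f n + (L.map fun r => r.2 * f r.1).sum))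
    (hle : ∀ r ∈ L, r.1 ≤ 2 * q) (hq : 2 * q < n)
    (hex : (L.map fun r => r.2 * if r.1 = (2 * q : ℤ) then 1 else 0).sum ≠ 0) :
    HasMinLeeDist (Set.range (codeword Q d)) (n - 2 * q) := by
  -- By linearity distances are weights of nonzero codewords. No real part lies strictly between 2q
  -- and n, and `hex` says that 2q occurs.
  have hall : ∀ u, (fiberSum Q t u).re ≤ 2 * q ∨ (fiberSum Q t u).re = n := by
    have h := hL fun x => if ¬(x ≤ 2 * q ∨ x = n) then 1 else 0
    rw [sum_map_eq_zero, if_neg (by simp), add_zero, mul_zero, ← Finset.natCast_card_filter,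
      Nat.cast_eq_zero, Finset.card_eq_zero, Finset.filter_eq_empty_iff] at h
    · intro u
      exact not_not.1 (h (Finset.mem_univ u))
    · intro r hr
      rw [if_neg (by simp [hle r hr]), mul_zero]
  have hmin : ∃ u, (fiberSum Q t u).re = 2 * q := by
    by_contra! hne
    have h := hL fun x => if x = 2 * q then 1 else 0
    simp only [if_neg (hne _), Finset.sum_const_zero] at h
    rw [if_neg (by omega), zero_add] at h
    exact mul_ne_zero (Nat.cast_ne_zero.2 hκ) hex h.symm
  refine ⟨(n : ℝ) - 2 * q, by push_cast; rfl, ?_, ?_⟩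
  · obtain ⟨u, hu⟩ := hmin
    have hzero : codeword Q d (0, 0) = 0 := by
      funext i
      simp [codeword, word, hQ.zero]
    refine ⟨_, ⟨u, rfl⟩, _, ⟨(0, 0), rfl⟩, ?_, ?_⟩
    · rw [hzero, ne_eq, codeword_eq_zero_iff hinj hrange, hu]
      omega
    · rw [hzero, sub_zero, leeWeight_codeword hinj hrange, hu]
      push_cast
      rfl
  · rintro r ⟨_, ⟨u, rfl⟩, _, ⟨v, rfl⟩, hne, rfl⟩
    obtain ⟨w, _, hw⟩ := hQ.exists_codeword_sub (d := d) u v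
    rw [← hw, leeWeight_codeword hinj hrange]
    have h1 : codeword Q d w ≠ 0 := by
      rw [hw]
      exact sub_ne_zero.2 hne
    rw [ne_eq, codeword_eq_zero_iff hinj hrange] at h1
    have h2 : (((fiberSum Q t w).re : ℤ) : ℝ) ≤ ((2 * q : ℤ) : ℝ) :=
      Int.cast_le.2 ((hall w).resolve_right h1)
    push_cast at h2
    linarith

end Table

end IsTraceForm

end GaloisZ4

/-! ### The tables in terms of q = 2^j, and their translation into powers of 2 and i. -/

namespace GaloisZ4

lemma toComplex_iPow (k : ℕ) : ((iPow (k : ZMod 4) : GaussianInt) : ℂ) = Complex.I ^ k := by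
  rw [iPow_natCast, map_pow, GaussianInt.toComplex_def']
  simp

/-- The cases m ≡ 1 and m ≡ 3 modulo 4 correspond to j+1 even and odd. -/
lemma tau_eq (j : ℕ) : tau (2 * j + 3) = (sgn ((j + 1 : ℕ) : ZMod 4) : ℂ) := by
  have h : ∀ a : ZMod 4, iPow (2 * a) = (sgn (2 * a) : GaussianInt) ∧
      iPow (2 * a + 1 + 1) = (sgn (2 * a + 1) : GaussianInt) := by decide
  rw [tau]
  rcases Nat.even_or_odd' (j + 1) with ⟨k, hk | hk⟩
  · rw [if_pos (by omega), show (2 * j + 3 - 1) / 2 = j + 1 by omega, ← toComplex_iPow, hk]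
    push_cast
    rw [(h k).1, map_intCast]
  · rw [if_neg (by omega), show (2 * j + 3 + 1) / 2 = j + 1 + 1 by omega, ← toComplex_iPow, hk]
    push_cast
    rw [(h k).2, map_intCast]

lemma sigma_eq (m : ℕ) : sigma m = (sigmaInt m : ℂ) := by
  rw [sigma, sigmaInt]
  split_ifs <;> simp

lemma I_pow_mul_sgn (j t : ℕ) (ht : t = 1 ∨ t = 3) :
    Complex.I ^ (2 * j + 3 + t) * (sgn ((j + 1 : ℕ) : ZMod 4) : ℂ) =
      -(sgn (((j + 1 : ℕ) : ZMod 4) - (t : ZMod 4)) : ℂ) := by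
  have h : ∀ κ : ZMod 4, iPow (2 * κ + 1 + 1) * (sgn κ : GaussianInt) =
      ((-sgn (κ - 1) : ℤ) : GaussianInt) ∧ iPow (2 * κ + 1 + 3) * (sgn κ : GaussianInt) =
      ((-sgn (κ - 3) : ℤ) : GaussianInt) := by decide
  rw [← toComplex_iPow, ← map_intCast GaussianInt.toComplex, ← map_mul,
    show ((2 * j + 3 + t : ℕ) : ZMod 4) = 2 * ((j + 1 : ℕ) : ZMod 4) + 1 + (t : ZMod 4) by
      push_cast; ring]
  rcases ht with rfl | rfl
  · rw [Nat.cast_one, (h _).1, map_intCast, Int.cast_neg]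
  · rw [Nat.cast_ofNat, (h _).2, map_intCast, Int.cast_neg]

namespace IsTraceForm

variable {j : ℕ} {F : Type*} [Field F] [Fintype F] {Q : F → ZMod 4} {n : ℕ} {d : Fin n → F}

lemma length_eq (hQ : IsTraceForm (2 * j + 3) Q) {t : ZMod 4} (hinj : Function.Injective d)
    (hrange : ∀ a, a ∈ Set.range d ↔ Q a = t) :
    (n : ℤ) = 2 * 2 ^ j * 2 ^ j + 2 ^ j * sgn (((j + 1 : ℕ) : ZMod 4) - t) := by
  rw [← hQ.card_fiber t, card_fiber_eq hinj hrange]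

/-- Substituting k + 2 for 2^j turns the frequencies to be shown positive into polynomials in k with
positive coefficients. -/
lemma two_le_two_pow (hj : j ≠ 0) : ∃ k : ℕ, (2 ^ j : ℤ) = k + 2 := by
  obtain ⟨i, rfl⟩ := Nat.exists_eq_succ_of_ne_zero hj
  have h1 : 1 ≤ 2 ^ i := Nat.one_le_two_pow
  refine ⟨2 * 2 ^ i - 2, ?_⟩
  rw [Nat.cast_sub (by omega), pow_succ]
  push_cast
  ring

/-- Here m > 3 is essential: 2·4^j - 2^j > 2·2^j needs 2^j ≥ 2. -/
lemma two_mul_lt_length (hQ : IsTraceForm (2 * j + 3) Q) (hj : j ≠ 0) {t : ZMod 4}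
    (hinj : Function.Injective d) (hrange : ∀ a, a ∈ Set.range d ↔ Q a = t) :
    2 * 2 ^ j < n := by
  have h := hQ.length_eq hinj hrange
  obtain ⟨k, hk⟩ := two_le_two_pow hj
  zify
  rcases sgn_eq_or (((j + 1 : ℕ) : ZMod 4) - t) with e | e <;> rw [e] at h <;> rw [h, hk] <;>
    nlinarith

lemma sigmaInt_eq_or (m : ℕ) : sigmaInt m = 0 ∨ sigmaInt m = -3 := by
  rw [sigmaInt]
  split_ifs <;> simp

theorem parameters_zero (hQ : IsTraceForm (2 * j + 3) Q) (hj : j ≠ 0)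
    (hinj : Function.Injective d) (hrange : ∀ a, a ∈ Set.range d ↔ Q a = 0) {q τ σ : ℂ}
    (hq : q = 2 ^ j) (hτ : τ = sgn ((j + 1 : ℕ) : ZMod 4)) (hσ : σ = sigmaInt (2 * j + 3)) :
    (n : ℂ) = 2 * q ^ 2 + q * τ ∧
    (Set.range (codeword Q d)).ncard = 4 ^ (2 * j + 2) ∧
    HasMinLeeDist (Set.range (codeword Q d)) (n - 2 * q) ∧
    HasLeeDistribution (Set.range (codeword Q d))
      [ (0, 1),
        (n - q * τ, 2 * q ^ 2 + q * τ - 1),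
        (n + q * τ, 2 * q ^ 2 - q * τ),
        (n, q ^ 2 / 2 * (12 * q ^ 2 - 5 + 3 * σ) - q * (2 * q ^ 2 - 1) * τ),
        (n + q, q ^ 2 * (4 * q ^ 2 - 4 * q - 1 - σ + 2 * τ)),
        (n - q, q ^ 2 * (4 * q ^ 2 + 4 * q - 1 - σ - 2 * τ)),
        (n + 2 * q, q ^ 2 / 4 * (4 * q ^ 2 + 1 + σ - 4 * τ) + q / 2 * (2 * q ^ 2 - 1) * (τ - 2)),
        (n - 2 * q,
          q ^ 2 / 4 * (4 * q ^ 2 + 1 + σ + 4 * τ) + q / 2 * (2 * q ^ 2 - 1) * (τ + 2)) ] := by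
  classical
  have hlen := hQ.length_eq hinj hrange
  rw [sub_zero] at hlen
  have hlt := hQ.two_mul_lt_length hj hinj hrange
  obtain ⟨k, hk⟩ := two_le_two_pow hj
  have hp : (0 : ℤ) < 2 ^ j := by positivity
  set e := sgn ((j + 1 : ℕ) : ZMod 4) with he
  have he' : e = 1 ∨ e = -1 := sgn_eq_or _
  let L : List (ℤ × ℂ) := [(2 ^ j * e, 2 * q ^ 2 + q * τ - 1), (-(2 ^ j * e), 2 * q ^ 2 - q * τ),
    (0, q ^ 2 / 2 * (12 * q ^ 2 - 5 + 3 * σ) - q * (2 * q ^ 2 - 1) * τ),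
    (-2 ^ j, q ^ 2 * (4 * q ^ 2 - 4 * q - 1 - σ + 2 * τ)),
    (2 ^ j, q ^ 2 * (4 * q ^ 2 + 4 * q - 1 - σ - 2 * τ)),
    (-(2 * 2 ^ j), q ^ 2 / 4 * (4 * q ^ 2 + 1 + σ - 4 * τ) + q / 2 * (2 * q ^ 2 - 1) * (τ - 2)),
    (2 * 2 ^ j, q ^ 2 / 4 * (4 * q ^ 2 + 1 + σ + 4 * τ) + q / 2 * (2 * q ^ 2 - 1) * (τ + 2))]
  have hL : ∀ f : ℤ → ℂ, ∑ u, f (fiberSum Q 0 u).re =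
      (4 : ℕ) * (f n + (L.map fun r => r.2 * f r.1).sum) := by
    intro f
    rw [hQ.sum_apply_fiberSum_zero f hq he hσ (n := n) (by rw [card_fiber_eq hinj hrange])]
    simp only [L, List.map_cons, List.map_nil, List.sum_cons, List.sum_nil, hτ]
    push_cast
    ring
  have hle : ∀ r ∈ L, r.1 ≤ 2 * (2 ^ j : ℕ) := by
    simp only [L, List.forall_mem_cons, List.not_mem_nil, false_imp_iff, implies_true, and_true]
    push_cast
    rcases he' with h | h <;> rw [h] <;> refine ⟨?_, ?_, ?_, ?_, ?_, ?_, ?_⟩ <;> linarith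
  refine ⟨?_, ?_, ?_, ?_⟩
  · have := congrArg (Int.cast : ℤ → ℂ) hlen
    push_cast at this
    rw [this, hq, hτ]
    ring
  · have h := hQ.ncard_code hinj hrange hL hle hlt
    rw [show 2 * j + 3 = 2 * j + 2 + 1 by ring, pow_succ] at h
    omega
  · have h := hQ.hasMinLeeDist hinj hrange (by norm_num) hL hle hlt ?_
    · convert h using 3
      rw [hq]
      push_cast
      rfl
    · have hp' : ((2 ^ j : ℕ) : ℤ) = 2 ^ j := by push_cast; rfl
      -- The rows ±2^j e repeat the values ±2^j but never reach 2·2^j, so one row alone gives the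
      -- frequency of the maximal real part.
      have n1 : (2 ^ j * e : ℤ) ≠ 2 * 2 ^ j := by rcases he' with h | h <;> rw [h] <;> omega
      have n2 : -(2 ^ j * e : ℤ) ≠ 2 * 2 ^ j := by rcases he' with h | h <;> rw [h] <;> omega
      simp only [L, List.map_cons, List.map_nil, List.sum_cons, List.sum_nil, hp']
      rw [if_neg n1, if_neg n2, if_neg (by omega), if_neg (by omega), if_neg (by omega),
        if_neg (by omega), if_true]
      have hpos : (0 : ℤ) < (2 ^ j) ^ 2 * (4 * (2 ^ j) ^ 2 + 1 + sigmaInt (2 * j + 3) + 4 * e) +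
          2 * 2 ^ j * (2 * (2 ^ j) ^ 2 - 1) * (e + 2) := by
        rw [hk]
        rcases he' with h | h <;> rcases sigmaInt_eq_or (2 * j + 3) with h' | h' <;>
          rw [h, h'] <;> ring_nf <;> positivity
      have hne : (((2 ^ j) ^ 2 * (4 * (2 ^ j) ^ 2 + 1 + sigmaInt (2 * j + 3) + 4 * e) +
          2 * 2 ^ j * (2 * (2 ^ j) ^ 2 - 1) * (e + 2) : ℤ) : ℂ) ≠ 0 := Int.cast_ne_zero.2 hpos.ne'
      intro h0
      apply hne
      push_cast
      rw [← hq, ← hσ, ← hτ]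
      linear_combination 4 * h0
  · have h := hQ.hasLeeDistribution hinj hrange (by norm_num) hL hle hlt
    convert h using 2
    simp only [L, List.map_cons, List.map_nil]
    push_cast
    rw [← hq, ← hτ]
    simp only [sub_neg_eq_add, sub_zero]

theorem parameters_two (hQ : IsTraceForm (2 * j + 3) Q) (hj : j ≠ 0)
    (hinj : Function.Injective d) (hrange : ∀ a, a ∈ Set.range d ↔ Q a = 2) {q τ σ : ℂ}
    (hq : q = 2 ^ j) (hτ : τ = sgn ((j + 1 : ℕ) : ZMod 4)) (hσ : σ = sigmaInt (2 * j + 3)) :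
    (n : ℂ) = 2 * q ^ 2 - q * τ ∧
    (Set.range (codeword Q d)).ncard = 2 ^ (4 * j + 5) ∧
    HasMinLeeDist (Set.range (codeword Q d)) (n - 2 * q) ∧
    HasLeeDistribution (Set.range (codeword Q d))
      [ (0, 1),
        (n + q * τ, 4 * q ^ 2 - 1),
        (n + n, 1),
        (n - q * τ, 4 * q ^ 2 - 1),
        (n, q ^ 2 * (12 * q ^ 2 - 1 + 3 * σ) + 2 * q * (2 * q ^ 2 - 1) * τ),
        (n - q, 2 * q ^ 2 * (4 * q ^ 2 - 1 - σ)),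
        (n + q, 2 * q ^ 2 * (4 * q ^ 2 - 1 - σ)),
        (n - 2 * q, q ^ 2 / 2 * (4 * q ^ 2 - 3 + σ) - q / 4 * (8 * q ^ 2 - 4) * τ),
        (n + 2 * q, q ^ 2 / 2 * (4 * q ^ 2 - 3 + σ) - q / 4 * (8 * q ^ 2 - 4) * τ) ] := by
  classical
  have hlen := hQ.length_eq hinj hrange
  have hsgn : ∀ κ : ZMod 4, sgn (κ - 2) = -sgn κ := by decide
  rw [hsgn] at hlen
  have hlt := hQ.two_mul_lt_length hj hinj hrange
  obtain ⟨k, hk⟩ := two_le_two_pow hj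
  have hp : (0 : ℤ) < 2 ^ j := by positivity
  set e := sgn ((j + 1 : ℕ) : ZMod 4) with he
  have he' : e = 1 ∨ e = -1 := sgn_eq_or _
  let L : List (ℤ × ℂ) := [(-(2 ^ j * e), 4 * q ^ 2 - 1), (-n, 1), (2 ^ j * e, 4 * q ^ 2 - 1),
    (0, q ^ 2 * (12 * q ^ 2 - 1 + 3 * σ) + 2 * q * (2 * q ^ 2 - 1) * τ),
    (2 ^ j, 2 * q ^ 2 * (4 * q ^ 2 - 1 - σ)), (-2 ^ j, 2 * q ^ 2 * (4 * q ^ 2 - 1 - σ)),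
    (2 * 2 ^ j, q ^ 2 / 2 * (4 * q ^ 2 - 3 + σ) - q / 4 * (8 * q ^ 2 - 4) * τ),
    (-(2 * 2 ^ j), q ^ 2 / 2 * (4 * q ^ 2 - 3 + σ) - q / 4 * (8 * q ^ 2 - 4) * τ)]
  have hL : ∀ f : ℤ → ℂ, ∑ u, f (fiberSum Q 2 u).re =
      (2 : ℕ) * (f n + (L.map fun r => r.2 * f r.1).sum) := by
    intro f
    rw [hQ.sum_apply_fiberSum_two f hq he hσ (n := n) (by rw [card_fiber_eq hinj hrange])]
    simp only [L, List.map_cons, List.map_nil, List.sum_cons, List.sum_nil, hτ]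
    push_cast
    ring
  have hle : ∀ r ∈ L, r.1 ≤ 2 * (2 ^ j : ℕ) := by
    simp only [L, List.forall_mem_cons, List.not_mem_nil, false_imp_iff, implies_true, and_true]
    push_cast
    rcases he' with h | h <;> rw [h] <;> refine ⟨?_, ?_, ?_, ?_, ?_, ?_, ?_, ?_⟩ <;> linarith
  refine ⟨?_, ?_, ?_, ?_⟩
  · have := congrArg (Int.cast : ℤ → ℂ) hlen
    push_cast at this
    rw [this, hq, hτ]
    ring
  · have h := hQ.ncard_code hinj hrange hL hle hlt
    have h4 : 4 ^ (2 * j + 3) = 2 * 2 ^ (4 * j + 5) := by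
      rw [show 4 ^ (2 * j + 3) = (2 ^ 2) ^ (2 * j + 3) by norm_num, ← pow_mul,
        show 2 * (2 * j + 3) = 4 * j + 5 + 1 by ring, pow_succ, mul_comm]
    rw [h4] at h
    omega
  · have h := hQ.hasMinLeeDist hinj hrange (by norm_num) hL hle hlt ?_
    · convert h using 3
      rw [hq]
      push_cast
      rfl
    · have hp' : ((2 ^ j : ℕ) : ℤ) = 2 ^ j := by push_cast; rfl
      have n1 : (2 ^ j * e : ℤ) ≠ 2 * 2 ^ j := by rcases he' with h | h <;> rw [h] <;> omega
      have n2 : -(2 ^ j * e : ℤ) ≠ 2 * 2 ^ j := by rcases he' with h | h <;> rw [h] <;> omega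
      simp only [L, List.map_cons, List.map_nil, List.sum_cons, List.sum_nil, hp']
      rw [if_neg n1, if_neg n2, if_neg (by omega), if_neg (by omega), if_neg (by omega),
        if_neg (by omega), if_true, if_neg (by omega)]
      have hpos : (0 : ℤ) < 2 * (2 ^ j) ^ 2 * (4 * (2 ^ j) ^ 2 - 3 + sigmaInt (2 * j + 3)) -
          2 ^ j * (8 * (2 ^ j) ^ 2 - 4) * e := by
        rw [hk]
        rcases he' with h | h <;> rcases sigmaInt_eq_or (2 * j + 3) with h' | h' <;>
          rw [h, h'] <;> ring_nf <;> positivity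
      have hne : ((2 * (2 ^ j) ^ 2 * (4 * (2 ^ j) ^ 2 - 3 + sigmaInt (2 * j + 3)) -
          2 ^ j * (8 * (2 ^ j) ^ 2 - 4) * e : ℤ) : ℂ) ≠ 0 := Int.cast_ne_zero.2 hpos.ne'
      intro h0
      apply hne
      push_cast
      rw [← hq, ← hσ, ← hτ]
      linear_combination 4 * h0
  · have h := hQ.hasLeeDistribution hinj hrange (by norm_num) hL hle hlt
    convert h using 2
    simp only [L, List.map_cons, List.map_nil]
    push_cast
    rw [← hq, ← hτ]
    simp only [sub_neg_eq_add, sub_zero]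

theorem parameters_odd (hQ : IsTraceForm (2 * j + 3) Q) (hj : j ≠ 0) {t : ZMod 4}
    (ht : 2 * t = 2) (hinj : Function.Injective d) (hrange : ∀ a, a ∈ Set.range d ↔ Q a = t)
    {q ε : ℂ} (hq : q = 2 ^ j) (hε : ε = sgn (((j + 1 : ℕ) : ZMod 4) - t)) :
    (n : ℂ) = 2 * q ^ 2 + q * ε ∧
    (Set.range (codeword Q d)).ncard = 4 ^ (2 * j + 3) ∧
    HasMinLeeDist (Set.range (codeword Q d)) (n - 2 * q) ∧
    ∀ s : ℤ, s = 1 ∨ s = -1 → HasLeeDistribution (Set.range (codeword Q d))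
      [ (0, 1),
        (n + n, 1),
        (n - q * ε, 4 * q ^ 2 - 1),
        (n + q * ε, 4 * q ^ 2 - 1),
        (n, (8 * q ^ 2 - 2) * (3 * q ^ 2 - q * ε) + 8 * q ^ 2),
        (n + q * s, 2 * q ^ 2 * (8 * q ^ 2 - 2)),
        (n - q * s, 2 * q ^ 2 * (8 * q ^ 2 - 2)),
        (n + 2 * q * s, (8 * q ^ 2 - 2) * (q ^ 2 / 2 + q / 2 * ε)),
        (n - 2 * q * s, (8 * q ^ 2 - 2) * (q ^ 2 / 2 + q / 2 * ε)) ] := by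
  classical
  have hlen := hQ.length_eq hinj hrange
  have hlt := hQ.two_mul_lt_length hj hinj hrange
  obtain ⟨k, hk⟩ := two_le_two_pow hj
  have hp : (0 : ℤ) < 2 ^ j := by positivity
  set e := sgn (((j + 1 : ℕ) : ZMod 4) - t) with he
  have he' : e = 1 ∨ e = -1 := sgn_eq_or _
  -- The sign s orders the rows written with ±: in the final table the factor i^(t-1) = ±1
  -- interchanges upper and lower signs.
  let L : ℤ → List (ℤ × ℂ) := fun s => [(-n, 1), (2 ^ j * e, 4 * q ^ 2 - 1),
    (-(2 ^ j * e), 4 * q ^ 2 - 1),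
    (0, (8 * q ^ 2 - 2) * (3 * q ^ 2 - q * ε) + 8 * q ^ 2),
    (-(2 ^ j * s), 2 * q ^ 2 * (8 * q ^ 2 - 2)), (2 ^ j * s, 2 * q ^ 2 * (8 * q ^ 2 - 2)),
    (-(2 * 2 ^ j * s), (8 * q ^ 2 - 2) * (q ^ 2 / 2 + q / 2 * ε)),
    (2 * 2 ^ j * s, (8 * q ^ 2 - 2) * (q ^ 2 / 2 + q / 2 * ε))]
  have hL : ∀ s : ℤ, s = 1 ∨ s = -1 → ∀ f : ℤ → ℂ, ∑ u, f (fiberSum Q t u).re =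
      (1 : ℕ) * (f n + ((L s).map fun r => r.2 * f r.1).sum) := by
    intro s hs f
    rw [hQ.sum_apply_fiberSum_odd ht f hq he (n := n) (by rw [card_fiber_eq hinj hrange])]
    simp only [L, List.map_cons, List.map_nil, List.sum_cons, List.sum_nil, hε]
    rcases hs with rfl | rfl <;> simp only [mul_one, mul_neg_one, neg_neg] <;> push_cast <;> ring
  have hle : ∀ s : ℤ, s = 1 ∨ s = -1 → ∀ r ∈ L s, r.1 ≤ 2 * (2 ^ j : ℕ) := by
    intro s hs
    simp only [L, List.forall_mem_cons, List.not_mem_nil, false_imp_iff, implies_true, and_true]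
    push_cast
    rcases he' with h | h <;> rw [h] <;> rcases hs with rfl | rfl <;>
      refine ⟨?_, ?_, ?_, ?_, ?_, ?_, ?_, ?_⟩ <;> linarith
  refine ⟨?_, ?_, ?_, fun s hs => ?_⟩
  · have := congrArg (Int.cast : ℤ → ℂ) hlen
    push_cast at this
    rw [this, hq, hε]
    ring
  · have h := hQ.ncard_code hinj hrange (hL 1 (Or.inl rfl)) (hle 1 (Or.inl rfl)) hlt
    rwa [one_mul] at h
  · have h := hQ.hasMinLeeDist hinj hrange one_ne_zero (hL 1 (Or.inl rfl)) (hle 1 (Or.inl rfl))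
      hlt ?_
    · convert h using 3
      rw [hq]
      push_cast
      rfl
    · have hp' : ((2 ^ j : ℕ) : ℤ) = 2 ^ j := by push_cast; rfl
      have n1 : (2 ^ j * e : ℤ) ≠ 2 * 2 ^ j := by rcases he' with h | h <;> rw [h] <;> omega
      have n2 : -(2 ^ j * e : ℤ) ≠ 2 * 2 ^ j := by rcases he' with h | h <;> rw [h] <;> omega
      simp only [L, List.map_cons, List.map_nil, List.sum_cons, List.sum_nil, hp', mul_one]
      rw [if_neg n1, if_neg n2, if_neg (by omega), if_neg (by omega), if_neg (by omega),
        if_neg (by omega), if_neg (by omega), if_true]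
      have hpos : (0 : ℤ) < (8 * (2 ^ j) ^ 2 - 2) * ((2 ^ j) ^ 2 + 2 ^ j * e) := by
        rw [hk]
        rcases he' with h | h <;> rw [h] <;> ring_nf <;> positivity
      have hne : (((8 * (2 ^ j) ^ 2 - 2) * ((2 ^ j) ^ 2 + 2 ^ j * e) : ℤ) : ℂ) ≠ 0 :=
        Int.cast_ne_zero.2 hpos.ne'
      intro h0
      apply hne
      push_cast
      rw [← hq, ← hε]
      linear_combination 2 * h0
  · have h := hQ.hasLeeDistribution hinj hrange one_ne_zero (hL s hs) (hle s hs) hlt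
    convert h using 2
    simp only [L, List.map_cons, List.map_nil]
    push_cast
    rw [← hq, ← hε]
    simp only [sub_neg_eq_add, sub_zero]

end IsTraceForm

end GaloisZ4

theorem theorem1 (m : ℕ) (hm : 3 < m) (hodd : Odd m)
    (h : (ZMod 4)[X]) (hh : GaloisZ4.IsBasicIrreducible h) (hdeg : h.natDegree = m)
    (τ σ : ℂ) (hτ : τ = GaloisZ4.tau m) (hσ : σ = GaloisZ4.sigma m) :
    -- the case `t = 0`
    (∀ (n : ℕ) (d : Fin n → AdjoinRoot h),
      GaloisZ4.Enumerates d (GaloisZ4.traceFiber m (AdjoinRoot h) 0) →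
        (n : ℂ) = 2 ^ (m - 2) + 2 ^ ((m - 3) / 2) * τ ∧
        (GaloisZ4.code m d).ncard = 4 ^ (m - 1) ∧
        GaloisZ4.HasMinLeeDist (GaloisZ4.code m d)
          (2 ^ (m - 2) + 2 ^ ((m - 3) / 2) * (τ - 2)) ∧
        GaloisZ4.HasLeeDistribution (GaloisZ4.code m d)
          [ (0, 1),
            (2 ^ (m - 2), 2 ^ (m - 2) + 2 ^ ((m - 3) / 2) * τ - 1),
            (2 ^ (m - 2) + 2 ^ ((m - 1) / 2) * τ, 2 ^ (m - 2) - 2 ^ ((m - 3) / 2) * τ),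
            (2 ^ (m - 2) + 2 ^ ((m - 3) / 2) * τ,
              2 ^ (m - 4) * (3 * 2 ^ (m - 1) - 5 + 3 * σ)
                - 2 ^ ((m - 3) / 2) * (2 ^ (m - 2) - 1) * τ),
            (2 ^ (m - 2) + 2 ^ ((m - 3) / 2) * (τ + 1),
              2 ^ (m - 3) * (2 ^ (m - 1) - 2 ^ ((m + 1) / 2) - 1 - σ + 2 * τ)),
            (2 ^ (m - 2) + 2 ^ ((m - 3) / 2) * (τ - 1),
              2 ^ (m - 3) * (2 ^ (m - 1) + 2 ^ ((m + 1) / 2) - 1 - σ - 2 * τ)),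
            (2 ^ (m - 2) + 2 ^ ((m - 3) / 2) * (τ + 2),
              2 ^ (m - 5) * (2 ^ (m - 1) + 1 + σ - 4 * τ)
                + 2 ^ ((m - 5) / 2) * (2 ^ (m - 2) - 1) * (τ - 2)),
            (2 ^ (m - 2) + 2 ^ ((m - 3) / 2) * (τ - 2),
              2 ^ (m - 5) * (2 ^ (m - 1) + 1 + σ + 4 * τ)
                + 2 ^ ((m - 5) / 2) * (2 ^ (m - 2) - 1) * (τ + 2)) ]) ∧
    -- the case `t = 2`
    (∀ (n : ℕ) (d : Fin n → AdjoinRoot h),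
      GaloisZ4.Enumerates d (GaloisZ4.traceFiber m (AdjoinRoot h) 2) →
        (n : ℂ) = 2 ^ (m - 2) - 2 ^ ((m - 3) / 2) * τ ∧
        (GaloisZ4.code m d).ncard = 2 ^ (2 * m - 1) ∧
        GaloisZ4.HasMinLeeDist (GaloisZ4.code m d)
          (2 ^ (m - 2) - 2 ^ ((m - 3) / 2) * (τ + 2)) ∧
        GaloisZ4.HasLeeDistribution (GaloisZ4.code m d)
          [ (0, 1),
            (2 ^ (m - 2), 2 ^ (m - 1) - 1),
            (2 ^ (m - 1) - 2 ^ ((m - 1) / 2) * τ, 1),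
            (2 ^ (m - 2) - 2 ^ ((m - 1) / 2) * τ, 2 ^ (m - 1) - 1),
            (2 ^ (m - 2) - 2 ^ ((m - 3) / 2) * τ,
              2 ^ (m - 3) * (3 * 2 ^ (m - 1) - 1 + 3 * σ)
                + 2 ^ ((m - 1) / 2) * (2 ^ (m - 2) - 1) * τ),
            (2 ^ (m - 2) - 2 ^ ((m - 3) / 2) * (τ + 1),
              2 ^ (m - 2) * (2 ^ (m - 1) - 1 - σ)),
            (2 ^ (m - 2) - 2 ^ ((m - 3) / 2) * (τ - 1),
              2 ^ (m - 2) * (2 ^ (m - 1) - 1 - σ)),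
            (2 ^ (m - 2) - 2 ^ ((m - 3) / 2) * (τ + 2),
              2 ^ (m - 4) * (2 ^ (m - 1) - 3 + σ)
                - (2 : ℂ) ^ (((m : ℤ) - 7) / 2) * (2 ^ m - 4) * τ),
            (2 ^ (m - 2) - 2 ^ ((m - 3) / 2) * (τ - 2),
              2 ^ (m - 4) * (2 ^ (m - 1) - 3 + σ)
                - (2 : ℂ) ^ (((m : ℤ) - 7) / 2) * (2 ^ m - 4) * τ) ]) ∧
    -- the parameters for `t = 1`
    (∀ (n : ℕ) (d : Fin n → AdjoinRoot h),
      GaloisZ4.Enumerates d (GaloisZ4.traceFiber m (AdjoinRoot h) 1) →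
        (n : ℂ) = 2 ^ (m - 2) + 2 ^ ((m - 3) / 2) * Complex.I ^ (m - 1) * τ ∧
        (GaloisZ4.code m d).ncard = 4 ^ m ∧
        GaloisZ4.HasMinLeeDist (GaloisZ4.code m d)
          (2 ^ (m - 2) + 2 ^ ((m - 3) / 2) * (Complex.I ^ (m - 1) * τ - 2))) ∧
    -- the parameters for `t = 3`
    (∀ (n : ℕ) (d : Fin n → AdjoinRoot h),
      GaloisZ4.Enumerates d (GaloisZ4.traceFiber m (AdjoinRoot h) 3) →
        (n : ℂ) = 2 ^ (m - 2) - 2 ^ ((m - 3) / 2) * Complex.I ^ (m - 1) * τ ∧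
        (GaloisZ4.code m d).ncard = 4 ^ m ∧
        GaloisZ4.HasMinLeeDist (GaloisZ4.code m d)
          (2 ^ (m - 2) - 2 ^ ((m - 3) / 2) * (Complex.I ^ (m - 1) * τ + 2))) ∧
    -- the Lee weight distribution for `t = 1` and `t = 3`
    (∀ (t : ℕ), t = 1 ∨ t = 3 → ∀ (n : ℕ) (d : Fin n → AdjoinRoot h),
      GaloisZ4.Enumerates d (GaloisZ4.traceFiber m (AdjoinRoot h) (t : ZMod 4)) →
        GaloisZ4.HasLeeDistribution (GaloisZ4.code m d)
          [ (0, 1),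
            (2 ^ (m - 1) - 2 ^ ((m - 1) / 2) * Complex.I ^ (m + t) * τ, 1),
            (2 ^ (m - 2), 2 ^ (m - 1) - 1),
            (2 ^ (m - 2) - 2 ^ ((m - 1) / 2) * Complex.I ^ (m + t) * τ, 2 ^ (m - 1) - 1),
            (2 ^ (m - 2) - 2 ^ ((m - 3) / 2) * Complex.I ^ (m + t) * τ,
              (2 ^ m - 2) * (3 * 2 ^ (m - 3) + 2 ^ ((m - 3) / 2) * Complex.I ^ (m + t) * τ)
                + 2 ^ m),
            (2 ^ (m - 2)
                + 2 ^ ((m - 3) / 2) * Complex.I ^ (t - 1) * (Complex.I ^ (m - 1) * τ + 1),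
              2 ^ (m - 2) * (2 ^ m - 2)),
            (2 ^ (m - 2)
                + 2 ^ ((m - 3) / 2) * Complex.I ^ (t - 1) * (Complex.I ^ (m - 1) * τ - 1),
              2 ^ (m - 2) * (2 ^ m - 2)),
            (2 ^ (m - 2)
                + 2 ^ ((m - 3) / 2) * Complex.I ^ (t - 1) * (Complex.I ^ (m - 1) * τ + 2),
              (2 ^ m - 2) * (2 ^ (m - 4) - 2 ^ ((m - 5) / 2) * Complex.I ^ (m + t) * τ)),
            (2 ^ (m - 2)
                + 2 ^ ((m - 3) / 2) * Complex.I ^ (t - 1) * (Complex.I ^ (m - 1) * τ - 2),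
              (2 ^ m - 2) * (2 ^ (m - 4) - 2 ^ ((m - 5) / 2) * Complex.I ^ (m + t) * τ)) ]) := by
  obtain ⟨i, rfl⟩ : ∃ i, m = 2 * (i + 1) + 3 := by
    obtain ⟨k, rfl⟩ := hodd
    exact ⟨k - 2, by omega⟩
  obtain ⟨F, _, _, π, hπ⟩ := hh.exists_isResidueMap hdeg
  have hQ := hπ.isTraceForm
  have hi : i + 1 ≠ 0 := Nat.succ_ne_zero i
  rw [GaloisZ4.tau_eq] at hτ
  rw [GaloisZ4.sigma_eq] at hσ
  obtain ⟨q, hq⟩ : ∃ q : ℂ, q = 2 ^ (i + 1) := ⟨_, rfl⟩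
  have p0 : (2 : ℂ) ^ (2 * (i + 1) + 3) = 8 * q ^ 2 := by rw [hq]; ring
  have p1 : (2 : ℂ) ^ (2 * (i + 1) + 3 - 1) = 4 * q ^ 2 := by
    rw [hq, show 2 * (i + 1) + 3 - 1 = 2 * i + 4 by omega]; ring
  have p2 : (2 : ℂ) ^ (2 * (i + 1) + 3 - 2) = 2 * q ^ 2 := by
    rw [hq, show 2 * (i + 1) + 3 - 2 = 2 * i + 3 by omega]; ring
  have p3 : (2 : ℂ) ^ (2 * (i + 1) + 3 - 3) = q ^ 2 := by
    rw [hq, show 2 * (i + 1) + 3 - 3 = 2 * i + 2 by omega]; ring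
  have p4 : (2 : ℂ) ^ (2 * (i + 1) + 3 - 4) = q ^ 2 / 2 := by
    rw [hq, show 2 * (i + 1) + 3 - 4 = 2 * i + 1 by omega]; ring
  have p5 : (2 : ℂ) ^ (2 * (i + 1) + 3 - 5) = q ^ 2 / 4 := by
    rw [hq, show 2 * (i + 1) + 3 - 5 = 2 * i by omega]; ring
  have r1 : (2 : ℂ) ^ ((2 * (i + 1) + 3 + 1) / 2) = 4 * q := by
    rw [hq, show (2 * (i + 1) + 3 + 1) / 2 = i + 3 by omega]; ring
  have r2 : (2 : ℂ) ^ ((2 * (i + 1) + 3 - 1) / 2) = 2 * q := by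
    rw [hq, show (2 * (i + 1) + 3 - 1) / 2 = i + 2 by omega]; ring
  have r3 : (2 : ℂ) ^ ((2 * (i + 1) + 3 - 3) / 2) = q := by
    rw [hq, show (2 * (i + 1) + 3 - 3) / 2 = i + 1 by omega]
  have r5 : (2 : ℂ) ^ ((2 * (i + 1) + 3 - 5) / 2) = q / 2 := by
    rw [hq, show (2 * (i + 1) + 3 - 5) / 2 = i by omega]; ring
  -- For m = 5 the exponent (m-7)/2 is -1, so an integer power is needed.
  have r7 : (2 : ℂ) ^ ((((2 * (i + 1) + 3 : ℕ) : ℤ) - 7) / 2) = q / 4 := by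
    rw [hq, show (((2 * (i + 1) + 3 : ℕ) : ℤ) - 7) / 2 = i - 1 by omega, zpow_sub₀ two_ne_zero,
      zpow_natCast]
    ring
  simp only [p0, p1, p2, p3, p4, p5, r1, r2, r3, r5, r7]
  have hI : ∀ t : ℕ, t = 1 ∨ t = 3 → Complex.I ^ (2 * (i + 1) + 3 + t) * τ =
      -(GaloisZ4.sgn (((i + 1 + 1 : ℕ) : ZMod 4) - (t : ZMod 4)) : ℂ) := by
    intro t ht
    rw [hτ, GaloisZ4.I_pow_mul_sgn _ _ ht]
  have hI1 : Complex.I ^ (2 * (i + 1) + 3 - 1) * τ =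
      (GaloisZ4.sgn (((i + 1 + 1 : ℕ) : ZMod 4) - 1) : ℂ) := by
    have h1 := hI 1 (Or.inl rfl)
    rw [Nat.cast_one, show 2 * (i + 1) + 3 + 1 = 2 * (i + 1) + 3 - 1 + 2 by omega, pow_add,
      Complex.I_sq] at h1
    linear_combination -h1
  have hI3 : Complex.I ^ (2 * (i + 1) + 3 - 1) * τ =
      -(GaloisZ4.sgn (((i + 1 + 1 : ℕ) : ZMod 4) - 3) : ℂ) := by
    have h3 := hI 3 (Or.inr rfl)
    rwa [Nat.cast_ofNat, show 2 * (i + 1) + 3 + 3 = 2 * (i + 1) + 3 - 1 + 4 by omega, pow_add,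
      Complex.I_pow_four, mul_one] at h3
  refine ⟨fun n d hd => ?_, fun n d hd => ?_, fun n d hd => ?_, fun n d hd => ?_,
    fun t ht n d hd => ?_⟩ <;> obtain ⟨d', hinj, hrange, hC⟩ := hπ.exists_code_eq hd <;> rw [hC]
  · obtain ⟨hn, hcard, hdist, hdistr⟩ := hQ.parameters_zero hi hinj hrange hq hτ hσ
    rw [hn] at hdist hdistr
    refine ⟨hn, hcard, (congrArg _ ?_).mp hdist, (congrArg _ ?_).mp hdistr⟩
    · ring
    · simp only [List.cons.injEq, Prod.mk.injEq, and_true, true_and]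
      repeat' apply And.intro
      all_goals ring
  · obtain ⟨hn, hcard, hdist, hdistr⟩ := hQ.parameters_two hi hinj hrange hq hτ hσ
    rw [hn] at hdist hdistr
    refine ⟨hn, ?_, (congrArg _ ?_).mp hdist, (congrArg _ ?_).mp hdistr⟩
    · rw [show 2 * (2 * (i + 1) + 3) - 1 = 4 * (i + 1) + 5 by omega]
      exact hcard
    · ring
    · simp only [List.cons.injEq, Prod.mk.injEq, and_true, true_and]
      repeat' apply And.intro
      all_goals ring
  · obtain ⟨hn, hcard, hdist, -⟩ := hQ.parameters_odd hi (by decide) hinj hrange hq hI1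
    rw [hn] at hdist
    refine ⟨by rw [hn]; ring, hcard, (congrArg _ ?_).mp hdist⟩
    ring
  · obtain ⟨hn, hcard, hdist, -⟩ := hQ.parameters_odd hi (by decide) hinj hrange hq
      (neg_eq_iff_eq_neg.2 hI3)
    rw [hn] at hdist
    refine ⟨by rw [hn]; ring, hcard, (congrArg _ ?_).mp hdist⟩
    ring
  · have ht2 : 2 * (t : ZMod 4) = 2 := by rcases ht with rfl | rfl <;> rfl
    obtain ⟨hn, -, -, hdistr⟩ := hQ.parameters_odd hi ht2 hinj hrange hq
      (neg_eq_iff_eq_neg.2 (hI t ht))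
    -- Here s = i^(t-1), and s·i^(m-1) = -i^(m+t) because the exponents m+t-2 and m+t differ by 2.
    obtain ⟨s, hs, hIs, hIt⟩ : ∃ s : ℤ, (s = 1 ∨ s = -1) ∧ Complex.I ^ (t - 1) = s ∧
        s * (Complex.I ^ (2 * (i + 1) + 3 - 1) * τ) =
          -(Complex.I ^ (2 * (i + 1) + 3 + t) * τ) := by
      rcases ht with rfl | rfl
      · refine ⟨1, Or.inl rfl, by simp, ?_⟩
        rw [hI1, hI 1 (Or.inl rfl), Nat.cast_one, Int.cast_one]
        ring
      · refine ⟨-1, Or.inr rfl, by simp, ?_⟩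
        rw [hI3, hI 3 (Or.inr rfl), Nat.cast_ofNat, Int.cast_neg, Int.cast_one]
        ring
    have hdistr := hdistr s hs
    rw [hn] at hdistr
    refine (congrArg _ ?_).mp hdistr
    simp only [List.cons.injEq, Prod.mk.injEq, and_true, true_and, hIs]
    repeat' apply And.intro
    all_goals first | ring1 | linear_combination (-q) * hIt
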